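/- Let $K$ be a division ring and let $V\subsetneq K$ be a total valuation ring of $K$, i.e. a subring such that $k\in V$ or $k^{-1}\in V$ for every nonzero $k\in K$. Let $\sigma:\mathbb Q\to \mathrm{Aut}(K)$ be a group homomorphism into the group of ring automorphisms of $K$, and let $K[\mathbb Q,\sigma]$ be the skew group ring, whose elements are finite sums $\sum a_rX^r$ with $X^rb=\sigma(r)(b)X^r$. Notation. For subsets $I$ of $K$ write $I^{\sigma(r)}=\sigma(r)(I)$. For additive subgroups $I,J$ of $K$, $IJ$ is the additive subgroup generated by the products $xy$ with $x\in I$, $y\in J$; $O_l(I)=\{a\in K: aI\subseteq I\}$, $O_r(I)=\{a\in K: Ia\subseteq I\}$; and ${}^\ast I=\bigcap\{Uc : c\in K,\ I\subseteq Uc\}$ with $U=O_l(I)$. $J(W)$ is the Jacobson radical of a ring $W$. For a subgroup $G$ of $\mathbb Q$ and additive subgroups $A_g$ $(g\in G)$ of $K$, $\bigoplus_{g\in G}A_gX^g$ is called a graded extension of $V$ in $K[G,\sigma|_G]$ if it is a subring of $K[G,\sigma|_G]$ that contains $aX^g$ or $(aX^g)^{-1}$ for all $g\in G$ and all nonzero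 $a\in K$, and $A_0=V$. Such a graded extension is of Type (II) if there are $g,h>0$ in $G$ with $A_gA_h^{\sigma(g)}\ne A_{g+h}$ or $A_{-g}A_{-h}^{\sigma(-g)}\neq A_{-g-h}$. A graded extension $\bigoplus_{r\in\mathbb Q}A_rX^r$ of $V$ in $K[\mathbb Q,\sigma]$ is of Type (h) if for some $r>0$ the graded extension $\bigoplus_{i\in\mathbb Z}A_{ir}X^{ir}$ of $V$ in $K[\mathbb Zr,\sigma|_{\mathbb Zr}]$ is of Type (II), and $J(W)^2=J(W)$ for $W=\bigcup_{s\in\mathbb Q}O_l(A_s)$. Theorem. Let $A=\bigoplus_{r\in\mathbb Q}A_rX^r$ be an additive subgroup of $K[\mathbb Q,\sigma]$ (with each $A_r$ an additive subgroup of $K$) such that $A_0=V$. Let $W=\bigcup_{r\in\mathbb Q}O_l(A_r)$, and assume that $O_l(A_t)=W$ for some $t\in\mathbb Q$ (so that $W$ is a ring) and that $J(W)^2=J(W)$. Let $$H=\{r\in\mathbb Q : {}^\ast(J(W)A_r)=Wc \text{ for some } c\in K\}.$$ Then $A$ is a graded extension of $V$ in $K[\mathbb Q,\sigma]$ of Type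 (h) if and only if there are elements $c_s\in K$ such that for all $r,s\in H$ $${}^\ast(J(W)A_s)=Wc_s=c_sW^{\sigma(s)},\qquad Wc_{-s}=W(c_s^{-1})^{\sigma(-s)},\qquad (Wc_r)(Wc_s)^{\sigma(r)}=Wc_{r+s},$$ and the following hold: (1) $H$ is a nonzero proper subgroup of $\mathbb Q$, and $\bigoplus_{s\in H}A_sX^s$ is a graded extension of $V$ in $K[H,\sigma|_H]$. (2) For every $s\in\mathbb Q\setminus H$: ${}^\ast A_s=A_s=WA_s$, $A_s\neq Wa$ for all $a\in K$, and $O_r(A_s)=W^{\sigma(s)}$. (3) $$M=V\oplus\Big(\bigoplus_{s\in H,\,s<0}Wc_sX^s\Big)\oplus\Big(\bigoplus_{s\in H,\,s>0}J(W)c_sX^s\Big)\oplus\Big(\bigoplus_{r\in\mathbb Q\setminus H}A_rX^r\Big)$$ is a graded extension of $V$ in $K[\mathbb Q,\sigma]$. -/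

import Mathlib

open scoped Pointwise

noncomputable section

/-- A subring `V` of a division ring `K` is a total valuation ring of `K` if for every nonzero
`k ∈ K` either `k ∈ V` or `k⁻¹ ∈ V`. -/
def IsTotalValuationRing {K : Type*} [DivisionRing K] (V : Subring K) : Prop :=
  ∀ k : K, k ≠ 0 → k ∈ V ∨ k⁻¹ ∈ V

/-! ### Additive subgroups of a division ring

Products of additive subgroups are Mathlib's pointwise products: `I * J` is the additive subgroup
generated by all `x * y` with `x ∈ I`, `y ∈ J`. -/

/-- `O_l(I) = {a ∈ K | a I ⊆ I}`, as a subring of `K`. -/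
def leftOrder {K : Type*} [DivisionRing K] (I : AddSubgroup K) : Subring K where
  carrier := {a | ∀ x ∈ I, a * x ∈ I}
  mul_mem' {a b} ha hb x hx := by
    rw [mul_assoc]
    exact ha _ (hb _ hx)
  one_mem' x hx := by simpa using hx
  add_mem' {a b} ha hb x hx := by
    rw [add_mul]
    exact I.add_mem (ha _ hx) (hb _ hx)
  zero_mem' x hx := by simp
  neg_mem' {a} ha x hx := by
    rw [neg_mul]
    exact I.neg_mem (ha _ hx)

/-- `O_r(I) = {a ∈ K | I a ⊆ I}`, as a subring of `K`. -/
def rightOrder {K : Type*} [DivisionRing K] (I : AddSubgroup K) : Subring K where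
  carrier := {a | ∀ x ∈ I, x * a ∈ I}
  mul_mem' {a b} ha hb x hx := by
    rw [← mul_assoc]
    exact hb _ (ha _ hx)
  one_mem' x hx := by simpa using hx
  add_mem' {a b} ha hb x hx := by
    rw [mul_add]
    exact I.add_mem (ha _ hx) (hb _ hx)
  zero_mem' x hx := by simp
  neg_mem' {a} ha x hx := by
    rw [mul_neg]
    exact I.neg_mem (ha _ hx)

/-- `I c = {x * c | x ∈ I}`. -/
def mulElem {K : Type*} [DivisionRing K] (I : AddSubgroup K) (c : K) : AddSubgroup K :=
  I.map (AddMonoidHom.mulRight c)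

/-- `c I = {c * x | x ∈ I}`. -/
def elemMul {K : Type*} [DivisionRing K] (c : K) (I : AddSubgroup K) : AddSubgroup K :=
  I.map (AddMonoidHom.mulLeft c)

/-- `*I`: the intersection of all `U c`, `c ∈ K`, that contain `I`, where `U = O_l(I)`. -/
def leftStar {K : Type*} [DivisionRing K] (I : AddSubgroup K) : AddSubgroup K :=
  sInf {L | ∃ c : K, L = mulElem (leftOrder I).toAddSubgroup c ∧ I ≤ L}

/-- The Jacobson radical `J(W)` of a subring `W` of `K`, as an additive subgroup of `K`. -/
def jacobsonRad {K : Type*} [DivisionRing K] (W : Subring K) : AddSubgroup K :=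
  (Ring.jacobson W).toAddSubgroup.map W.subtype.toAddMonoidHom

/-- `W` is the union of the left orders `O_l(A_r)`. -/
def IsUnionOfLeftOrders {K : Type*} [DivisionRing K] {ι : Type*} (A : ι → AddSubgroup K)
    (W : Subring K) : Prop :=
  (W : Set K) = ⋃ r, (leftOrder (A r) : Set K)

/-! ### The skew group ring

A homomorphism from an additive group `G` to `Aut(K)` is a monoid homomorphism
`σ : Multiplicative G →* RingAut K`. -/

/-- The automorphism `σ(g)` of `K`. -/
def autAt {K G : Type*} [DivisionRing K] [AddCommGroup G]
    (σ : Multiplicative G →* RingAut K) (g : G) : RingAut K :=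
  σ (Multiplicative.ofAdd g)

/-- The image `I^{σ(g)} = σ(g)(I)`. -/
def imageAt {K G : Type*} [DivisionRing K] [AddCommGroup G]
    (σ : Multiplicative G →* RingAut K) (g : G) (I : AddSubgroup K) : AddSubgroup K :=
  I.map (autAt σ g : K ≃+* K).toAddEquiv.toAddMonoidHom

/-- The restriction `σ|_H` to a subgroup `H`. -/
def restrictHom {K G : Type*} [DivisionRing K] [AddCommGroup G]
    (σ : Multiplicative G →* RingAut K) (H : AddSubgroup G) : Multiplicative H →* RingAut K :=
  σ.comp (AddMonoidHom.toMultiplicative H.subtype)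

/-- The skew group ring `K[G, σ]`: finite sums `∑ a_g X^g` with `X^g b = σ(g)(b) X^g`. -/
def SkewGroupRing {K G : Type*} [DivisionRing K] [AddCommGroup G]
    (_σ : Multiplicative G →* RingAut K) : Type _ :=
  SkewMonoidAlgebra K (Multiplicative G)

instance SkewGroupRing.instRing {K G : Type*} [DivisionRing K] [AddCommGroup G]
    (σ : Multiplicative G →* RingAut K) : Ring (SkewGroupRing σ) :=
  letI : MulSemiringAction (Multiplicative G) K := MulSemiringAction.compHom K σ
  inferInstanceAs (Ring (SkewMonoidAlgebra K (Multiplicative G)))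

namespace SkewGroupRing

/-- The monomial `a X^g`. -/
def monomial {K G : Type*} [DivisionRing K] [AddCommGroup G]
    (σ : Multiplicative G →* RingAut K) (g : G) (a : K) : SkewGroupRing σ :=
  SkewMonoidAlgebra.single (Multiplicative.ofAdd g) a

/-- The coefficient of `X^g`. -/
def coeffAt {K G : Type*} [DivisionRing K] [AddCommGroup G]
    {σ : Multiplicative G →* RingAut K} (f : SkewGroupRing σ) (g : G) : K :=
  SkewMonoidAlgebra.coeff f (Multiplicative.ofAdd g)

theorem coeffAt_zero {K G : Type*} [DivisionRing K] [AddCommGroup G]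
    {σ : Multiplicative G →* RingAut K} (g : G) : coeffAt (0 : SkewGroupRing σ) g = 0 := by
  rfl

theorem coeffAt_add {K G : Type*} [DivisionRing K] [AddCommGroup G]
    {σ : Multiplicative G →* RingAut K} (f f' : SkewGroupRing σ) (g : G) :
    coeffAt (f + f') g = coeffAt f g + coeffAt f' g := by
  let : MulSemiringAction (Multiplicative G) K := MulSemiringAction.compHom K σ
  exact DFunLike.congr_fun
    (SkewMonoidAlgebra.coeff_add (k := K) (G := Multiplicative G) f f') (Multiplicative.ofAdd g)

theorem coeffAt_neg {K G : Type*} [DivisionRing K] [AddCommGroup G]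
    {σ : Multiplicative G →* RingAut K} (f : SkewGroupRing σ) (g : G) :
    coeffAt (-f) g = -coeffAt f g := by
  have h : coeffAt (-f + f) g = 0 := by rw [neg_add_cancel, coeffAt_zero]
  rw [coeffAt_add] at h
  exact eq_neg_of_add_eq_zero_left h

theorem monomial_mul_monomial {K G : Type*} [DivisionRing K] [AddCommGroup G]
    (σ : Multiplicative G →* RingAut K) (g h : G) (a b : K) :
    monomial σ g a * monomial σ h b = monomial σ (g + h) (a * autAt σ g b) := by
  let : MulSemiringAction (Multiplicative G) K := MulSemiringAction.compHom K σ
  exact SkewMonoidAlgebra.single_mul_single (k := K) (G := Multiplicative G)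

theorem monomial_zero_one {K G : Type*} [DivisionRing K] [AddCommGroup G]
    (σ : Multiplicative G →* RingAut K) : monomial σ 0 1 = 1 := by
  rfl

/-- A nonzero homogeneous element `a X^g` is a unit of `K[G, σ]`, with inverse
`X^{-g} a⁻¹ = σ(-g)(a⁻¹) X^{-g}`. -/
def monomialUnit {K G : Type*} [DivisionRing K] [AddCommGroup G]
    (σ : Multiplicative G →* RingAut K) (g : G) (a : K) (ha : a ≠ 0) : (SkewGroupRing σ)ˣ where
  val := monomial σ g a
  inv := monomial σ (-g) (autAt σ (-g) a⁻¹)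
  val_inv := by
    have h : autAt σ g (autAt σ (-g) a⁻¹) = a⁻¹ := by
      have : autAt σ g * autAt σ (-g) = 1 := by
        rw [autAt, autAt, ← map_mul, ← ofAdd_add, add_neg_cancel, ofAdd_zero, map_one]
      exact DFunLike.congr_fun this a⁻¹
    rw [monomial_mul_monomial, h, add_neg_cancel, mul_inv_cancel₀ ha, monomial_zero_one]
  inv_val := by
    rw [monomial_mul_monomial, ← map_mul, inv_mul_cancel₀ ha, map_one, neg_add_cancel,
      monomial_zero_one]

/-- The additive subgroup `⨁ A_g X^g` of `K[G, σ]`. -/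
def homogeneousSum {K G : Type*} [DivisionRing K] [AddCommGroup G]
    (σ : Multiplicative G →* RingAut K) (A : G → AddSubgroup K) :
    AddSubgroup (SkewGroupRing σ) where
  carrier := {f | ∀ g, coeffAt f g ∈ A g}
  add_mem' {f f'} hf hf' g := by
    rw [coeffAt_add]
    exact (A g).add_mem (hf g) (hf' g)
  zero_mem' g := by
    rw [coeffAt_zero]
    exact (A g).zero_mem
  neg_mem' {f} hf g := by
    rw [coeffAt_neg]
    exact (A g).neg_mem (hf g)

end SkewGroupRing

/-! ### Graded extensions -/

/-- `⨁ A_g X^g` is a graded extension of `V` in `K[G, σ]`: it is a subring of `K[G, σ]` that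
contains `a X^g` or `(a X^g)⁻¹` for every nonzero homogeneous element `a X^g`, and `A_0 = V`. -/
def IsGradedExtension {K G : Type*} [DivisionRing K] [AddCommGroup G]
    (σ : Multiplicative G →* RingAut K) (V : Subring K) (A : G → AddSubgroup K) : Prop :=
  (∃ S : Subring (SkewGroupRing σ), S.toAddSubgroup = SkewGroupRing.homogeneousSum σ A ∧
    ∀ (g : G) (a : K) (ha : a ≠ 0),
      ((SkewGroupRing.monomialUnit σ g a ha : (SkewGroupRing σ)ˣ) : SkewGroupRing σ) ∈ S ∨
      (((SkewGroupRing.monomialUnit σ g a ha)⁻¹ : (SkewGroupRing σ)ˣ) : SkewGroupRing σ) ∈ S) ∧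
  A 0 = V.toAddSubgroup

/-- A graded extension of Type (II), for a group `G` of exponents with an order (such as a
subgroup of `ℚ`): for some `g, h > 0`, `A_g A_h^{σ(g)} ≠ A_{g+h}` or
`A_{-g} A_{-h}^{σ(-g)} ≠ A_{-g-h}`. -/
def IsTypeII {K G : Type*} [DivisionRing K] [AddCommGroup G] [PartialOrder G]
    (σ : Multiplicative G →* RingAut K) (V : Subring K) (A : G → AddSubgroup K) : Prop :=
  IsGradedExtension σ V A ∧
  ∃ g h : G, 0 < g ∧ 0 < h ∧
    (A g * imageAt σ g (A h) ≠ A (g + h) ∨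
      A (-g) * imageAt σ (-g) (A (-h)) ≠ A (-g - h))

/-- A graded extension `⨁ A_r X^r` of `V` in `K[ℚ, σ]` of Type (h): for some `r > 0` the part
`⨁_i A_{ir} X^{ir}` supported on `ℤ r` is of Type (II), and `J(W)² = J(W)`, where `W` is the
union of all `O_l(A_s)`. -/
def IsTypeH {K : Type*} [DivisionRing K] (σ : Multiplicative ℚ →* RingAut K) (V : Subring K)
    (A : ℚ → AddSubgroup K) : Prop :=
  IsGradedExtension σ V A ∧
  ∃ r : ℚ, 0 < r ∧
    IsTypeII (restrictHom σ (AddSubgroup.zmultiples r)) V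
      (fun s : AddSubgroup.zmultiples r => A s) ∧
    ∃ W : Subring K, IsUnionOfLeftOrders A W ∧ jacobsonRad W * jacobsonRad W = jacobsonRad W

/-- `H = {r | *(J(W) A_r) = W c for some c ∈ K}`. -/
def principalStarSet {K : Type*} [DivisionRing K] (W : Subring K) (A : ℚ → AddSubgroup K) :
    Set ℚ :=
  {r | ∃ c : K, leftStar (jacobsonRad W * A r) = mulElem W.toAddSubgroup c}

open Classical in
/-- The components of
`M = V ⊕ (⨁_{s ∈ H, s < 0} W c_s X^s) ⊕ (⨁_{s ∈ H, s > 0} J(W) c_s X^s) ⊕ (⨁_{r ∉ H} A_r X^r)`. -/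
def modifiedComponents {K : Type*} [DivisionRing K] (V W : Subring K) (H : Set ℚ) (c : ℚ → K)
    (A : ℚ → AddSubgroup K) (r : ℚ) : AddSubgroup K :=
  if r = 0 then V.toAddSubgroup
  else if r ∈ H then
    if r < 0 then mulElem W.toAddSubgroup (c r) else mulElem (jacobsonRad W) (c r)
  else A r

end

/-! ### Total cones in a `ℚ`-graded group -/

/-- A submonoid `P` of a `ℚ`-graded group `G` with `G = P ∪ P⁻¹`. -/
structure GradedCone (G : Type*) [Group G] where
  /-- The degree of an element. -/
  deg : G → ℚ
  deg_mul : ∀ x y, deg (x * y) = deg x + deg y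
  /-- The underlying set of the cone. -/
  P : Set G
  mul_mem : ∀ {x y}, x ∈ P → y ∈ P → x * y ∈ P
  total : ∀ x, x ∈ P ∨ x⁻¹ ∈ P

namespace GradedCone

variable {G : Type*} [Group G] (C : GradedCone G)

theorem deg_one : C.deg 1 = 0 := by
  have := C.deg_mul 1 1
  rw [mul_one] at this
  linarith

theorem deg_inv (x : G) : C.deg x⁻¹ = -C.deg x := by
  have := C.deg_mul x x⁻¹
  rw [mul_inv_cancel, deg_one] at this
  linarith

theorem deg_pow (x : G) (n : ℕ) : C.deg (x ^ n) = n * C.deg x := by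
  induction n with
  | zero => simp [deg_one]
  | succ n ih => rw [pow_succ, deg_mul, ih]; push_cast; ring

theorem one_mem : (1 : G) ∈ C.P := by
  rcases C.total 1 with h | h
  · exact h
  · simpa using h

theorem inv_mem {x : G} (h : x ∉ C.P) : x⁻¹ ∈ C.P := (C.total x).resolve_left h

theorem pow_mem {x : G} (h : x ∈ C.P) (n : ℕ) : x ^ n ∈ C.P := by
  induction n with
  | zero => simpa using C.one_mem
  | succ n ih => rw [pow_succ]; exact C.mul_mem ih h

/-- The opposite cone. -/
def op : GradedCone Gᵐᵒᵖ where
  deg x := C.deg x.unop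
  deg_mul x y := by rw [MulOpposite.unop_mul, C.deg_mul, add_comm]
  P := {x | x.unop ∈ C.P}
  mul_mem hx hy := C.mul_mem hy hx
  total x := C.total x.unop

/-- The left order of the component of degree `s`. -/
def L (s : ℚ) : Set G := {g | C.deg g = 0 ∧ ∀ a ∈ C.P, C.deg a = s → g * a ∈ C.P}

/-- The right order of the component of degree `s`. -/
def R (s : ℚ) : Set G := {g | C.deg g = 0 ∧ ∀ a ∈ C.P, C.deg a = s → a * g ∈ C.P}

/-- A set of elements of degree zero that is closed under products and contains the degree zero
part of the cone. -/
structure Over (S : Set G) : Prop where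
  deg_eq : ∀ {g}, g ∈ S → C.deg g = 0
  mem_of_mem : ∀ {g}, g ∈ C.P → C.deg g = 0 → g ∈ S
  mul_mem : ∀ {g h}, g ∈ S → h ∈ S → g * h ∈ S

/-- The nonunits of an overring `S`. -/
def J (S : Set G) : Set G := {g | C.deg g = 0 ∧ g⁻¹ ∉ S}

theorem over_L (s : ℚ) : C.Over (C.L s) where
  deg_eq h := h.1
  mem_of_mem h h0 := ⟨h0, fun _ ha _ => C.mul_mem h ha⟩
  mul_mem {g h} hg hh := ⟨by rw [C.deg_mul, hg.1, hh.1, add_zero], fun a ha hs => by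
    rw [mul_assoc]
    exact hg.2 _ (hh.2 a ha hs) (by rw [C.deg_mul, hh.1, hs, zero_add])⟩

theorem R_eq_L_neg (s : ℚ) : C.R s = C.L (-s) := by
  ext g
  constructor
  · rintro ⟨h0, h⟩
    refine ⟨h0, fun b hb hs => ?_⟩
    by_contra hn
    have h1 := C.inv_mem hn
    have h2 := h _ h1 (by simp [C.deg_inv, C.deg_mul, h0, hs])
    have h3 := h _ h2 (by simp [C.deg_inv, hs])
    have h4 := C.mul_mem hb h3
    have e : b * ((g * b)⁻¹ * g * g) = g := by group
    rw [e] at h4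
    exact hn (C.mul_mem h4 hb)
  · rintro ⟨h0, h⟩
    refine ⟨h0, fun b hb hs => ?_⟩
    by_contra hn
    have h1 := C.inv_mem hn
    have h2 := h _ h1 (by simp [C.deg_inv, C.deg_mul, h0, hs])
    have h3 := h _ h2 (by simp [C.deg_inv, hs])
    have h4 := C.mul_mem h3 hb
    have e : g * (g * (b * g)⁻¹) * b = g := by group
    rw [e] at h4
    exact hn (C.mul_mem hb h4)

theorem inv_mem_J {S : Set G} {g : G} (h : C.deg g = 0) (hg : g ∉ S) : g⁻¹ ∈ C.J S :=
  ⟨by rw [C.deg_inv, h, neg_zero], by rwa [inv_inv]⟩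

namespace Over

variable {C} {S T : Set G} (hS : C.Over S)
include hS

theorem one_mem : (1 : G) ∈ S := hS.mem_of_mem C.one_mem C.deg_one

theorem mem_or {g : G} (h : C.deg g = 0) : g ∈ S ∨ g⁻¹ ∈ S :=
  (C.total g).imp (fun h' => hS.mem_of_mem h' h)
    fun h' => hS.mem_of_mem h' (by rw [C.deg_inv, h, neg_zero])

theorem mem_of_mem_J {g : G} (h : g ∈ C.J S) : g ∈ S := (hS.mem_or h.1).resolve_right h.2

theorem J_mem_P {g : G} (h : g ∈ C.J S) : g ∈ C.P := by
  by_contra hn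
  exact h.2 (hS.mem_of_mem (C.inv_mem hn) (by rw [C.deg_inv, h.1, neg_zero]))

theorem one_notMem_J : (1 : G) ∉ C.J S := fun h => h.2 (by simpa using hS.one_mem)

theorem mul_J {g j : G} (hg : g ∈ S) (hj : j ∈ C.J S) : g * j ∈ C.J S := by
  refine ⟨by rw [C.deg_mul, hS.deg_eq hg, hj.1, add_zero], fun h => hj.2 ?_⟩
  have := hS.mul_mem h hg
  rwa [mul_inv_rev, inv_mul_cancel_right] at this

theorem J_mul {g j : G} (hj : j ∈ C.J S) (hg : g ∈ S) : j * g ∈ C.J S := by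
  refine ⟨by rw [C.deg_mul, hS.deg_eq hg, hj.1, add_zero], fun h => hj.2 ?_⟩
  have := hS.mul_mem hg h
  rwa [mul_inv_rev, mul_inv_cancel_left] at this

theorem total (hT : C.Over T) : S ⊆ T ∨ T ⊆ S := by
  by_contra! h
  obtain ⟨⟨s, hs, hsT⟩, ⟨t, ht, htS⟩⟩ := Set.not_subset.1 h.1, Set.not_subset.1 h.2
  have hs0 := hS.deg_eq hs
  have ht0 := hT.deg_eq ht
  rcases C.total (s * t⁻¹) with h1 | h1
  · refine hsT ?_
    have := hT.mul_mem (hT.mem_of_mem h1 (by simp [C.deg_mul, C.deg_inv, hs0, ht0])) ht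
    rwa [inv_mul_cancel_right] at this
  · refine htS ?_
    have := hS.mul_mem (hS.mem_of_mem h1 (by simp [C.deg_mul, C.deg_inv, hs0, ht0])) hs
    rwa [mul_inv_rev, inv_inv, inv_mul_cancel_right] at this

end Over

/-- The product of the components of degrees `r` and `s` is not the component of degree `r + s`. -/
def Fail (r s : ℚ) : Prop :=
  ∃ x ∈ C.P, C.deg x = r + s ∧ ∀ a ∈ C.P, C.deg a = r → a⁻¹ * x ∉ C.P

theorem L_subset_of_not_fail {r s : ℚ} (h : ¬C.Fail r s) : C.L r ⊆ C.L (r + s) := by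
  rintro g ⟨h0, hg⟩
  refine ⟨h0, fun x hx hxd => ?_⟩
  by_contra hn
  refine h ⟨x, hx, hxd, fun a ha had hax => hn ?_⟩
  have := C.mul_mem (hg a ha had) hax
  rwa [mul_assoc, mul_inv_cancel_left] at this

theorem R_subset_of_not_fail {r s : ℚ} (h : ¬C.Fail r s) : C.R s ⊆ C.R (r + s) := by
  rintro g ⟨h0, hg⟩
  refine ⟨h0, fun x hx hxd => ?_⟩
  by_contra hn
  refine h ⟨x, hx, hxd, fun a ha had hax => hn ?_⟩
  have := C.mul_mem ha (hg _ hax (by simp [C.deg_mul, C.deg_inv, hxd, had]))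
  rwa [mul_assoc, mul_inv_cancel_left] at this

theorem Fail.exists {C : GradedCone G} {r s : ℚ} (h : C.Fail r s) :
    ∃ x ∈ C.P, C.deg x = r + s ∧ (∀ g, g ∈ C.L r ↔ x⁻¹ * g * x ∈ C.L (-s)) ∧
      C.L s = C.L (-r) ∧ (∀ g ∈ C.J (C.L r), g * x ∈ C.P) ∧
      ∀ u ∈ C.P, C.deg u = r + s → u * x⁻¹ ∈ C.L r := by
  obtain ⟨x, hx, hxd, hf⟩ := h
  have ha : ∀ a, C.deg a = r → (a ∈ C.P ↔ x⁻¹ * a ∈ C.P) := by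
    intro a had
    refine ⟨fun h => ?_, fun h => ?_⟩
    · have := C.inv_mem (hf a h had)
      rwa [mul_inv_rev, inv_inv] at this
    · have := C.mul_mem hx h
      rwa [mul_inv_cancel_left] at this
  have hb : ∀ b, C.deg b = s → (b ∈ C.P ↔ b * x⁻¹ ∈ C.P) := by
    intro b hbd
    refine ⟨fun h => ?_, fun h => ?_⟩
    · by_contra hn
      refine hf _ (C.inv_mem hn) (by simp [C.deg_mul, C.deg_inv, hbd, hxd]) ?_
      simpa using h
    · have := C.mul_mem h hx
      rwa [inv_mul_cancel_right] at this
  refine ⟨x, hx, hxd, fun g => ⟨fun hg => ?_, fun hg => ?_⟩, ?_, fun g hg => ?_, fun u hu hud => ?_⟩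
  · refine ⟨by simp [C.deg_mul, C.deg_inv, hg.1], fun b hb' hbd => ?_⟩
    have h1 : C.deg (x * b) = r := by rw [C.deg_mul, hxd, hbd]; ring
    have h2 := (ha _ (by rw [C.deg_mul, hg.1, h1, zero_add])).1 (hg.2 _ (C.mul_mem hx hb') h1)
    simpa [mul_assoc] using h2
  · have h0 : C.deg g = 0 := by simpa [C.deg_mul, C.deg_inv] using hg.1
    refine ⟨h0, fun a ha' had => ?_⟩
    have h1 := hg.2 _ ((ha a had).1 ha') (by rw [C.deg_mul, C.deg_inv, hxd, had]; ring)
    rw [ha _ (by rw [C.deg_mul, h0, had, zero_add])]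
    simpa [mul_assoc] using h1
  · ext g
    refine ⟨fun hg => ⟨hg.1, fun b hb' hbd => ?_⟩, fun hg => ⟨hg.1, fun b hb' hbd => ?_⟩⟩
    · have h1 : C.deg (b * x) = s := by rw [C.deg_mul, hxd, hbd]; ring
      have h2 := (hb _ (by rw [C.deg_mul, hg.1, h1, zero_add])).1 (hg.2 _ (C.mul_mem hb' hx) h1)
      simpa [mul_assoc] using h2
    · have h1 := hg.2 _ ((hb b hbd).1 hb') (by rw [C.deg_mul, C.deg_inv, hxd, hbd]; ring)
      rw [hb _ (by rw [C.deg_mul, hg.1, hbd, zero_add])]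
      simpa [mul_assoc] using h1
  · have h1 : ∃ a ∈ C.P, C.deg a = r ∧ g⁻¹ * a ∉ C.P := by
      by_contra! hn
      exact hg.2 ⟨by rw [C.deg_inv, hg.1, neg_zero], hn⟩
    obtain ⟨a, ha', had, hn⟩ := h1
    rw [ha _ (by rw [C.deg_mul, C.deg_inv, hg.1, had]; ring)] at hn
    have := C.mul_mem ha' (C.inv_mem hn)
    have e : a * (x⁻¹ * (g⁻¹ * a))⁻¹ = g * x := by group
    rwa [e] at this
  · refine ⟨by simp [C.deg_mul, C.deg_inv, hud, hxd], fun a ha' had => ?_⟩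
    have := C.mul_mem hu ((ha a had).1 ha')
    rwa [← mul_assoc] at this

/-- A failure whose left and right orders coincide is forced by the left orders along the multiples
of the degree: the increasing case. -/
theorem L_eq_of_fail_of_subset {W : Set G} {r s : ℚ} (hle : ∀ v, C.L v ⊆ W) (h : C.Fail r s)
    (hLR : C.L r ⊆ C.L (-s)) {n : ℕ} (hn : C.L (n * (r + s)) = W) :
    C.L r = W := by
  obtain ⟨x, hx, hxd, hconj, -, hJ, hup⟩ := h.exists
  refine (hle r).antisymm fun g hg => ?_
  by_contra hgL
  have hW := C.over_L (n * (r + s))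
  rw [hn] at hW
  have hL := C.over_L r
  have hg0 := hW.deg_eq hg
  have hj : g⁻¹ ∈ C.J (C.L r) := C.inv_mem_J hg0 hgL
  have hcj : ∀ k : ℕ, ∀ j ∈ C.J (C.L r), (x ^ k)⁻¹ * j * x ^ k ∈ C.J (C.L r) := by
    intro k
    induction k with
    | zero => simp
    | succ k ih =>
      intro j hj
      have h1 := ih j hj
      have e : (x ^ (k + 1))⁻¹ * j * x ^ (k + 1) = x⁻¹ * ((x ^ k)⁻¹ * j * x ^ k) * x := by
        rw [pow_succ]; group
      rw [e]
      generalize (x ^ k)⁻¹ * j * x ^ k = i at h1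
      refine ⟨by simp [C.deg_mul, C.deg_inv, h1.1], fun h2 => h1.2 ?_⟩
      rw [hconj]
      have := hLR h2
      simpa [mul_assoc] using this
  have hinv : ∀ j ∈ C.J (C.L r), x⁻¹ * j ∈ C.P := by
    intro j hj
    by_contra hn
    have h1 := hup _ (C.inv_mem hn) (by simp [C.deg_mul, C.deg_inv, hj.1, hxd])
    have e : (x⁻¹ * j)⁻¹ * x⁻¹ = j⁻¹ := by group
    rw [e] at h1
    exact hj.2 h1
  have h1 : ∀ k : ℕ, g⁻¹ ^ k * x ^ k ∈ C.P := by
    intro k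
    induction k with
    | zero => simpa using C.one_mem
    | succ k ih =>
      have := C.mul_mem ih (hJ _ (hcj k _ hj))
      have e : g⁻¹ ^ k * x ^ k * ((x ^ k)⁻¹ * g⁻¹ * x ^ k * x) = g⁻¹ ^ (k + 1) * x ^ (k + 1) := by
        rw [pow_succ, pow_succ]; group
      rwa [e] at this
  have h2 : ∀ k : ℕ, (x ^ k)⁻¹ * g⁻¹ ^ k ∈ C.P := by
    intro k
    induction k with
    | zero => simpa using C.one_mem
    | succ k ih =>
      have := C.mul_mem (hinv _ (hcj k _ hj)) ih
      have e : x⁻¹ * ((x ^ k)⁻¹ * g⁻¹ * x ^ k) * ((x ^ k)⁻¹ * g⁻¹ ^ k)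
          = (x ^ (k + 1))⁻¹ * g⁻¹ ^ (k + 1) := by
        rw [pow_succ, pow_succ' g⁻¹]; group
      rwa [e] at this
  have hgk : ∀ k : ℕ, g ^ k ∈ W := by
    intro k
    induction k with
    | zero => simpa using hW.one_mem
    | succ k ih => rw [pow_succ]; exact hW.mul_mem ih hg
  have hw : g ^ (n + 1) * g ^ n ∈ W := hW.mul_mem (hgk _) (hgk n)
  rw [← hn] at hw
  have h3 := C.mul_mem (hw.2 _ (h1 n)
    (by simp [C.deg_mul, C.deg_pow, C.deg_inv, hg0, hxd])) (h2 n)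
  have e : g ^ (n + 1) * g ^ n * (g⁻¹ ^ n * x ^ n) * ((x ^ n)⁻¹ * g⁻¹ ^ n) = g := by
    rw [pow_succ']; simp [mul_assoc]
  rw [e] at h3
  exact hgL (hL.mem_of_mem h3 hg0)

end GradedCone

namespace GradedCone

variable {G : Type*} [Group G] (C : GradedCone G)

theorem exists_mul_eq_mul {a b : ℚ} (h : 0 < a * b) :
    ∃ m n : ℕ, 0 < m ∧ 0 < n ∧ (m : ℚ) * a = n * b := by
  have hb : b ≠ 0 := by rintro rfl; simp at h
  have hq : 0 < a / b := by
    have : a / b = a * b / b ^ 2 := by field_simp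
    rw [this]; positivity
  have hnum : 0 < (a / b).num := Rat.num_pos.2 hq
  refine ⟨(a / b).den, (a / b).num.toNat, (a / b).den_pos, by omega, ?_⟩
  have h1 : (((a / b).num.toNat : ℕ) : ℚ) = (a / b).num := by
    exact_mod_cast Int.toNat_of_nonneg hnum.le
  have h2 := Rat.mul_den_eq_num (a / b)
  rw [h1, ← h2]
  field_simp

/-- The decreasing case of `L_eq_of_fail_of_subset` does not occur. -/
theorem L_subset_of_fail {W : Set G} {r s : ℚ} (hle : ∀ v, C.L v ⊆ W) (h : C.Fail r s)
    (hrs : 0 < r * s) {n₀ : ℕ} (hn₀ : 0 < n₀)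
    (hn : ∀ k : ℕ, 0 < k → C.L ((k * n₀ : ℕ) * (r + s)) = W) :
    C.L r ⊆ C.L (-s) := by
  by_contra hLR
  have hRL : C.L (-s) ⊆ C.L r := ((C.over_L r).total (C.over_L (-s))).resolve_left hLR
  have hsr : ¬C.Fail s r := by
    intro h'
    obtain ⟨-, -, -, -, h1, -⟩ := h'.exists
    exact hLR h1.subset
  obtain ⟨x, hx, hxd, hconj, -, hJ, hup⟩ := h.exists
  obtain ⟨g, hgL, hgR⟩ := Set.not_subset.1 hLR
  have hg0 := hgL.1
  have hR := C.over_L (-s)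
  have hxR : ∀ i, i ∈ C.L (-s) ↔ x * i * x⁻¹ ∈ C.L r := by
    intro i
    rw [hconj]
    simp [mul_assoc]
  have hjx : ∀ j ∈ C.J (C.L (-s)), j * x⁻¹ ∈ C.P := by
    intro j hj
    by_contra hn
    have h1 := hup _ (C.inv_mem hn) (by simp [C.deg_mul, C.deg_inv, hj.1, hxd])
    rw [mul_inv_rev, inv_inv, ← hxR] at h1
    exact hj.2 h1
  have hjxn : ∀ n : ℕ, ∀ j ∈ C.J (C.L (-s)), j * (x ^ n)⁻¹ ∈ C.P := by
    intro n
    induction n with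
    | zero => intro j hj; simpa using hR.J_mem_P hj
    | succ n ih =>
      intro j hj
      have h1 : x⁻¹ * g * x ∈ C.L (-s) := (hconj g).1 hgL
      have := C.mul_mem (hjx _ (hR.J_mul hj h1)) (ih _ (C.inv_mem_J hg0 hgR))
      have e : j * (x⁻¹ * g * x) * x⁻¹ * (g⁻¹ * (x ^ n)⁻¹) = j * (x ^ (n + 1))⁻¹ := by
        rw [pow_succ]; group
      rwa [e] at this
  have hB : ∀ n : ℕ, C.L (n * (r + s)) = W → ∀ z ∈ C.P, C.deg z = n * (r + s) →
      (x ^ n)⁻¹ * z ∈ C.L (-s) := by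
    intro n hnW z hz hzd
    by_contra hb
    have h1 := hjxn n _ (C.inv_mem_J
      (by rw [C.deg_mul, C.deg_inv, C.deg_pow, hzd, hxd]; ring) hb)
    have h2 : g ∈ C.L (n * (r + s)) := hnW ▸ hle r hgL
    have h3 := C.mul_mem (h2.2 z hz hzd) h1
    have e : g * z * (((x ^ n)⁻¹ * z)⁻¹ * (x ^ n)⁻¹) = g := by group
    rw [e] at h3
    exact hgR (hR.mem_of_mem h3 hg0)
  have hN : ∃ N : ℕ, 0 < N ∧ ∀ k : ℕ, 0 < k → C.L ((k * N : ℕ) * (r + s)) = W ∧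
      ∀ z ∈ C.P, C.deg z = (k * N : ℕ) * (r + s) → ∀ i ∈ C.L (-s), z * i ∈ C.P := by
    by_cases hU : C.L (-s) ⊆ C.R r
    · refine ⟨n₀, hn₀, fun k hk => ⟨hn k hk, fun z hz hzd i hi => ?_⟩⟩
      have h1 := hB _ (hn k hk) z hz hzd
      have hpos : 0 < k * n₀ := Nat.mul_pos hk hn₀
      obtain ⟨m, hm⟩ : ∃ m, k * n₀ = m + 1 := ⟨k * n₀ - 1, by omega⟩
      rw [hm] at h1
      have h2 := C.R_subset_of_not_fail hsr (hU (hR.mul_mem h1 hi))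
      have h3 := C.mul_mem (C.pow_mem hx m) (h2.2 x hx (by rw [hxd, add_comm]))
      have e : x ^ m * (x * ((x ^ (m + 1))⁻¹ * z * i)) = z * i := by
        rw [pow_succ]; group
      rwa [e] at h3
    · have hR' : ∀ i : ℕ, C.L (-s) ⊆ C.R ((i + 1 : ℕ) * s) := by
        intro i
        induction i with
        | zero => simp [C.R_eq_L_neg]
        | succ i ih =>
          have hnf : ¬C.Fail ((i + 1 : ℕ) * s) s := by
            intro h'
            obtain ⟨-, -, -, -, h1, -⟩ := h'.exists
            rw [← C.R_eq_L_neg] at h1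
            obtain ⟨-, -, -, -, h2, -⟩ := h.exists
            refine hU (ih.trans ?_)
            rw [← h1, h2, C.R_eq_L_neg]
          have := C.R_subset_of_not_fail hnf
          rw [C.R_eq_L_neg s] at this
          refine this.trans_eq ?_
          congr 1; push_cast; ring
      have hps : 0 < (r + s) * s := by nlinarith [sq_nonneg s]
      obtain ⟨m, i, hm, hi, hmi⟩ := exists_mul_eq_mul hps
      refine ⟨m * n₀, Nat.mul_pos hm hn₀, fun k hk => ⟨?_, fun z hz hzd j hj => ?_⟩⟩
      · have := hn (k * m) (Nat.mul_pos hk hm)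
        rwa [mul_assoc] at this
      · obtain ⟨l, hl⟩ : ∃ l, k * n₀ * i = l + 1 :=
          ⟨k * n₀ * i - 1, by have := Nat.mul_pos (Nat.mul_pos hk hn₀) hi; omega⟩
        refine (hR' l hj).2 z hz ?_
        rw [hzd, ← hl]
        push_cast
        linear_combination (k * n₀ : ℚ) * hmi
  obtain ⟨N, hN0, hN⟩ := hN
  have hto : ∀ k : ℕ, 0 < k → ∀ w ∈ W, (x ^ (k * N))⁻¹ * w * x ^ (k * N) ∈ C.L (-s) := by
    intro k hk w hw
    have hw' := hw
    rw [← (hN k hk).1] at hw'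
    rw [mul_assoc]
    have hd : C.deg (x ^ (k * N)) = (k * N : ℕ) * (r + s) := by rw [C.deg_pow, hxd]
    exact hB _ (hN k hk).1 _ (hw'.2 _ (C.pow_mem hx _) hd) (by rw [C.deg_mul, hw'.1, hd, zero_add])
  have hfrom : ∀ k : ℕ, 0 < k → ∀ w, (x ^ (k * N))⁻¹ * w * x ^ (k * N) ∈ C.L (-s) → w ∈ W := by
    intro k hk w hw
    rw [← (hN k hk).1]
    have hd : C.deg (x ^ (k * N)) = (k * N : ℕ) * (r + s) := by rw [C.deg_pow, hxd]
    refine ⟨by simpa [C.deg_mul, C.deg_inv] using hw.1, fun z hz hzd => ?_⟩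
    have h1 := (hN k hk).2 _ (C.pow_mem hx _) hd _
      (hR.mul_mem hw (hB _ (hN k hk).1 z hz hzd))
    have e : x ^ (k * N) * ((x ^ (k * N))⁻¹ * w * x ^ (k * N) * ((x ^ (k * N))⁻¹ * z)) = w * z := by
      group
    rwa [e] at h1
  have hgR' : (x ^ N)⁻¹ * g * x ^ N ∈ C.L (-s) := by
    obtain ⟨m, rfl⟩ : ∃ m, N = m + 1 := ⟨N - 1, by omega⟩
    clear hN hto hfrom hN0
    induction m with
    | zero => simpa using (hconj g).1 hgL
    | succ m ih =>
      have := (hconj _).1 (hRL ih)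
      have e : x⁻¹ * ((x ^ (m + 1))⁻¹ * g * x ^ (m + 1)) * x
          = (x ^ (m + 1 + 1))⁻¹ * g * x ^ (m + 1 + 1) := by
        rw [pow_succ x (m + 1)]; group
      rwa [e] at this
  have h1 := hfrom 2 (by norm_num) (x ^ N * g * (x ^ N)⁻¹) (by
    have e : (x ^ (2 * N))⁻¹ * (x ^ N * g * (x ^ N)⁻¹) * x ^ (2 * N) = (x ^ N)⁻¹ * g * x ^ N := by
      rw [two_mul, pow_add]; group
    rwa [e])
  have h2 := hto 1 (by norm_num) _ h1
  rw [one_mul] at h2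
  have e : (x ^ N)⁻¹ * (x ^ N * g * (x ^ N)⁻¹) * x ^ N = g := by group
  rw [e] at h2
  exact hgR h2

theorem L_eq_of_fail {W : Set G} {r s : ℚ} (hle : ∀ v, C.L v ⊆ W) (h : C.Fail r s)
    (hrs : 0 < r * s) {n₀ : ℕ} (hn₀ : 0 < n₀)
    (hn : ∀ k : ℕ, 0 < k → C.L ((k * n₀ : ℕ) * (r + s)) = W) :
    C.L r = W ∧ C.R s = W := by
  have h1 := C.L_subset_of_fail hle h hrs hn₀ hn
  have h2 := C.L_eq_of_fail_of_subset hle h h1 (hn 1 one_pos)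
  refine ⟨h2, ?_⟩
  rw [C.R_eq_L_neg]
  exact (hle _).antisymm (h2 ▸ h1)

theorem mem_op_L {s : ℚ} {x : Gᵐᵒᵖ} : x ∈ C.op.L s ↔ x.unop ∈ C.R s :=
  ⟨fun h => ⟨h.1, fun a ha hd => h.2 (MulOpposite.op a) ha hd⟩,
    fun h => ⟨h.1, fun a ha hd => h.2 a.unop ha hd⟩⟩

theorem mem_op_R {s : ℚ} {x : Gᵐᵒᵖ} : x ∈ C.op.R s ↔ x.unop ∈ C.L s :=
  ⟨fun h => ⟨h.1, fun a ha hd => h.2 (MulOpposite.op a) ha hd⟩,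
    fun h => ⟨h.1, fun a ha hd => h.2 a.unop ha hd⟩⟩

theorem Fail.op {C : GradedCone G} {r s : ℚ} (h : C.Fail r s) : C.op.Fail s r := by
  obtain ⟨x, hx, hxd, hf⟩ := h
  refine ⟨MulOpposite.op x, hx, by rw [add_comm]; exact hxd, fun b hb hbd h => ?_⟩
  have h' : x * b.unop⁻¹ ∈ C.P := h
  have hbd' : C.deg b.unop = s := hbd
  refine hf _ h' (by rw [C.deg_mul, C.deg_inv, hxd, hbd']; ring) ?_
  have hb' : b.unop ∈ C.P := hb
  simpa using hb'

/-- The mirror image of `L_eq_of_fail`. -/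
theorem L_eq_of_fail' {W : Set G} {r s : ℚ} (hle : ∀ v, C.L v ⊆ W) (h : C.Fail r s)
    (hrs : 0 < r * s) {n₀ : ℕ} (hn₀ : 0 < n₀)
    (hn : ∀ k : ℕ, 0 < k → C.R ((k * n₀ : ℕ) * (r + s)) = W) :
    C.L r = W ∧ C.R s = W := by
  have key := C.op.L_eq_of_fail (W := {x | x.unop ∈ W}) (r := s) (s := r)
    (fun v x hx => hle (-v) (by rw [← C.R_eq_L_neg]; exact C.mem_op_L.1 hx)) h.op
    (by rwa [mul_comm]) hn₀ (fun k hk => by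
      ext x
      rw [mem_op_L, add_comm, hn k hk]; rfl)
  constructor
  · ext g
    have := Set.ext_iff.1 key.2 (MulOpposite.op g)
    rw [mem_op_R] at this
    exact this
  · ext g
    have := Set.ext_iff.1 key.1 (MulOpposite.op g)
    rw [mem_op_L] at this
    exact this

end GradedCone

namespace GradedCone

variable {G : Type*} [Group G] (C : GradedCone G)

/-- `W` is an overring that contains all left orders and has an idempotent radical. -/
structure IsTop (W : Set G) : Prop where
  isOver : C.Over W
  L_subset : ∀ v, C.L v ⊆ W
  idem : ∀ j ∈ C.J W, ∃ j₁ ∈ C.J W, ∃ j₂ ∈ C.J W, j = j₁ * j₂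

/-- The component of degree `s` lies between `J(W) γ` and `W γ`, where `γ` normalizes `W`. -/
structure Sandwich (W : Set G) (s : ℚ) (γ : G) : Prop where
  deg_eq : C.deg γ = s
  conj : ∀ g, g ∈ W ↔ γ * g * γ⁻¹ ∈ W
  mem_P : ∀ j ∈ C.J W, j * γ ∈ C.P
  mem_W : ∀ z ∈ C.P, C.deg z = s → z * γ⁻¹ ∈ W

variable {C} {W : Set G}

theorem IsTop.mem_of_mul_J (hW : C.IsTop W) {y : G} (h0 : C.deg y = 0)
    (h : ∀ j ∈ C.J W, y * j ∈ W) : y ∈ W := by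
  by_contra hy
  obtain ⟨j₁, h₁, j₂, h₂, e⟩ := hW.idem _ (C.inv_mem_J h0 hy)
  have := hW.isOver.mul_J (h j₁ h₁) h₂
  rw [mul_assoc, ← e, mul_inv_cancel] at this
  exact hW.isOver.one_notMem_J this

theorem IsTop.mem_of_J_mul (hW : C.IsTop W) {y : G} (h0 : C.deg y = 0)
    (h : ∀ j ∈ C.J W, j * y ∈ W) : y ∈ W := by
  by_contra hy
  obtain ⟨j₁, h₁, j₂, h₂, e⟩ := hW.idem _ (C.inv_mem_J h0 hy)
  have := hW.isOver.J_mul h₁ (h j₂ h₂)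
  rw [← mul_assoc, ← e, inv_mul_cancel] at this
  exact hW.isOver.one_notMem_J this

namespace Sandwich

variable {r s : ℚ} {γ δ : G}

theorem conj_J (h : C.Sandwich W s γ) (g : G) : g ∈ C.J W ↔ γ * g * γ⁻¹ ∈ C.J W := by
  have e : (γ * g * γ⁻¹)⁻¹ = γ * g⁻¹ * γ⁻¹ := by group
  have e' : C.deg (γ * g * γ⁻¹) = C.deg g := by rw [C.deg_mul, C.deg_mul, C.deg_inv]; ring
  change C.deg g = 0 ∧ g⁻¹ ∉ W ↔ C.deg (γ * g * γ⁻¹) = 0 ∧ (γ * g * γ⁻¹)⁻¹ ∉ W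
  rw [e, e', ← h.conj]

theorem conj_symm (h : C.Sandwich W s γ) (g : G) : g ∈ W ↔ γ⁻¹ * g * γ ∈ W := by
  rw [h.conj (γ⁻¹ * g * γ)]
  simp [mul_assoc]

theorem conj_J_symm (h : C.Sandwich W s γ) (g : G) : g ∈ C.J W ↔ γ⁻¹ * g * γ ∈ C.J W := by
  rw [h.conj_J (γ⁻¹ * g * γ)]
  simp [mul_assoc]

theorem one (hW : C.Over W) : C.Sandwich W 0 1 where
  deg_eq := C.deg_one
  conj g := by simp
  mem_P j hj := by simpa using hW.J_mem_P hj
  mem_W z hz h0 := by simpa using hW.mem_of_mem hz h0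

theorem inv (hW : C.IsTop W) (h : C.Sandwich W s γ) : C.Sandwich W (-s) γ⁻¹ where
  deg_eq := by rw [C.deg_inv, h.deg_eq]
  conj g := by rw [inv_inv]; exact h.conj_symm g
  mem_P j hj := by
    by_contra hn
    have h1 := h.mem_W _ (C.inv_mem hn) (by simp [C.deg_mul, C.deg_inv, hj.1, h.deg_eq])
    rw [mul_inv_rev, inv_inv, ← h.conj] at h1
    exact hj.2 h1
  mem_W z hz hzd := by
    rw [inv_inv]
    refine hW.mem_of_mul_J (by rw [C.deg_mul, hzd, h.deg_eq]; ring) fun j hj => ?_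
    have h1 := C.mul_mem hz (h.mem_P _ ((h.conj_J j).1 hj))
    have e : z * (γ * j * γ⁻¹ * γ) = z * γ * j := by group
    rw [e] at h1
    exact hW.isOver.mem_of_mem h1 (by rw [C.deg_mul, C.deg_mul, hzd, h.deg_eq, hj.1]; ring)

theorem mul_mem_P (hW : C.IsTop W) (h : C.Sandwich W r γ) (h' : C.Sandwich W s δ) {j : G}
    (hj : j ∈ C.J W) : j * (γ * δ) ∈ C.P := by
  obtain ⟨j₁, h₁, j₂, h₂, rfl⟩ := hW.idem j hj
  have h1 := C.mul_mem (h.mem_P _ h₁) (h'.mem_P _ ((h.conj_J_symm j₂).1 h₂))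
  have e : j₁ * γ * (γ⁻¹ * j₂ * γ * δ) = j₁ * j₂ * (γ * δ) := by group
  rwa [e] at h1

theorem mul (hW : C.IsTop W) (h : C.Sandwich W r γ) (h' : C.Sandwich W s δ) :
    C.Sandwich W (r + s) (γ * δ) where
  deg_eq := by rw [C.deg_mul, h.deg_eq, h'.deg_eq]
  conj g := by
    rw [h'.conj, h.conj]
    simp [mul_assoc]
  mem_P _ hj := h.mul_mem_P hW h' hj
  mem_W z hz hzd := by
    refine hW.mem_of_mul_J ?_ fun j hj => ?_
    · rw [C.deg_mul, C.deg_inv, C.deg_mul, hzd, h.deg_eq, h'.deg_eq]; ring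
    · have h1 := C.mul_mem hz ((h'.inv hW).mul_mem_P hW (h.inv hW)
        ((h'.conj_J_symm _).1 ((h.conj_J_symm j).1 hj)))
      have e : z * (δ⁻¹ * (γ⁻¹ * j * γ) * δ * (δ⁻¹ * γ⁻¹)) = z * (γ * δ)⁻¹ * j := by group
      rw [e] at h1
      refine hW.isOver.mem_of_mem h1 ?_
      simp only [C.deg_mul, C.deg_inv, hzd, h.deg_eq, h'.deg_eq, hj.1]; ring

theorem pow (hW : C.IsTop W) (h : C.Sandwich W s γ) (n : ℕ) : C.Sandwich W (n * s) (γ ^ n) := by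
  induction n with
  | zero => simpa using one hW.isOver
  | succ n ih =>
    have := ih.mul hW h
    rw [pow_succ]
    convert this using 1
    push_cast; ring

theorem unit_mul (hW : C.IsTop W) (h : C.Sandwich W s γ) {u : G} (hu : u ∈ W) (hu' : u⁻¹ ∈ W) :
    C.Sandwich W s (u * γ) where
  deg_eq := by rw [C.deg_mul, hW.isOver.deg_eq hu, h.deg_eq, zero_add]
  conj g := by
    rw [h.conj]
    refine ⟨fun h1 => ?_, fun h1 => ?_⟩
    · have := hW.isOver.mul_mem (hW.isOver.mul_mem hu h1) hu'
      simpa [mul_assoc] using this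
    · have := hW.isOver.mul_mem (hW.isOver.mul_mem hu' h1) hu
      simpa [mul_assoc] using this
  mem_P j hj := by
    rw [← mul_assoc]
    exact h.mem_P _ (hW.isOver.J_mul hj hu)
  mem_W z hz hzd := by
    have := hW.isOver.mul_mem (h.mem_W z hz hzd) hu'
    simpa [mul_assoc] using this

theorem mem_of_zero (hW : C.IsTop W) (h : C.Sandwich W 0 γ) : γ ∈ W := by
  simpa using (h.inv hW).mem_W 1 C.one_mem (by simp [C.deg_one])

end Sandwich

theorem sandwich_of_fail {r s : ℚ} (h : C.Fail r s) (hr : C.L r = W) (hs : C.R s = W) :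
    ∃ γ, C.Sandwich W (r + s) γ := by
  obtain ⟨x, hx, hxd, hconj, -, hJ, hup⟩ := h.exists
  rw [hr, ← C.R_eq_L_neg, hs] at hconj
  rw [hr] at hJ hup
  refine ⟨x, hxd, fun g => ?_, hJ, hup⟩
  rw [hconj (x * g * x⁻¹)]
  simp [mul_assoc]

theorem forall_L_mul_or_fail (hle : ∀ v, C.L v ⊆ W) {t : ℚ} (ht : C.L t = W) :
    (∀ n : ℕ, 0 < n → C.L (n * t) = W) ∨
      ∃ n : ℕ, 0 < n ∧ C.L (n * t) = W ∧ C.Fail (n * t) t := by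
  by_contra! h
  obtain ⟨⟨n, hn, hne⟩, h⟩ := h
  refine hne ?_
  induction n, hn using Nat.le_induction with
  | base => simpa using ht
  | succ n hn ih =>
    by_cases hL : C.L (n * t) = W
    · refine (hle _).antisymm ?_
      have := C.L_subset_of_not_fail (h n hn hL)
      rw [hL] at this
      have e : ((n + 1 : ℕ) : ℚ) * t = n * t + t := by push_cast; ring
      rwa [e]
    · exact absurd (ih hL) hL

theorem sandwich_of_forall (hle : ∀ v, C.L v ⊆ W) {t : ℚ} (ht0 : t ≠ 0)
    (ht : ∀ n : ℕ, 0 < n → C.L (n * t) = W) {r s : ℚ} (h : C.Fail r s) (hrs : 0 < r * s) :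
    ∃ γ, C.Sandwich W (r + s) γ := by
  have hp : r + s ≠ 0 := by
    intro h0
    have : r = -s := by linarith
    rw [this] at hrs
    nlinarith [sq_nonneg s]
  rcases lt_or_gt_of_ne (mul_ne_zero hp ht0) with hlt | hgt
  · obtain ⟨m, n, hm, hn, e⟩ := exists_mul_eq_mul (a := r + s) (b := -t) (by linarith)
    obtain ⟨h1, h2⟩ := C.L_eq_of_fail' hle h hrs hm (fun k hk => by
      rw [C.R_eq_L_neg, ← ht (k * n) (Nat.mul_pos hk hn)]
      congr 1; push_cast; linear_combination -(k : ℚ) * e)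
    exact sandwich_of_fail h h1 h2
  · obtain ⟨m, n, hm, hn, e⟩ := exists_mul_eq_mul hgt
    obtain ⟨h1, h2⟩ := C.L_eq_of_fail hle h hrs hm (fun k hk => by
      rw [← ht (k * n) (Nat.mul_pos hk hn)]
      congr 1; push_cast; linear_combination (k : ℚ) * e)
    exact sandwich_of_fail h h1 h2

theorem exists_sandwich (hle : ∀ v, C.L v ⊆ W) {t : ℚ} (ht : C.L t = W) {r s : ℚ}
    (h : C.Fail r s) (hrs : 0 < r * s) : ∃ p, p ≠ 0 ∧ ∃ γ, C.Sandwich W p γ := by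
  wlog ht0 : t ≠ 0 generalizing t
  · refine this (t := 1) ((hle _).antisymm ?_) one_ne_zero
    have h1 : t = 0 := not_not.1 ht0
    rw [← ht, h1]
    rintro g ⟨h0, hg⟩
    refine (C.over_L 1).mem_of_mem ?_ h0
    simpa using hg 1 C.one_mem C.deg_one
  have hp : r + s ≠ 0 := by
    intro h0
    have : r = -s := by linarith
    rw [this] at hrs
    nlinarith [sq_nonneg s]
  rcases forall_L_mul_or_fail hle ht with h1 | ⟨n, hn, hnL, hnf⟩
  · exact ⟨_, hp, sandwich_of_forall hle ht0 h1 h hrs⟩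
  have hnR : C.R (n * t) = W := by
    obtain ⟨-, -, -, -, h1, -⟩ := hnf.exists
    rw [C.R_eq_L_neg, ← h1, ht]
  have hnt : (n * t : ℚ) ≠ 0 := mul_ne_zero (by exact_mod_cast hn.ne') ht0
  rcases forall_L_mul_or_fail hle hnL with h1 | ⟨m, hm, hmL, hmf⟩
  · exact ⟨_, hp, sandwich_of_forall hle hnt h1 h hrs⟩
  · refine ⟨_, ?_, sandwich_of_fail hmf hmL hnR⟩
    have : (m * (n * t) + n * t : ℚ) = (m + 1) * (n * t) := by ring
    rw [this]
    exact mul_ne_zero (by positivity) hnt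

end GradedCone

namespace GradedCone

variable {G : Type*} [Group G] (C : GradedCone G)

/-- The product `J(W) A_s J(W)`. -/
def core (W : Set G) (s : ℚ) : Set G :=
  {z | ∃ j₁ ∈ C.J W, ∃ a ∈ C.P, C.deg a = s ∧ ∃ j₂ ∈ C.J W, z = j₁ * a * j₂}

variable {C} {W : Set G} {s : ℚ}

theorem core_mem_P (hW : C.Over W) {z : G} (hz : z ∈ C.core W s) : z ∈ C.P := by
  obtain ⟨j₁, h₁, a, ha, -, j₂, h₂, rfl⟩ := hz
  exact C.mul_mem (C.mul_mem (hW.J_mem_P h₁) ha) (hW.J_mem_P h₂)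

theorem core_deg {z : G} (hz : z ∈ C.core W s) : C.deg z = s := by
  obtain ⟨j₁, h₁, a, ha, hs, j₂, h₂, rfl⟩ := hz
  rw [C.deg_mul, C.deg_mul, h₁.1, h₂.1, hs]; ring

theorem mul_core (hW : C.Over W) {w z : G} (hw : w ∈ W) (hz : z ∈ C.core W s) :
    w * z ∈ C.core W s := by
  obtain ⟨j₁, h₁, a, ha, hs, j₂, h₂, rfl⟩ := hz
  exact ⟨w * j₁, hW.mul_J hw h₁, a, ha, hs, j₂, h₂, by group⟩

theorem core_mul (hW : C.Over W) {w z : G} (hw : w ∈ W) (hz : z ∈ C.core W s) :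
    z * w ∈ C.core W s := by
  obtain ⟨j₁, h₁, a, ha, hs, j₂, h₂, rfl⟩ := hz
  exact ⟨j₁, h₁, a, ha, hs, j₂ * w, hW.J_mul h₂ hw, by group⟩

theorem exists_eq_J_mul_core (hW : C.IsTop W) {z : G} (hz : z ∈ C.core W s) :
    ∃ j ∈ C.J W, ∃ z' ∈ C.core W s, z = j * z' := by
  obtain ⟨j₁, h₁, a, ha, hs, j₂, h₂, rfl⟩ := hz
  obtain ⟨i, hi, i', hi', rfl⟩ := hW.idem j₁ h₁
  exact ⟨i, hi, _, ⟨i', hi', a, ha, hs, j₂, h₂, rfl⟩, by group⟩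

theorem exists_eq_core_mul_J (hW : C.IsTop W) {z : G} (hz : z ∈ C.core W s) :
    ∃ z' ∈ C.core W s, ∃ j ∈ C.J W, z = z' * j := by
  obtain ⟨j₁, h₁, a, ha, hs, j₂, h₂, rfl⟩ := hz
  obtain ⟨i, hi, i', hi', rfl⟩ := hW.idem j₂ h₂
  exact ⟨_, ⟨j₁, h₁, a, ha, hs, i, hi, rfl⟩, i', hi', by group⟩

theorem core_mul_core_mem_J (hW : C.Over W) {c d : G} (hc : c ∈ C.core W s)
    (hd : d ∈ C.core W (-s)) : c * d ∈ C.J W := by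
  obtain ⟨j₁, h₁, a, ha, hs, j₂, h₂, rfl⟩ := hc
  obtain ⟨j₃, h₃, b, hb, hs', j₄, h₄, rfl⟩ := hd
  have h := C.mul_mem (C.mul_mem ha (hW.J_mem_P (hW.J_mul h₂ (hW.mem_of_mem_J h₃)))) hb
  have h' : a * (j₂ * j₃) * b ∈ W :=
    hW.mem_of_mem h (by simp only [C.deg_mul, hs, hs', h₂.1, h₃.1]; ring)
  have := hW.J_mul (hW.J_mul h₁ h') (hW.mem_of_mem_J h₄)
  have e : j₁ * (a * (j₂ * j₃) * b) * j₄ = j₁ * a * j₂ * (j₃ * b * j₄) := by group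
  rwa [e] at this

theorem inv_mem_core_of_notMem (hW : C.IsTop W) {z : G} (hzd : C.deg z = s)
    (hz : z ∉ C.core W s) {j j' : G} (hj : j ∈ C.J W) (hj' : j' ∈ C.J W) :
    j * z⁻¹ * j' ∈ C.core W (-s) := by
  obtain ⟨i₁, h₁, i₂, h₂, rfl⟩ := hW.idem j hj
  obtain ⟨i₃, h₃, i₄, h₄, rfl⟩ := hW.idem j' hj'
  refine ⟨i₁, h₁, i₂ * z⁻¹ * i₃, ?_, ?_, i₄, h₄, by group⟩
  · by_contra hn
    refine hz ⟨i₃, h₃, _, C.inv_mem hn, ?_, i₂, h₂, by group⟩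
    simp only [C.deg_mul, C.deg_inv, hzd, h₂.1, h₃.1]; ring
  · simp only [C.deg_mul, C.deg_inv, hzd, h₂.1, h₃.1]; ring

theorem core_subset_mul_J (hW : C.Over W) {z c : G} (hzd : C.deg z = s) (hz : z ∉ C.core W s)
    (hc : c ∈ C.core W s) : z⁻¹ * c ∈ C.J W := by
  refine ⟨by rw [C.deg_mul, C.deg_inv, hzd, core_deg hc]; ring, fun h => hz ?_⟩
  have := core_mul hW h hc
  rwa [mul_inv_rev, inv_inv, mul_inv_cancel_left] at this

theorem core_subset_J_mul (hW : C.Over W) {z c : G} (hzd : C.deg z = s) (hz : z ∉ C.core W s)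
    (hc : c ∈ C.core W s) : c * z⁻¹ ∈ C.J W := by
  refine ⟨by rw [C.deg_mul, C.deg_inv, hzd, core_deg hc]; ring, fun h => hz ?_⟩
  have := mul_core hW h hc
  rwa [mul_inv_rev, inv_inv, inv_mul_cancel_right] at this

/-- The left order of `J(W) A_s J(W)` is `W` as soon as some multiple of `s` is sandwiched. -/
theorem mem_of_mul_core (hW : C.IsTop W) {n : ℕ} (hn : 0 < n) {y : G}
    (hy : C.Sandwich W (n * s) y) {g : G} (hg0 : C.deg g = 0)
    (hg : ∀ c ∈ C.core W s, g * c ∈ C.core W s) : g ∈ W := by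
  by_contra hgW
  have hO := hW.isOver
  have hz : ∃ z ∈ C.P, C.deg z = s ∧ z ∉ C.core W s := by
    by_contra! hn
    exact hgW (hW.L_subset s ⟨hg0, fun a ha had => core_mem_P hO (hg a (hn a ha had))⟩)
  obtain ⟨z, hzP, hzd, hz⟩ := hz
  have hgJ := C.inv_mem_J hg0 hgW
  have key : ∀ z ∈ C.P, C.deg z = s → z ∉ C.core W s → ∀ t, (∀ c ∈ C.core W s, t * c ∈ C.core W s) →
      ∀ j ∈ C.J W, t * z * j ∈ C.core W s := by
    intro z hzP hzd _ t ht j hj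
    have := ht _ (hg _ ⟨g⁻¹, hgJ, z, hzP, hzd, j, hj, rfl⟩)
    have e : t * (g * (g⁻¹ * z * j)) = t * z * j := by group
    rwa [e] at this
  have hzJ : ∀ j ∈ C.J W, z * j ∈ C.core W s := fun j hj => by
    simpa using key z hzP hzd hz 1 (by simp) j hj
  have hconj : ∀ t, C.deg t = 0 → (∀ c ∈ C.core W s, t * c ∈ C.core W s) → z⁻¹ * t * z ∈ W := by
    intro t ht0 ht
    refine hW.mem_of_mul_J (by rw [C.deg_mul, C.deg_mul, C.deg_inv, ht0]; ring) fun j hj => ?_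
    have h1 := hO.mem_of_mem_J (core_subset_mul_J hO hzd hz (key z hzP hzd hz t ht j hj))
    have e : z⁻¹ * (t * z * j) = z⁻¹ * t * z * j := by group
    rwa [e] at h1
  have hconjW : ∀ w ∈ W, z⁻¹ * w * z ∈ W := fun w hw =>
    hconj w (hO.deg_eq hw) fun c hc => mul_core hO hw hc
  have hconjJ : ∀ j ∈ C.J W, z * j * z⁻¹ ∈ C.J W := by
    refine fun j hj => ⟨by rw [C.deg_mul, C.deg_mul, C.deg_inv, hj.1]; ring, fun h1 => hj.2 ?_⟩
    have := hconjW _ h1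
    have e : z⁻¹ * (z * j * z⁻¹)⁻¹ * z = j⁻¹ := by group
    rwa [e] at this
  have hJz : ∀ j ∈ C.J W, j * z⁻¹ ∈ C.P := by
    intro j hj
    by_contra hn
    have h1 := C.inv_mem hn
    rw [mul_inv_rev, inv_inv] at h1
    have hd : C.deg (z * j⁻¹) = s := by rw [C.deg_mul, C.deg_inv, hzd, hj.1]; ring
    have h2 : z * j⁻¹ ∉ C.core W s := fun h => hz (by
      have := core_mul hO (hO.mem_of_mem_J hj) h
      rwa [inv_mul_cancel_right] at this)
    refine hj.2 (hW.mem_of_mul_J (by rw [C.deg_inv, hj.1, neg_zero]) fun i hi => ?_)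
    have h3 := hO.mem_of_mem_J (core_subset_mul_J hO hzd hz (key _ h1 hd h2 1 (by simp) i hi))
    have e : z⁻¹ * (1 * (z * j⁻¹) * i) = j⁻¹ * i := by group
    rwa [e] at h3
  have hJzn : ∀ k : ℕ, ∀ j ∈ C.J W, j * (z ^ k)⁻¹ ∈ C.P := by
    intro k
    induction k with
    | zero => intro j hj; simpa using hO.J_mem_P hj
    | succ k ih =>
      intro j hj
      obtain ⟨j₁, h₁, j₂, h₂, rfl⟩ := hW.idem j hj
      have := C.mul_mem (hJz _ h₁) (ih _ (hconjJ _ h₂))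
      have e : j₁ * z⁻¹ * (z * j₂ * z⁻¹ * (z ^ k)⁻¹) = j₁ * j₂ * (z ^ (k + 1))⁻¹ := by
        rw [pow_succ]; group
      rwa [e] at this
  have hznd : C.deg (z ^ n) = n * s := by rw [C.deg_pow, hzd]
  have hw := hy.mem_W _ (C.pow_mem hzP n) hznd
  have hw' : (z ^ n * y⁻¹)⁻¹ ∈ W := by
    refine hW.mem_of_J_mul (by rw [C.deg_inv, hO.deg_eq hw, neg_zero]) fun j hj => ?_
    obtain ⟨j₁, h₁, j₂, h₂, rfl⟩ := hW.idem j hj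
    have := C.mul_mem (hy.mem_P _ h₁) (hJzn n _ ((hy.conj_J_symm _).1 h₂))
    have e : j₁ * y * (y⁻¹ * j₂ * y * (z ^ n)⁻¹) = j₁ * j₂ * (z ^ n * y⁻¹)⁻¹ := by group
    rw [e] at this
    refine hO.mem_of_mem this ?_
    rw [C.deg_mul, C.deg_mul, C.deg_inv, hO.deg_eq hw, h₁.1, h₂.1]; ring
  have hgn : ∀ k : ℕ, (z ^ (k + 1))⁻¹ * g * z ^ (k + 1) ∈ W := by
    intro k
    induction k with
    | zero => simpa using hconj g hg0 hg
    | succ k ih =>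
      have := hconjW _ ih
      have e : z⁻¹ * ((z ^ (k + 1))⁻¹ * g * z ^ (k + 1)) * z
          = (z ^ (k + 1 + 1))⁻¹ * g * z ^ (k + 1 + 1) := by
        rw [pow_succ z (k + 1)]; group
      rwa [e] at this
  obtain ⟨m, rfl⟩ : ∃ m, n = m + 1 := ⟨n - 1, by omega⟩
  have h1 := (hy.conj _).1 (hgn m)
  have h2 := hO.mul_mem (hO.mul_mem hw h1) hw'
  have e : z ^ (m + 1) * y⁻¹ * (y * ((z ^ (m + 1))⁻¹ * g * z ^ (m + 1)) * y⁻¹)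
      * (z ^ (m + 1) * y⁻¹)⁻¹ = g := by group
  rw [e] at h2
  exact hgW h2

section Dichotomy

variable (hW : C.IsTop W)
  (hT : ∀ s g, C.deg g = 0 → (∀ c ∈ C.core W s, g * c ∈ C.core W s) → g ∈ W)
include hW hT

theorem exists_eq_core_mul_core (s : ℚ) {j : G} (hj : j ∈ C.J W) :
    ∃ c ∈ C.core W s, ∃ d ∈ C.core W (-s), j = c * d := by
  obtain ⟨j₁, h₁, j₂, h₂, rfl⟩ := hW.idem j hj
  have hz : ∃ z, C.deg z = s ∧ z ∉ C.core W s ∧ j₁ * z ∈ C.core W s := by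
    by_contra! hn
    refine h₁.2 (hT s _ (by rw [C.deg_inv, h₁.1, neg_zero]) fun c hc => ?_)
    by_contra hc'
    refine hn _ ?_ hc' (by rwa [mul_inv_cancel_left])
    rw [C.deg_mul, C.deg_inv, h₁.1, core_deg hc]; ring
  obtain ⟨z, hzd, hz, hjz⟩ := hz
  obtain ⟨c, hc, j₃, h₃, e⟩ := exists_eq_core_mul_J hW hjz
  refine ⟨c, hc, _, inv_mem_core_of_notMem hW hzd hz h₃ h₂, ?_⟩
  calc j₁ * j₂ = j₁ * z * z⁻¹ * j₂ := by group
    _ = _ := by rw [e]; group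

theorem sandwich_of_notMem_core {z : G} (hzP : z ∈ C.P) (hzd : C.deg z = s)
    (hz : z ∉ C.core W s) : C.Sandwich W s z := by
  have hO := hW.isOver
  have hzd' : C.deg z⁻¹ = -s := by rw [C.deg_inv, hzd]
  have hz' : z⁻¹ ∉ C.core W (-s) := by
    rintro ⟨j₁, h₁, b, hb, hbd, j₂, h₂, e⟩
    have h1 := hO.mem_of_mem (C.mul_mem (C.mul_mem hzP (hO.J_mem_P h₁)) hb)
      (by rw [C.deg_mul, C.deg_mul, hzd, h₁.1, hbd]; ring)
    have h2 := hO.mul_J h1 h₂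
    have e' : z * j₁ * b * j₂ = z * (j₁ * b * j₂) := by group
    rw [e', ← e, mul_inv_cancel] at h2
    exact hO.one_notMem_J h2
  -- for an element outside of the core of degree `v`, every element of `J(W)` factors through it
  have hfac : ∀ v u, C.deg u = v → u ∉ C.core W v → u⁻¹ ∉ C.core W (-v) → ∀ j ∈ C.J W,
      ∃ j₁ ∈ C.J W, ∃ j₂ ∈ C.J W, ∃ j₃ ∈ C.J W, j = j₁ * (u * j₂ * u⁻¹) * j₃ := by
    intro v u hud hu hu' j hj
    obtain ⟨c, hc, d, hd, rfl⟩ := exists_eq_core_mul_core hW hT v hj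
    obtain ⟨j₁, h₁, c', hc', rfl⟩ := exists_eq_J_mul_core hW hc
    obtain ⟨d', hd', j₃, h₃, rfl⟩ := exists_eq_core_mul_J hW hd
    have h1 := core_subset_mul_J hO hud hu hc'
    have h2 := core_subset_J_mul hO (by rw [C.deg_inv, hud]) hu' hd'
    rw [inv_inv] at h2
    exact ⟨j₁, h₁, u⁻¹ * c' * (d' * u), hO.J_mul h1 (hO.mem_of_mem_J h2), j₃, h₃, by group⟩
  have hmem : ∀ v u, C.deg u = v → (∀ i ∈ C.J W, ∀ i' ∈ C.J W, i * u * i' ∈ C.core W v) →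
      (∀ i ∈ C.J W, ∀ i' ∈ C.J W, i * u⁻¹ * i' ∈ C.core W (-v)) →
      ∀ j ∈ C.J W, u * j * u⁻¹ ∈ W := by
    intro v u hud hu hu' j hj
    have hd : C.deg (u * j * u⁻¹) = 0 := by
      rw [C.deg_mul, C.deg_mul, C.deg_inv, hj.1]; ring
    refine hW.mem_of_mul_J hd fun i' hi' => hW.mem_of_J_mul
      (by rw [C.deg_mul, hd, hi'.1, add_zero]) fun i hi => ?_
    obtain ⟨j₁, h₁, j₂, h₂, rfl⟩ := hW.idem j hj
    have := hO.mem_of_mem_J (core_mul_core_mem_J hO (hu i hi j₁ h₁) (hu' j₂ h₂ i' hi'))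
    have e : i * u * j₁ * (j₂ * u⁻¹ * i') = i * (u * (j₁ * j₂) * u⁻¹ * i') := by group
    rwa [e] at this
  have hJzJ : ∀ i ∈ C.J W, ∀ i' ∈ C.J W, i * z * i' ∈ C.core W s := fun i hi i' hi' =>
    ⟨i, hi, z, hzP, hzd, i', hi', rfl⟩
  have hJzJ' : ∀ i ∈ C.J W, ∀ i' ∈ C.J W, i * z⁻¹ * i' ∈ C.core W (-s) := fun i hi i' hi' =>
    inv_mem_core_of_notMem hW hzd hz hi hi'
  have hA : ∀ j ∈ C.J W, z * j * z⁻¹ ∈ W := hmem s z hzd hJzJ hJzJ'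
  have hB : ∀ j ∈ C.J W, z⁻¹ * j * z ∈ W := by
    have := hmem (-s) z⁻¹ hzd' hJzJ' (by simpa using hJzJ)
    simpa using this
  have hA' : ∀ j ∈ C.J W, z * j * z⁻¹ ∈ C.J W := by
    intro j hj
    obtain ⟨j₁, h₁, j₂, h₂, j₃, h₃, rfl⟩ := hfac (-s) z⁻¹ hzd' hz' (by simpa using hz) j hj
    have := hO.J_mul (hO.mul_J (hA _ h₁) h₂) (hA _ h₃)
    have e : z * j₁ * z⁻¹ * j₂ * (z * j₃ * z⁻¹) = z * (j₁ * (z⁻¹ * j₂ * z⁻¹⁻¹) * j₃) * z⁻¹ := by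
      group
    rwa [e] at this
  have hB' : ∀ j ∈ C.J W, z⁻¹ * j * z ∈ C.J W := by
    intro j hj
    obtain ⟨j₁, h₁, j₂, h₂, j₃, h₃, rfl⟩ := hfac s z hzd hz hz' j hj
    have := hO.J_mul (hO.mul_J (hB _ h₁) h₂) (hB _ h₃)
    have e : z⁻¹ * j₁ * z * j₂ * (z⁻¹ * j₃ * z) = z⁻¹ * (j₁ * (z * j₂ * z⁻¹) * j₃) * z := by
      group
    rwa [e] at this
  refine ⟨hzd, fun g => ⟨fun hg => ?_, fun hg => ?_⟩, fun j hj => C.mul_mem (hO.J_mem_P hj) hzP,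
    fun u hu hud => ?_⟩
  · refine hW.mem_of_mul_J (by rw [C.deg_mul, C.deg_mul, C.deg_inv, hO.deg_eq hg]; ring)
      fun j hj => ?_
    have := hO.mem_of_mem_J (hA' _ (hO.mul_J hg (hB' j hj)))
    have e : z * (g * (z⁻¹ * j * z)) * z⁻¹ = z * g * z⁻¹ * j := by group
    rwa [e] at this
  · have hg0 : C.deg g = 0 := by
      have := hO.deg_eq hg
      rw [C.deg_mul, C.deg_mul, C.deg_inv] at this
      linarith
    refine hW.mem_of_mul_J hg0 fun j hj => ?_
    have := hO.mem_of_mem_J (hB' _ (hO.mul_J hg (hA' j hj)))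
    have e : z⁻¹ * (z * g * z⁻¹ * (z * j * z⁻¹)) * z = g * j := by group
    rwa [e] at this
  · refine hW.mem_of_mul_J (by rw [C.deg_mul, C.deg_inv, hud, hzd]; ring) fun j hj => ?_
    obtain ⟨j₁, h₁, j₂, h₂, e⟩ := hW.idem _ (hB' j hj)
    have h1 := C.mul_mem hu (core_mem_P hO (hJzJ' j₁ h₁ _ (hA' j₂ h₂)))
    have e' : u * (j₁ * z⁻¹ * (z * j₂ * z⁻¹)) = u * z⁻¹ * j := by
      calc u * (j₁ * z⁻¹ * (z * j₂ * z⁻¹)) = u * (j₁ * j₂) * z⁻¹ := by group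
        _ = u * z⁻¹ * j := by rw [← e]; group
    rw [e'] at h1
    refine hO.mem_of_mem h1 ?_
    rw [C.deg_mul, C.deg_mul, C.deg_inv, hud, hzd, hj.1]; ring

theorem exists_J_mul_notMem_P (hs : ¬∃ γ, C.Sandwich W s γ) {z : G} (hz : z ∉ C.P)
    (hzd : C.deg z = s) : ∃ j ∈ C.J W, j * z ∉ C.P := by
  by_contra! hn
  have hO := hW.isOver
  refine hs ⟨z, ?_⟩
  have h1 : z⁻¹ ∉ C.core W (-s) := by
    intro h
    obtain ⟨c, hc, j, hj, e⟩ := exists_eq_core_mul_J hW h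
    have hjz : j * z ∈ C.core W (- -s) := by
      rw [neg_neg]
      by_contra hn'
      exact hs ⟨_, sandwich_of_notMem_core hW hT (hn j hj)
        (by rw [C.deg_mul, hj.1, hzd, zero_add]) hn'⟩
    have := core_mul_core_mem_J hO hc hjz
    rw [← mul_assoc, ← e, inv_mul_cancel] at this
    exact hO.one_notMem_J this
  have h2 := (sandwich_of_notMem_core hW hT (C.inv_mem hz) (by rw [C.deg_inv, hzd]) h1).inv hW
  simpa using h2

end Dichotomy

/-- Every element of a sandwiched component that is not in the lower bound is itself a normalizing
generator. -/
theorem Sandwich.of_notMem_J (hW : C.IsTop W) {γ a : G} (h : C.Sandwich W s γ) (ha : a ∈ C.P)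
    (had : C.deg a = s) (haJ : a * γ⁻¹ ∉ C.J W) : C.Sandwich W s a := by
  have h1 := h.mem_W a ha had
  have h2 : (a * γ⁻¹)⁻¹ ∈ W := by
    by_contra hn
    exact haJ ⟨hW.isOver.deg_eq h1, hn⟩
  have := h.unit_mul hW h1 h2
  rwa [inv_mul_cancel_right] at this

/-- If a component equals its lower bound, then so do all components of the same sign. -/
theorem Sandwich.low_of_low (hW : C.IsTop W) {t : ℚ} {γ δ : G} (hγ : C.Sandwich W t γ)
    (hlow : ∀ z ∈ C.P, C.deg z = t → z * γ⁻¹ ∈ C.J W) (hδ : C.Sandwich W s δ) (hst : 0 < s * t) :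
    ∀ z ∈ C.P, C.deg z = s → z * δ⁻¹ ∈ C.J W := by
  intro a ha had
  by_contra haJ
  have hO := hW.isOver
  have hSa := hδ.of_notMem_J hW ha had haJ
  obtain ⟨m, n, hm, hn, e⟩ := exists_mul_eq_mul hst
  have hγ' : γ⁻¹ ∈ C.P := by
    refine C.inv_mem fun h => ?_
    have := hlow γ h hγ.deg_eq
    rw [mul_inv_cancel] at this
    exact hO.one_notMem_J this
  obtain ⟨k, rfl⟩ : ∃ k, n = k + 1 := ⟨n - 1, by omega⟩
  have h1 := hlow _ (C.mul_mem (C.pow_mem ha m) (C.pow_mem hγ' k)) (by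
    rw [C.deg_mul, C.deg_pow, C.deg_pow, C.deg_inv, had, hγ.deg_eq, e]
    push_cast; ring)
  have h2 := (hSa.pow hW m).mul hW ((hγ.inv hW).pow hW (k + 1))
  have h3 : (m : ℚ) * s + (k + 1 : ℕ) * -t = 0 := by rw [e]; ring
  rw [h3] at h2
  have h4 := (h2.inv hW)
  rw [neg_zero] at h4
  have h5 := h4.mem_of_zero hW
  rw [mul_assoc, ← pow_succ] at h1
  exact h1.2 h5

theorem not_forall_sandwich (hW : C.IsTop W) {t : ℚ} (ht : C.L t = W) {r s : ℚ}
    (h : C.Fail r s) (hrs : 0 < r * s) : ¬∀ v, ∃ γ, C.Sandwich W v γ := by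
  intro hall
  have hO := hW.isOver
  obtain ⟨x, hx, hxd, hf⟩ := h
  obtain ⟨γ, hγ⟩ := hall r
  obtain ⟨δ, hδ⟩ := hall s
  have hγδ := hγ.mul hW hδ
  have hr0 : r ≠ 0 := by rintro rfl; simp at hrs
  by_cases hlow : ∃ v η, C.Sandwich W v η ∧ ∀ z ∈ C.P, C.deg z = v → z * η⁻¹ ∈ C.J W
  · obtain ⟨v, η, hη, hlow⟩ := hlow
    have hv0 : v ≠ 0 := by
      rintro rfl
      have := hlow 1 C.one_mem C.deg_one
      rw [one_mul] at this
      exact this.2 (by rw [inv_inv]; exact hη.mem_of_zero hW)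
    rcases lt_or_gt_of_ne (mul_ne_zero hr0 hv0) with hlt | hgt
    · have hsv : 0 < -s * v := by
        have h1 : 0 < (r * v) * (r * v) := mul_pos_of_neg_of_neg hlt hlt
        by_contra! hn
        nlinarith [mul_pos hrs (neg_pos.2 hlt), mul_self_nonneg r, mul_self_nonneg (r * v)]
      have hrv : 0 < -r * v := by linarith
      have full : ∀ u ζ, C.Sandwich W u ζ → 0 < -u * v → ∀ w ∈ W, w * ζ ∈ C.P := by
        intro u ζ hζ huv w hw
        by_contra hn
        have h1 := hη.low_of_low hW hlow (hζ.inv hW) huv _ (C.inv_mem hn)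
          (by rw [C.deg_inv, C.deg_mul, hO.deg_eq hw, hζ.deg_eq]; ring)
        have e : (w * ζ)⁻¹ * ζ⁻¹⁻¹ = ζ⁻¹ * w⁻¹ * ζ := by group
        rw [e, ← hζ.conj_J_symm] at h1
        exact h1.2 (by rwa [inv_inv])
      have hw := hγδ.mem_W x hx hxd
      refine hf _ (full r γ hγ hrv _ hw)
        (by rw [C.deg_mul, hO.deg_eq hw, hγ.deg_eq, zero_add]) ?_
      have e : (x * (γ * δ)⁻¹ * γ)⁻¹ * x = δ := by group
      rw [e]
      simpa using full s δ hδ hsv 1 hO.one_mem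
    · have hpv : 0 < (r + s) * v := by
        have h1 : 0 < s * v := by
          by_contra! hn
          nlinarith [mul_pos hrs hgt, mul_self_nonneg r, mul_pos hgt hgt]
        linarith
      have hj := hη.low_of_low hW hlow hγδ hpv x hx hxd
      obtain ⟨j₁, h₁, j₂, h₂, e⟩ := hW.idem _ hj
      refine hf _ (hγ.mem_P _ h₁) (by rw [C.deg_mul, h₁.1, hγ.deg_eq, zero_add]) ?_
      have := hδ.mem_P _ ((hγ.conj_J_symm _).1 h₂)
      have e' : (j₁ * γ)⁻¹ * x = γ⁻¹ * j₂ * γ * δ := by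
        calc (j₁ * γ)⁻¹ * x = (j₁ * γ)⁻¹ * (x * (γ * δ)⁻¹) * (γ * δ) := by group
          _ = _ := by rw [e]; group
      rwa [e']
  · push Not at hlow
    have htop : ∀ v, ∃ ζ ∈ C.P, C.Sandwich W v ζ := by
      intro v
      obtain ⟨ζ, hζ⟩ := hall v
      obtain ⟨z, hz, hzd, hzJ⟩ := hlow v ζ hζ
      exact ⟨z, hz, hζ.of_notMem_J hW hz hzd hzJ⟩
    have hWP : W ⊆ C.P := by
      intro w hw
      obtain ⟨a, ha, hSa⟩ := htop t
      obtain ⟨b, hb, hSb⟩ := htop (-t)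
      have h1 := hSa.mul hW hSb
      rw [add_neg_cancel] at h1
      have h2 := h1.inv hW
      rw [neg_zero] at h2
      have h3 := hO.mul_mem hw (h2.mem_of_zero hW)
      rw [← ht] at h3
      have h4 := C.mul_mem (h3.2 a ha hSa.deg_eq) hb
      have e : w * (a * b)⁻¹ * a * b = w := by group
      rwa [e] at h4
    obtain ⟨a, ha, hSa⟩ := htop r
    obtain ⟨b, hb, hSb⟩ := htop s
    have hw := (hSa.mul hW hSb).mem_W x hx hxd
    refine hf _ (C.mul_mem (hWP hw) ha)
      (by rw [C.deg_mul, hO.deg_eq hw, hSa.deg_eq, zero_add]) ?_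
    have e : (x * (a * b)⁻¹ * a)⁻¹ * x = b := by group
    rwa [e]

end GradedCone

namespace GradedCone

variable {G : Type*} [Group G] {C : GradedCone G} {W : Set G}

theorem mem_of_mul_core_of_sandwich (hW : C.IsTop W) {p : ℚ} (hp : p ≠ 0) {γ : G}
    (hγ : C.Sandwich W p γ) {s : ℚ} {g : G} (hg0 : C.deg g = 0)
    (hg : ∀ c ∈ C.core W s, g * c ∈ C.core W s) : g ∈ W := by
  rcases eq_or_ne s 0 with rfl | hs
  · exact mem_of_mul_core hW one_pos (by simpa using Sandwich.one hW.isOver) hg0 hg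
  rcases lt_or_gt_of_ne (mul_ne_zero hs hp) with hlt | hgt
  · obtain ⟨m, n, hm, hn, e⟩ := exists_mul_eq_mul (a := s) (b := -p) (by linarith)
    exact mem_of_mul_core hW hm (e ▸ (hγ.inv hW).pow hW n) hg0 hg
  · obtain ⟨m, n, hm, hn, e⟩ := exists_mul_eq_mul hgt
    exact mem_of_mul_core hW hm (e ▸ hγ.pow hW n) hg0 hg

/-- A component that is not sandwiched is a `W`-module equal to its products with `J(W)`. -/
structure Free (C : GradedCone G) (W : Set G) (s : ℚ) : Prop where
  L_eq : C.L s = W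
  R_eq : C.R s = W
  exists_J_mul : ∀ a ∈ C.P, C.deg a = s → ∃ j ∈ C.J W, ∃ b ∈ C.P, C.deg b = s ∧ a = j * b
  exists_mul_J : ∀ a ∈ C.P, C.deg a = s → ∃ j ∈ C.J W, ∃ b ∈ C.P, C.deg b = s ∧ a = b * j
  exists_notMem : ∀ z, z ∉ C.P → C.deg z = s → ∃ j ∈ C.J W, j * z ∉ C.P

theorem free_of_not_sandwich (hW : C.IsTop W) {p : ℚ} (hp : p ≠ 0) {γ : G}
    (hγ : C.Sandwich W p γ) {s : ℚ} (hs : ¬∃ δ, C.Sandwich W s δ) : C.Free W s := by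
  have hT : ∀ s g, C.deg g = 0 → (∀ c ∈ C.core W s, g * c ∈ C.core W s) → g ∈ W :=
    fun s g => mem_of_mul_core_of_sandwich hW hp hγ
  have hO := hW.isOver
  have hcore : ∀ a ∈ C.P, C.deg a = s → a ∈ C.core W s := by
    intro a ha had
    by_contra hn
    exact hs ⟨a, sandwich_of_notMem_core hW hT ha had hn⟩
  have hL : W ⊆ C.L s := fun w hw =>
    ⟨hO.deg_eq hw, fun a ha had => core_mem_P hO (mul_core hO hw (hcore a ha had))⟩
  have hR : W ⊆ C.R s := fun w hw =>
    ⟨hO.deg_eq hw, fun a ha had => core_mem_P hO (core_mul hO hw (hcore a ha had))⟩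
  refine ⟨(hW.L_subset s).antisymm hL, subset_antisymm ?_ hR, ?_, ?_,
    fun z hz hzd => exists_J_mul_notMem_P hW hT hs hz hzd⟩
  · rw [C.R_eq_L_neg]; exact hW.L_subset _
  · intro a ha had
    obtain ⟨j, hj, b, hb, e⟩ := exists_eq_J_mul_core hW (hcore a ha had)
    exact ⟨j, hj, b, core_mem_P hO hb, core_deg hb, e⟩
  · intro a ha had
    obtain ⟨b, hb, j, hj, e⟩ := exists_eq_core_mul_J hW (hcore a ha had)
    exact ⟨j, hj, b, core_mem_P hO hb, core_deg hb, e⟩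

end GradedCone

/-! ### Additive subgroups of a division ring -/

section DivisionRing

variable {K : Type*} [DivisionRing K]

theorem mem_leftOrder {I : AddSubgroup K} {a : K} : a ∈ leftOrder I ↔ ∀ x ∈ I, a * x ∈ I := Iff.rfl

theorem mem_mulElem_iff {I : AddSubgroup K} {c z : K} : z ∈ mulElem I c ↔ ∃ x ∈ I, x * c = z :=
  Iff.rfl

theorem mem_elemMul_iff {I : AddSubgroup K} {c z : K} : z ∈ elemMul c I ↔ ∃ x ∈ I, c * x = z :=
  Iff.rfl

theorem mem_mulElem {I : AddSubgroup K} {c z : K} (hc : c ≠ 0) :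
    z ∈ mulElem I c ↔ z * c⁻¹ ∈ I := by
  rw [mem_mulElem_iff]
  constructor
  · rintro ⟨x, hx, rfl⟩
    rwa [mul_inv_cancel_right₀ hc]
  · intro h
    exact ⟨_, h, inv_mul_cancel_right₀ hc z⟩

theorem mem_elemMul {I : AddSubgroup K} {c z : K} (hc : c ≠ 0) :
    z ∈ elemMul c I ↔ c⁻¹ * z ∈ I := by
  rw [mem_elemMul_iff]
  constructor
  · rintro ⟨x, hx, rfl⟩
    rwa [inv_mul_cancel_left₀ hc]
  · intro h
    exact ⟨_, h, mul_inv_cancel_left₀ hc z⟩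

theorem mem_leftStar {I : AddSubgroup K} {z : K} :
    z ∈ leftStar I ↔ ∀ c, I ≤ mulElem (leftOrder I).toAddSubgroup c →
      z ∈ mulElem (leftOrder I).toAddSubgroup c := by
  rw [leftStar, AddSubgroup.mem_sInf]
  constructor
  · intro h c hc
    exact h _ ⟨c, rfl, hc⟩
  · rintro h _ ⟨c, rfl, hc⟩
    exact h c hc

theorem le_leftStar (I : AddSubgroup K) : I ≤ leftStar I :=
  fun _ hz => mem_leftStar.2 fun _ hc => hc hz

theorem inv_mul_notMem {W : Subring K} {w b : K} (hw : w ∈ W) (hb : b⁻¹ ∉ W) (h0 : w * b ≠ 0) :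
    (w * b)⁻¹ ∉ W := by
  intro h
  refine hb ?_
  have hw0 : w ≠ 0 := left_ne_zero_of_mul h0
  have := W.mul_mem h hw
  rwa [mul_inv_rev, inv_mul_cancel_right₀ hw0] at this

/-- The ideal of nonunits of a total valuation ring. -/
def nonunitsIdeal {W : Subring K} (hW : IsTotalValuationRing W) : Ideal W where
  carrier := {w | (w : K) ≠ 0 → (w : K)⁻¹ ∉ W}
  zero_mem' h := absurd rfl h
  smul_mem' w b hb h0 := by
    have h0' : (w : K) * b ≠ 0 := h0
    exact inv_mul_notMem w.2 (hb (right_ne_zero_of_mul h0')) h0'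
  add_mem' := by
    intro a b ha hb
    by_cases ha0 : (a : K) = 0
    · have : a = 0 := Subtype.ext ha0
      simpa [this] using hb
    by_cases hb0 : (b : K) = 0
    · have : b = 0 := Subtype.ext hb0
      simpa [this] using ha
    rcases hW ((a : K) * (b : K)⁻¹) (mul_ne_zero ha0 (inv_ne_zero hb0)) with h | h
    · intro h0
      have e : ((a + b : W) : K) = ((a : K) * (b : K)⁻¹ + 1) * b := by
        push_cast
        rw [add_mul, inv_mul_cancel_right₀ hb0, one_mul]
      rw [e] at h0 ⊢
      exact inv_mul_notMem (W.add_mem h W.one_mem) (hb hb0) h0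
    · intro h0
      rw [mul_inv_rev, inv_inv] at h
      have e : ((a + b : W) : K) = (1 + (b : K) * (a : K)⁻¹) * a := by
        push_cast
        rw [add_mul, inv_mul_cancel_right₀ ha0, one_mul]
      rw [e] at h0 ⊢
      exact inv_mul_notMem (W.add_mem W.one_mem h) (ha ha0) h0

theorem jacobson_eq_nonunitsIdeal {W : Subring K} (hW : IsTotalValuationRing W) :
    Ring.jacobson W = nonunitsIdeal hW := by
  have hle : ∀ I : Ideal W, I ≠ ⊤ → I ≤ nonunitsIdeal hW := by
    intro I hI w hw h0 hinv
    refine hI ((Ideal.eq_top_iff_one I).2 ?_)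
    have : (⟨(w : K)⁻¹, hinv⟩ : W) * w = 1 := Subtype.ext (inv_mul_cancel₀ h0)
    rw [← this]
    exact I.mul_mem_left _ hw
  have hne : nonunitsIdeal hW ≠ ⊤ := by
    rw [Ne, Ideal.eq_top_iff_one]
    intro h
    have h' : ((1 : W) : K) ≠ 0 → ((1 : W) : K)⁻¹ ∉ W := h
    simp at h'
  rw [Ring.jacobson_eq_sInf_isMaximal]
  refine le_antisymm (sInf_le ?_) (le_sInf ?_)
  · refine ⟨hne, fun I hI => ?_⟩
    by_contra h
    exact hI.not_ge (hle I h)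
  · intro I hI
    exact (hI.eq_of_le hne (hle I hI.ne_top)).ge

theorem mem_jacobsonRad {W : Subring K} (hW : IsTotalValuationRing W) {z : K} (h0 : z ≠ 0) :
    z ∈ jacobsonRad W ↔ z⁻¹ ∉ W := by
  rw [jacobsonRad, AddSubgroup.mem_map]
  constructor
  · rintro ⟨w, hw, rfl⟩
    have hw' : w ∈ Ring.jacobson W := hw
    rw [jacobson_eq_nonunitsIdeal hW] at hw'
    exact hw' h0
  · intro h
    refine ⟨⟨z, (hW z h0).resolve_right h⟩, ?_, rfl⟩
    change _ ∈ Ring.jacobson W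
    rw [jacobson_eq_nonunitsIdeal hW]
    exact fun _ => h

theorem mul_mem_addSubgroup_mul {I B : AddSubgroup K} {x y : K} (hx : x ∈ I) (hy : y ∈ B) :
    x * y ∈ I * B :=
  AddSubmonoid.mul_mem_mul (M := I.toAddSubmonoid) (N := B.toAddSubmonoid) hx hy

theorem addSubgroup_mul_le {I B D : AddSubgroup K} :
    I * B ≤ D ↔ ∀ x ∈ I, ∀ y ∈ B, x * y ∈ D :=
  AddSubmonoid.mul_le (M := I.toAddSubmonoid) (N := B.toAddSubmonoid) (P := D.toAddSubmonoid)

/-- The elements of `I * B` are products if `I` is a right module over a total valuation ring. -/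
theorem exists_mul_of_mem_mul {U : Subring K} (hU : IsTotalValuationRing U) {I B : AddSubgroup K}
    (hI : ∀ x ∈ I, ∀ u ∈ U, x * u ∈ I) {z : K} (hz : z ∈ I * B) : ∃ x ∈ I, ∃ y ∈ B, z = x * y := by
  have hz' : z ∈ I.toAddSubmonoid * B.toAddSubmonoid := hz
  refine AddSubmonoid.mul_induction_on hz' (fun x hx y hy => ⟨x, hx, y, hy, rfl⟩) ?_
  · intro z z' h h'
    obtain ⟨x, hx, y, hy, rfl⟩ := h
    obtain ⟨x', hx', y', hy', rfl⟩ := h'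
    by_cases hy0 : y = 0
    · exact ⟨x', hx', y', hy', by simp [hy0]⟩
    by_cases hy0' : y' = 0
    · exact ⟨x, hx, y, hy, by simp [hy0']⟩
    rcases hU (y * y'⁻¹) (mul_ne_zero hy0 (inv_ne_zero hy0')) with h | h
    · refine ⟨x * (y * y'⁻¹) + x', I.add_mem (hI x hx _ h) hx', y', hy', ?_⟩
      rw [add_mul, mul_assoc x, inv_mul_cancel_right₀ hy0']
    · rw [mul_inv_rev, inv_inv] at h
      refine ⟨x + x' * (y' * y⁻¹), I.add_mem hx (hI x' hx' _ h), y, hy, ?_⟩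
      rw [add_mul, mul_assoc x', inv_mul_cancel_right₀ hy0]

end DivisionRing

/-! ### Graded extensions in terms of homogeneous elements -/

section Graded

variable {K G : Type*} [DivisionRing K] [AddCommGroup G] (σ : Multiplicative G →* RingAut K)

theorem autAt_zero (a : K) : autAt σ 0 a = a := by simp [autAt]

theorem autAt_add (g h : G) (a : K) : autAt σ (g + h) a = autAt σ g (autAt σ h a) := by
  simp [autAt]

theorem autAt_neg_autAt (g : G) (a : K) : autAt σ (-g) (autAt σ g a) = a := by
  rw [← autAt_add, neg_add_cancel, autAt_zero]

theorem autAt_autAt_neg (g : G) (a : K) : autAt σ g (autAt σ (-g) a) = a := by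
  rw [← autAt_add, add_neg_cancel, autAt_zero]

theorem mem_imageAt {g : G} {I : AddSubgroup K} {z : K} :
    z ∈ imageAt σ g I ↔ autAt σ (-g) z ∈ I := by
  constructor
  · rintro ⟨x, hx, rfl⟩
    have : autAt σ (-g) (autAt σ g x) ∈ I := by rwa [autAt_neg_autAt]
    exact this
  · intro h
    exact ⟨_, h, autAt_autAt_neg σ g z⟩

namespace SkewGroupRing

theorem coeffAt_monomial_self (g : G) (a : K) : coeffAt (monomial σ g a) g = a := by
  classical
  rw [coeffAt, monomial, SkewMonoidAlgebra.coeff_single_apply, if_pos rfl]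

theorem coeffAt_monomial_of_ne {g h : G} (hgh : g ≠ h) (a : K) :
    coeffAt (monomial σ g a) h = 0 := by
  classical
  rw [coeffAt, monomial, SkewMonoidAlgebra.coeff_single_apply, if_neg]
  simpa using hgh

theorem monomial_mem_homogeneousSum {A : G → AddSubgroup K} {g : G} {a : K} :
    monomial σ g a ∈ homogeneousSum σ A ↔ a ∈ A g := by
  constructor
  · intro h
    have := h g
    rwa [coeffAt_monomial_self] at this
  · intro h h'
    rcases eq_or_ne g h' with rfl | hne
    · rwa [coeffAt_monomial_self]
    · rw [coeffAt_monomial_of_ne σ hne]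
      exact (A h').zero_mem

theorem homogeneousSum_le_closure (A : G → AddSubgroup K) :
    homogeneousSum σ A ≤ AddSubgroup.closure {f | ∃ g, ∃ a ∈ A g, f = monomial σ g a} := by
  intro f hf
  have e : f = ∑ g ∈ SkewMonoidAlgebra.support (k := K) (G := Multiplicative G) f,
      monomial σ (Multiplicative.toAdd g) (coeffAt f (Multiplicative.toAdd g)) :=
    (SkewMonoidAlgebra.sum_single (k := K) (G := Multiplicative G) f).symm
  rw [e]
  exact AddSubgroup.sum_mem _ fun g _ => AddSubgroup.subset_closure ⟨_, _, hf _, rfl⟩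

theorem mul_mem_homogeneousSum {A : G → AddSubgroup K}
    (hA : ∀ g h, ∀ a ∈ A g, ∀ b ∈ A h, a * autAt σ g b ∈ A (g + h)) {f f' : SkewGroupRing σ}
    (hf : f ∈ homogeneousSum σ A) (hf' : f' ∈ homogeneousSum σ A) :
    f * f' ∈ homogeneousSum σ A := by
  have h1 := homogeneousSum_le_closure σ A hf
  have h2 := homogeneousSum_le_closure σ A hf'
  clear hf hf'
  induction h1 using AddSubgroup.closure_induction with
  | mem f h =>
    obtain ⟨g, a, ha, rfl⟩ := h
    induction h2 using AddSubgroup.closure_induction with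
    | mem f' h' =>
      obtain ⟨h, b, hb, rfl⟩ := h'
      rw [monomial_mul_monomial, monomial_mem_homogeneousSum]
      exact hA g h a ha b hb
    | zero => rw [mul_zero]; exact AddSubgroup.zero_mem _
    | add x y _ _ hx hy => rw [mul_add]; exact AddSubgroup.add_mem _ hx hy
    | neg x _ hx => rw [mul_neg]; exact AddSubgroup.neg_mem _ hx
  | zero => rw [zero_mul]; exact AddSubgroup.zero_mem _
  | add x y _ _ hx hy => rw [add_mul]; exact AddSubgroup.add_mem _ hx hy
  | neg x _ hx => rw [neg_mul]; exact AddSubgroup.neg_mem _ hx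

end SkewGroupRing

open SkewGroupRing

theorem isGradedExtension_iff {V : Subring K} {A : G → AddSubgroup K} :
    IsGradedExtension σ V A ↔ A 0 = V.toAddSubgroup ∧
      (∀ g h, ∀ a ∈ A g, ∀ b ∈ A h, a * autAt σ g b ∈ A (g + h)) ∧
      ∀ g a, a ≠ 0 → a ∈ A g ∨ autAt σ (-g) a⁻¹ ∈ A (-g) := by
  constructor
  · rintro ⟨⟨S, hS, hT⟩, h0⟩
    have hmem : ∀ {g a}, monomial σ g a ∈ S ↔ a ∈ A g := by
      intro g a
      rw [← monomial_mem_homogeneousSum σ, ← hS]; rfl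
    refine ⟨h0, fun g h a ha b hb => ?_, fun g a ha => ?_⟩
    · rw [← hmem, ← monomial_mul_monomial]
      exact S.mul_mem (hmem.2 ha) (hmem.2 hb)
    · exact (hT g a ha).imp hmem.1 hmem.1
  · rintro ⟨h0, hmul, hT⟩
    refine ⟨⟨{ homogeneousSum σ A with
      mul_mem' := fun hf hf' => mul_mem_homogeneousSum σ hmul hf hf'
      one_mem' := ?_ }, rfl, fun g a ha => ?_⟩, h0⟩
    · have : monomial σ 0 1 ∈ homogeneousSum σ A := by
        rw [monomial_mem_homogeneousSum, h0]; exact V.one_mem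
      exact this
    · exact (hT g a ha).imp (monomial_mem_homogeneousSum σ).2 (monomial_mem_homogeneousSum σ).2

end Graded

namespace GradedCone

variable {G : Type*} [Group G] {C : GradedCone G} {W : Set G}

/-- The cone obtained by replacing the sandwiched components of negative degree by their upper
bound and those of positive degree by their lower bound. -/
def Modified (C : GradedCone G) (W : Set G) (H : AddSubgroup ℚ) (γ : ℚ → G) (x : G) : Prop :=
  (C.deg x = 0 ∧ x ∈ C.P) ∨
  (C.deg x ∈ H ∧ C.deg x < 0 ∧ x * (γ (C.deg x))⁻¹ ∈ W) ∨
  (C.deg x ∈ H ∧ 0 < C.deg x ∧ x * (γ (C.deg x))⁻¹ ∈ C.J W) ∨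
  (C.deg x ∉ H ∧ x ∈ C.P)

section Modified

variable {H : AddSubgroup ℚ} {γ : ℚ → G}

theorem Modified.cases_of_mem (hW : C.IsTop W) (hγ : ∀ s ∈ H, C.Sandwich W s (γ s)) {x : G}
    (hx : C.Modified W H γ x) (hxH : C.deg x ∈ H) : x * (γ (C.deg x))⁻¹ ∈ W := by
  rcases hx with ⟨h0, h⟩ | ⟨-, -, h⟩ | ⟨-, -, h⟩ | ⟨h', h⟩
  · exact (hγ _ hxH).mem_W x h rfl
  · exact h
  · exact hW.isOver.mem_of_mem_J h
  · exact absurd hxH h'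

theorem modified_of_mem_J (hγ : ∀ s ∈ H, C.Sandwich W s (γ s)) (hW : C.IsTop W) {x : G}
    (hxH : C.deg x ∈ H) (h : x * (γ (C.deg x))⁻¹ ∈ C.J W) : C.Modified W H γ x := by
  rcases lt_trichotomy (C.deg x) 0 with h1 | h1 | h1
  · exact .inr (.inl ⟨hxH, h1, hW.isOver.mem_of_mem_J h⟩)
  · have := (hγ _ hxH).mem_P _ h
    rw [inv_mul_cancel_right] at this
    exact .inl ⟨h1, this⟩
  · exact .inr (.inr (.inl ⟨hxH, h1, h⟩))

theorem Modified.mem_P {x : G} (hx : C.Modified W H γ x) (hxH : C.deg x ∉ H) : x ∈ C.P := by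
  rcases hx with ⟨-, h⟩ | ⟨h', -⟩ | ⟨h', -⟩ | ⟨-, h⟩
  · exact h
  · exact absurd h' hxH
  · exact absurd h' hxH
  · exact h

theorem Sandwich.mul_mul_inv_mem (hW : C.IsTop W) {r s : ℚ} {a b c : G} (ha : C.Sandwich W r a)
    (hb : C.Sandwich W s b) (hc : C.Sandwich W (r + s) c) : a * b * c⁻¹ ∈ W := by
  have h := (ha.mul hW hb).mul hW (hc.inv hW)
  rw [add_neg_cancel] at h
  exact h.mem_of_zero hW

theorem Modified.mul (hW : C.IsTop W) (hγ : ∀ s ∈ H, C.Sandwich W s (γ s))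
    (hF : ∀ s, s ∉ H → C.Free W s) {x y : G} (hx : C.Modified W H γ x)
    (hy : C.Modified W H γ y) : C.Modified W H γ (x * y) := by
  have hO := hW.isOver
  have hdeg : C.deg (x * y) = C.deg x + C.deg y := C.deg_mul x y
  by_cases hxH : C.deg x ∈ H <;> by_cases hyH : C.deg y ∈ H
  · have hxyH : C.deg (x * y) ∈ H := hdeg ▸ H.add_mem hxH hyH
    have hSx := hγ _ hxH
    have hSy := hγ _ hyH
    have hxW := hx.cases_of_mem hW hγ hxH
    have hyW := hy.cases_of_mem hW hγ hyH
    have hc : γ (C.deg x) * γ (C.deg y) * (γ (C.deg (x * y)))⁻¹ ∈ W :=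
      hSx.mul_mul_inv_mem hW hSy (by rw [← hdeg]; exact hγ _ hxyH)
    have e : x * y * (γ (C.deg (x * y)))⁻¹ = x * (γ (C.deg x))⁻¹ *
        (γ (C.deg x) * (y * (γ (C.deg y))⁻¹) * (γ (C.deg x))⁻¹) *
        (γ (C.deg x) * γ (C.deg y) * (γ (C.deg (x * y)))⁻¹) := by group
    rcases lt_trichotomy (C.deg x) 0 with h1 | h1 | h1
    · rcases lt_trichotomy (C.deg y) 0 with h2 | h2 | h2
      · refine .inr (.inl ⟨hxyH, by linarith, ?_⟩)
        rw [e]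
        exact hO.mul_mem (hO.mul_mem hxW ((hSx.conj _).1 hyW)) hc
      · have hyP : y ∈ C.P := by
          rcases hy with ⟨-, h⟩ | ⟨-, h, -⟩ | ⟨-, h, -⟩ | ⟨h, -⟩
          · exact h
          · linarith
          · linarith
          · exact absurd hyH h
        have hd : C.deg (x * y) = C.deg x := by rw [hdeg, h2, add_zero]
        refine .inr (.inl ⟨hxyH, by linarith, ?_⟩)
        rw [hd]
        have e' : x * y * (γ (C.deg x))⁻¹
            = x * (γ (C.deg x))⁻¹ * (γ (C.deg x) * y * (γ (C.deg x))⁻¹) := by group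
        rw [e']
        exact hO.mul_mem hxW ((hSx.conj _).1 (hO.mem_of_mem hyP h2))
      · have hyJ : y * (γ (C.deg y))⁻¹ ∈ C.J W := by
          rcases hy with ⟨h, -⟩ | ⟨-, h, -⟩ | ⟨-, -, h⟩ | ⟨h, -⟩
          · linarith
          · linarith
          · exact h
          · exact absurd hyH h
        refine modified_of_mem_J hγ hW hxyH ?_
        rw [e]
        exact hO.J_mul (hO.mul_J hxW ((hSx.conj_J _).1 hyJ)) hc
    · have hxP : x ∈ C.P := by
        rcases hx with ⟨-, h⟩ | ⟨-, h, -⟩ | ⟨-, h, -⟩ | ⟨h, -⟩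
        · exact h
        · linarith
        · linarith
        · exact absurd hxH h
      have hxW' := hO.mem_of_mem hxP h1
      have hd : C.deg (x * y) = C.deg y := by rw [hdeg, h1, zero_add]
      rcases hy with ⟨h2, h⟩ | ⟨-, h2, h⟩ | ⟨-, h2, h⟩ | ⟨h, -⟩
      · exact .inl ⟨by rw [hd, h2], C.mul_mem hxP h⟩
      · refine .inr (.inl ⟨hxyH, by linarith, ?_⟩)
        rw [hd, mul_assoc]
        exact hO.mul_mem hxW' h
      · refine .inr (.inr (.inl ⟨hxyH, by linarith, ?_⟩))
        rw [hd, mul_assoc]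
        exact hO.mul_J hxW' h
      · exact absurd hyH h
    · have hxJ : x * (γ (C.deg x))⁻¹ ∈ C.J W := by
        rcases hx with ⟨h, -⟩ | ⟨-, h, -⟩ | ⟨-, -, h⟩ | ⟨h, -⟩
        · linarith
        · linarith
        · exact h
        · exact absurd hxH h
      refine modified_of_mem_J hγ hW hxyH ?_
      rw [e]
      exact hO.J_mul (hO.J_mul hxJ ((hSx.conj _).1 hyW)) hc
  · have hxyH : C.deg (x * y) ∉ H := fun h => hyH (by
      have := H.sub_mem h hxH
      rwa [hdeg, add_sub_cancel_left] at this)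
    refine .inr (.inr (.inr ⟨hxyH, ?_⟩))
    obtain ⟨j, hj, b, hb, -, e⟩ := (hF _ hyH).exists_J_mul y (hy.mem_P hyH) rfl
    have hS := hγ _ hxH
    have h1 := hS.mem_P _ (hO.mul_J (hx.cases_of_mem hW hγ hxH) ((hS.conj_J _).1 hj))
    have h2 := C.mul_mem h1 hb
    have e' : x * (γ (C.deg x))⁻¹ * (γ (C.deg x) * j * (γ (C.deg x))⁻¹) * γ (C.deg x) * b
        = x * (j * b) := by group
    rwa [e', ← e] at h2
  · have hxyH : C.deg (x * y) ∉ H := fun h => hxH (by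
      have := H.sub_mem h hyH
      rwa [hdeg, add_sub_cancel_right] at this)
    refine .inr (.inr (.inr ⟨hxyH, ?_⟩))
    obtain ⟨j, hj, b, hb, -, e⟩ := (hF _ hxH).exists_mul_J x (hx.mem_P hxH) rfl
    have h1 := C.mul_mem hb ((hγ _ hyH).mem_P _ (hO.J_mul hj (hy.cases_of_mem hW hγ hyH)))
    have e' : b * (j * (y * (γ (C.deg y))⁻¹) * γ (C.deg y)) = b * j * y := by group
    rwa [e', ← e] at h1
  · have hxP := hx.mem_P hxH
    have hyP := hy.mem_P hyH
    by_cases hxyH : C.deg (x * y) ∈ H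
    · refine modified_of_mem_J hγ hW hxyH ?_
      obtain ⟨j, hj, b, hb, hbd, e⟩ := (hF _ hxH).exists_J_mul x hxP rfl
      have h1 := (hγ _ hxyH).mem_W _ (C.mul_mem hb hyP) (by rw [C.deg_mul, hbd, hdeg])
      have h2 := hO.J_mul hj h1
      have e' : j * (b * y * (γ (C.deg (x * y)))⁻¹) = j * b * y * (γ (C.deg (x * y)))⁻¹ := by group
      rwa [e', ← e] at h2
    · exact .inr (.inr (.inr ⟨hxyH, C.mul_mem hxP hyP⟩))

theorem modified_total (hW : C.IsTop W) (hγ : ∀ s ∈ H, C.Sandwich W s (γ s)) (x : G) :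
    C.Modified W H γ x ∨ C.Modified W H γ x⁻¹ := by
  have hO := hW.isOver
  have hdeg : C.deg x⁻¹ = -C.deg x := C.deg_inv x
  by_cases hxH : C.deg x ∈ H
  · have hxH' : C.deg x⁻¹ ∈ H := hdeg ▸ H.neg_mem hxH
    wlog hpos : 0 ≤ C.deg x generalizing x
    · have := this x⁻¹ (by rw [C.deg_inv x⁻¹, hdeg]) hxH' (by rwa [inv_inv]) (by linarith)
      rw [inv_inv] at this
      exact this.symm
    rcases hpos.eq_or_lt with h0 | hpos
    · exact (C.total x).imp (fun h => .inl ⟨h0.symm, h⟩) fun h => .inl ⟨by rw [hdeg, ← h0, neg_zero], h⟩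
    · have hS := hγ _ hxH
      by_cases hJ : x * (γ (C.deg x))⁻¹ ∈ C.J W
      · exact .inl (.inr (.inr (.inl ⟨hxH, hpos, hJ⟩)))
      · have h0 : C.deg (x * (γ (C.deg x))⁻¹) = 0 := by
          rw [C.deg_mul, C.deg_inv, hS.deg_eq, add_neg_cancel]
        have h1 : (x * (γ (C.deg x))⁻¹)⁻¹ ∈ W := by
          by_contra hn
          exact hJ ⟨h0, hn⟩
        have h2 := (hS.conj_symm _).1 h1
        have hS' := hγ _ hxH'
        have h3 := (hS.inv hW).mul hW (hS'.inv hW)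
        rw [hdeg, neg_neg, neg_add_cancel, ← hdeg] at h3
        have h4 := hO.mul_mem h2 (h3.mem_of_zero hW)
        refine .inr (.inr (.inl ⟨hxH', by linarith, ?_⟩))
        have e : (γ (C.deg x))⁻¹ * (x * (γ (C.deg x))⁻¹)⁻¹ * γ (C.deg x) *
            ((γ (C.deg x))⁻¹ * (γ (C.deg x⁻¹))⁻¹) = x⁻¹ * (γ (C.deg x⁻¹))⁻¹ := by group
        rwa [e] at h4
  · have hxH' : C.deg x⁻¹ ∉ H := fun h => hxH (by
      have := H.neg_mem h
      rwa [hdeg, neg_neg] at this)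
    exact (C.total x).imp (fun h => .inr (.inr (.inr ⟨hxH, h⟩))) fun h =>
      .inr (.inr (.inr ⟨hxH', h⟩))

end Modified

/-! Reconstruction of a set `P` from a cone `D` that agrees with `P` outside of `H`. -/

section Reconstruct

variable {D : GradedCone G} {P : Set G} {H : AddSubgroup ℚ} {γ : ℚ → G}

/-- The data from which `P` is shown to be a cone. -/
structure Recon (D : GradedCone G) (W P : Set G) (H : AddSubgroup ℚ) (γ : ℚ → G) : Prop where
  isOver : D.Over W
  conj : ∀ s ∈ H, ∀ g, g ∈ W ↔ γ s * g * (γ s)⁻¹ ∈ W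
  mem_P_of_J : ∀ s ∈ H, ∀ j ∈ D.J W, j * γ s ∈ P
  mem_W_of_P : ∀ x ∈ P, D.deg x ∈ H → x * (γ (D.deg x))⁻¹ ∈ W
  mem_D_of_J : ∀ s ∈ H, ∀ j ∈ D.J W, j * γ s ∈ D.P
  mem_W_of_D : ∀ x ∈ D.P, D.deg x ∈ H → D.deg x ≠ 0 → x * (γ (D.deg x))⁻¹ ∈ W
  zero_iff : ∀ x, D.deg x = 0 → (x ∈ D.P ↔ x ∈ P)
  notMem_iff : ∀ x, D.deg x ∉ H → (x ∈ D.P ↔ x ∈ P)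
  exists_J_mul : ∀ x ∈ P, D.deg x ∉ H → ∃ j ∈ D.J W, ∃ b ∈ P, D.deg b = D.deg x ∧ x = j * b
  exists_mul_J : ∀ x ∈ P, D.deg x ∉ H → ∃ j ∈ D.J W, ∃ b ∈ P, D.deg b = D.deg x ∧ x = b * j
  mul_mem : ∀ x ∈ P, ∀ y ∈ P, D.deg x ∈ H → D.deg y ∈ H → x * y ∈ P
  total : ∀ x, D.deg x ∈ H → x ∈ P ∨ x⁻¹ ∈ P

theorem Recon.mul_mul_inv_mem_J {W : Set G} (h : Recon D W P H γ) {x y : G} (hx : x ∈ P)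
    (hy : y ∈ P) (hxH : D.deg x ∉ H) (hyH : D.deg y ∉ H) (hxyH : D.deg (x * y) ∈ H)
    (h0 : D.deg (x * y) ≠ 0) : x * y * (γ (D.deg (x * y)))⁻¹ ∈ D.J W := by
  obtain ⟨j, hj, b, hb, hbd, e⟩ := h.exists_J_mul x hx hxH
  have hd : D.deg (b * y) = D.deg (x * y) := by rw [D.deg_mul, D.deg_mul, hbd]
  have h1 := h.mem_W_of_D _ (D.mul_mem ((h.notMem_iff b (hbd ▸ hxH)).2 hb)
    ((h.notMem_iff y hyH).2 hy)) (hd ▸ hxyH) (hd ▸ h0)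
  rw [hd] at h1
  have h2 := h.isOver.J_mul hj h1
  have e' : j * (b * y * (γ (D.deg (x * y)))⁻¹) = j * b * y * (γ (D.deg (x * y)))⁻¹ := by group
  rwa [e', ← e] at h2

theorem Recon.conj_J {W : Set G} (h : Recon D W P H γ) {s : ℚ} (hs : s ∈ H) {j : G}
    (hj : j ∈ D.J W) : γ s * j * (γ s)⁻¹ ∈ D.J W := by
  refine ⟨by rw [D.deg_mul, D.deg_mul, D.deg_inv, hj.1]; ring, fun h1 => hj.2 ?_⟩
  rw [h.conj s hs]
  have e : (γ s * j * (γ s)⁻¹)⁻¹ = γ s * j⁻¹ * (γ s)⁻¹ := by group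
  rwa [← e]

theorem Recon.mul_mem_P {W : Set G} (h : Recon D W P H γ) {x y : G} (hx : x ∈ P) (hy : y ∈ P) :
    x * y ∈ P := by
  have hO := h.isOver
  have hdeg : D.deg (x * y) = D.deg x + D.deg y := D.deg_mul x y
  by_cases hxH : D.deg x ∈ H <;> by_cases hyH : D.deg y ∈ H
  · exact h.mul_mem x hx y hy hxH hyH
  · have hxyH : D.deg (x * y) ∉ H := fun h => hyH (by
      have := H.sub_mem h hxH
      rwa [hdeg, add_sub_cancel_left] at this)
    obtain ⟨j, hj, b, hb, hbd, e⟩ := h.exists_J_mul y hy hyH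
    have h1 := h.mem_D_of_J _ hxH _ (hO.mul_J (h.mem_W_of_P x hx hxH) (h.conj_J hxH hj))
    have h2 := D.mul_mem h1 ((h.notMem_iff b (hbd ▸ hyH)).2 hb)
    have e' : x * (γ (D.deg x))⁻¹ * (γ (D.deg x) * j * (γ (D.deg x))⁻¹) * γ (D.deg x) * b
        = x * (j * b) := by group
    rw [e', ← e] at h2
    exact (h.notMem_iff _ hxyH).1 h2
  · have hxyH : D.deg (x * y) ∉ H := fun h => hxH (by
      have := H.sub_mem h hyH
      rwa [hdeg, add_sub_cancel_right] at this)
    obtain ⟨j, hj, b, hb, hbd, e⟩ := h.exists_mul_J x hx hxH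
    have h1 := D.mul_mem ((h.notMem_iff b (hbd ▸ hxH)).2 hb)
      (h.mem_D_of_J _ hyH _ (hO.J_mul hj (h.mem_W_of_P y hy hyH)))
    have e' : b * (j * (y * (γ (D.deg y))⁻¹) * γ (D.deg y)) = b * j * y := by group
    rw [e', ← e] at h1
    exact (h.notMem_iff _ hxyH).1 h1
  · by_cases hxyH : D.deg (x * y) ∈ H
    · by_cases h0 : D.deg (x * y) = 0
      · exact (h.zero_iff _ h0).1
          (D.mul_mem ((h.notMem_iff x hxH).2 hx) ((h.notMem_iff y hyH).2 hy))
      · have := h.mem_P_of_J _ hxyH _ (h.mul_mul_inv_mem_J hx hy hxH hyH hxyH h0)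
        rwa [inv_mul_cancel_right] at this
    · exact (h.notMem_iff _ hxyH).1
        (D.mul_mem ((h.notMem_iff x hxH).2 hx) ((h.notMem_iff y hyH).2 hy))

theorem Recon.total_P {W : Set G} (h : Recon D W P H γ) (x : G) : x ∈ P ∨ x⁻¹ ∈ P := by
  by_cases hxH : D.deg x ∈ H
  · exact h.total x hxH
  · refine (D.total x).imp (h.notMem_iff x hxH).1 (h.notMem_iff _ fun h' => hxH ?_).1
    have := H.neg_mem h'
    rwa [D.deg_inv, neg_neg] at this

end Reconstruct

end GradedCone

section Homogeneous

variable {K : Type*} [DivisionRing K] (σ : Multiplicative ℚ →* RingAut K)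

/-- The action of `ℚ` on the units of `K`. -/
def unitsAut : Multiplicative ℚ →* MulAut Kˣ where
  toFun r := Units.mapEquiv (σ r : K ≃+* K).toMulEquiv
  map_one' := by ext; simp
  map_mul' r s := by ext; simp

/-- The group of nonzero homogeneous elements of `K[ℚ, σ]`. -/
abbrev HomogeneousUnits : Type _ := Kˣ ⋊[unitsAut σ] Multiplicative ℚ

namespace HomogeneousUnits

variable {σ}

/-- The degree `r` of `a X^r`. -/
def deg (x : HomogeneousUnits σ) : ℚ := Multiplicative.toAdd x.right

/-- The coefficient `a` of `a X^r`. -/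
def coef (x : HomogeneousUnits σ) : K := x.left

theorem coef_ne_zero (x : HomogeneousUnits σ) : x.coef ≠ 0 := x.left.ne_zero

theorem deg_mul (x y : HomogeneousUnits σ) : (x * y).deg = x.deg + y.deg := by
  simp [deg]

theorem deg_inv (x : HomogeneousUnits σ) : (x⁻¹).deg = -x.deg := by
  simp [deg]

theorem coef_mul (x y : HomogeneousUnits σ) : (x * y).coef = x.coef * autAt σ x.deg y.coef := by
  simp [coef, deg, autAt, unitsAut]

theorem coef_inv (x : HomogeneousUnits σ) : (x⁻¹).coef = autAt σ (-x.deg) x.coef⁻¹ := by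
  simp [coef, deg, autAt, unitsAut]

theorem ext' {x y : HomogeneousUnits σ} (h : x.coef = y.coef) (h' : x.deg = y.deg) : x = y := by
  apply SemidirectProduct.ext
  · exact Units.ext h
  · exact Multiplicative.toAdd.injective h'

variable (σ)

/-- The homogeneous element `a X^r`. -/
def homog (r : ℚ) (a : K) (ha : a ≠ 0) : HomogeneousUnits σ :=
  ⟨Units.mk0 a ha, Multiplicative.ofAdd r⟩

@[simp] theorem deg_homog (r : ℚ) (a : K) (ha : a ≠ 0) : (homog σ r a ha).deg = r := rfl

@[simp] theorem coef_homog (r : ℚ) (a : K) (ha : a ≠ 0) : (homog σ r a ha).coef = a := rfl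

/-- The homogeneous elements of degree zero with coefficient in `W`. -/
def ofSubring (W : Subring K) : Set (HomogeneousUnits σ) := {x | x.deg = 0 ∧ x.coef ∈ W}

end HomogeneousUnits

open HomogeneousUnits

/-- The closure properties of the components of a graded extension. -/
structure IsConeFamily (A : ℚ → AddSubgroup K) : Prop where
  mul_mem : ∀ r s, ∀ a ∈ A r, ∀ b ∈ A s, a * autAt σ r b ∈ A (r + s)
  total : ∀ r a, a ≠ 0 → a ∈ A r ∨ autAt σ (-r) a⁻¹ ∈ A (-r)

variable {σ} {A : ℚ → AddSubgroup K}

/-- The nonzero homogeneous elements of a graded extension form a cone. -/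
def IsConeFamily.cone (hA : IsConeFamily σ A) : GradedCone (HomogeneousUnits σ) where
  deg := deg
  deg_mul := deg_mul
  P := {x | x.coef ∈ A x.deg}
  mul_mem {x y} hx hy := by
    change (x * y).coef ∈ A (x * y).deg
    rw [coef_mul, deg_mul]
    exact hA.mul_mem _ _ _ hx _ hy
  total x := by
    change x.coef ∈ A x.deg ∨ (x⁻¹).coef ∈ A (x⁻¹).deg
    rw [coef_inv, deg_inv]
    exact hA.total _ _ x.coef_ne_zero

namespace IsConeFamily

variable (hA : IsConeFamily σ A)

theorem mem_P {x : HomogeneousUnits σ} : x ∈ hA.cone.P ↔ x.coef ∈ A x.deg := Iff.rfl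

theorem deg_cone (x : HomogeneousUnits σ) : hA.cone.deg x = x.deg := rfl

theorem mem_L {s : ℚ} {x : HomogeneousUnits σ} :
    x ∈ hA.cone.L s ↔ x.deg = 0 ∧ x.coef ∈ leftOrder (A s) := by
  refine and_congr_right fun h0 => ?_
  have h0' : x.deg = 0 := h0
  constructor
  · intro h a ha
    by_cases ha0 : a = 0
    · rw [ha0, mul_zero]; exact (A s).zero_mem
    have := h (homog σ s a ha0) ha rfl
    rw [mem_P, coef_mul, deg_mul, h0', autAt_zero, zero_add] at this
    exact this
  · intro h y hy hys
    have hys' : y.deg = s := hys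
    rw [mem_P, hys'] at hy
    rw [mem_P, coef_mul, deg_mul, h0', autAt_zero, zero_add, hys']
    exact h _ hy

theorem mem_R {s : ℚ} {x : HomogeneousUnits σ} :
    x ∈ hA.cone.R s ↔ x.deg = 0 ∧ autAt σ s x.coef ∈ rightOrder (A s) := by
  refine and_congr_right fun h0 => ?_
  have h0' : x.deg = 0 := h0
  constructor
  · intro h a ha
    by_cases ha0 : a = 0
    · rw [ha0, zero_mul]; exact (A s).zero_mem
    have := h (homog σ s a ha0) ha rfl
    rw [mem_P, coef_mul, deg_mul, h0', add_zero] at this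
    exact this
  · intro h y hy hys
    have hys' : y.deg = s := hys
    rw [mem_P, hys'] at hy
    rw [mem_P, coef_mul, deg_mul, h0', add_zero, hys']
    exact h _ hy

theorem mem_of_L_eq {W : Subring K} {s : ℚ} (h : hA.cone.L s = ofSubring σ W) :
    leftOrder (A s) = W := by
  ext a
  by_cases ha : a = 0
  · simp [ha]
  have := Set.ext_iff.1 h (homog σ 0 a ha)
  rw [mem_L] at this
  simpa [ofSubring] using this

theorem L_eq_of_eq {W : Subring K} {s : ℚ} (h : leftOrder (A s) = W) :
    hA.cone.L s = ofSubring σ W := by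
  ext x
  rw [mem_L, h]; rfl

theorem rightOrder_of_R_eq {W : Subring K} {s : ℚ} (h : hA.cone.R s = ofSubring σ W) :
    (rightOrder (A s)).toAddSubgroup = imageAt σ s W.toAddSubgroup := by
  ext a
  rw [mem_imageAt]
  by_cases ha : a = 0
  · simp [ha]
  have ha' : autAt σ (-s) a ≠ 0 := by simpa using ha
  have := Set.ext_iff.1 h (homog σ 0 _ ha')
  rw [mem_R, coef_homog, autAt_autAt_neg] at this
  simpa [ofSubring] using this

theorem mem_J {W : Subring K} (hW : IsTotalValuationRing W) {x : HomogeneousUnits σ} :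
    x ∈ hA.cone.J (ofSubring σ W) ↔ x.deg = 0 ∧ x.coef ∈ jacobsonRad W := by
  refine and_congr_right fun h0 => ?_
  have h0' : x.deg = 0 := h0
  rw [mem_jacobsonRad hW x.coef_ne_zero]
  refine not_congr ?_
  change (x⁻¹).deg = 0 ∧ (x⁻¹).coef ∈ W ↔ _
  rw [deg_inv, coef_inv, h0', neg_zero, autAt_zero]
  simp

end IsConeFamily

theorem IsTotalValuationRing.mono {V W : Subring K} (hV : IsTotalValuationRing V) (h : V ≤ W) :
    IsTotalValuationRing W := fun k hk => (hV k hk).imp (fun h' => h h') fun h' => h h'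

theorem jacobsonRad_le (W : Subring K) : jacobsonRad W ≤ W.toAddSubgroup := by
  rintro _ ⟨w, -, rfl⟩
  exact w.2

section Radical

variable {W : Subring K} (hW : IsTotalValuationRing W)
include hW

theorem one_notMem_jacobsonRad : (1 : K) ∉ jacobsonRad W := by
  rw [mem_jacobsonRad hW one_ne_zero]
  simp

theorem mul_mem_jacobsonRad {w j : K} (hw : w ∈ W) (hj : j ∈ jacobsonRad W) :
    w * j ∈ jacobsonRad W := by
  by_cases h0 : w * j = 0
  · rw [h0]; exact (jacobsonRad W).zero_mem
  rw [mem_jacobsonRad hW (right_ne_zero_of_mul h0)] at hj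
  rw [mem_jacobsonRad hW h0]
  exact inv_mul_notMem hw hj h0

theorem jacobsonRad_mul_mem {w j : K} (hj : j ∈ jacobsonRad W) (hw : w ∈ W) :
    j * w ∈ jacobsonRad W := by
  by_cases h0 : j * w = 0
  · rw [h0]; exact (jacobsonRad W).zero_mem
  rw [mem_jacobsonRad hW (left_ne_zero_of_mul h0)] at hj
  rw [mem_jacobsonRad hW h0]
  intro h
  refine hj ?_
  have := W.mul_mem hw h
  rwa [mul_inv_rev, mul_inv_cancel_left₀ (right_ne_zero_of_mul h0)] at this

variable (hJ : jacobsonRad W * jacobsonRad W = jacobsonRad W)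
include hJ

theorem exists_mul_of_mem_jacobsonRad {j : K} (hj : j ∈ jacobsonRad W) :
    ∃ j₁ ∈ jacobsonRad W, ∃ j₂ ∈ jacobsonRad W, j = j₁ * j₂ := by
  rw [← hJ] at hj
  exact exists_mul_of_mem_mul hW (fun x hx u hu => jacobsonRad_mul_mem hW hx hu) hj

theorem mem_of_mul_jacobsonRad {y : K} (h : ∀ j ∈ jacobsonRad W, y * j ∈ W) : y ∈ W := by
  by_contra hy
  have h0 : y ≠ 0 := fun h => hy (h ▸ W.zero_mem)
  obtain ⟨j₁, h₁, j₂, h₂, e⟩ := exists_mul_of_mem_jacobsonRad hW hJ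
    ((mem_jacobsonRad hW (inv_ne_zero h0)).2 (by rwa [inv_inv]))
  have := mul_mem_jacobsonRad hW (h j₁ h₁) h₂
  rw [mul_assoc, ← e, mul_inv_cancel₀ h0] at this
  exact one_notMem_jacobsonRad hW this

theorem mem_of_jacobsonRad_mul {y : K} (h : ∀ j ∈ jacobsonRad W, j * y ∈ W) : y ∈ W := by
  by_contra hy
  have h0 : y ≠ 0 := fun h => hy (h ▸ W.zero_mem)
  obtain ⟨j₁, h₁, j₂, h₂, e⟩ := exists_mul_of_mem_jacobsonRad hW hJ
    ((mem_jacobsonRad hW (inv_ne_zero h0)).2 (by rwa [inv_inv]))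
  have := jacobsonRad_mul_mem hW h₁ (h j₂ h₂)
  rw [← mul_assoc, ← e, inv_mul_cancel₀ h0] at this
  exact one_notMem_jacobsonRad hW this

theorem leftOrder_mulElem_jacobsonRad {c : K} (hc : c ≠ 0) :
    leftOrder (mulElem (jacobsonRad W) c) = W := by
  ext a
  constructor
  · intro h
    refine mem_of_mul_jacobsonRad hW hJ fun j hj => jacobsonRad_le W ?_
    have := h (j * c) ⟨j, hj, rfl⟩
    rwa [← mul_assoc, mem_mulElem hc, mul_inv_cancel_right₀ hc] at this
  · rintro ha _ ⟨j, hj, rfl⟩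
    exact ⟨a * j, mul_mem_jacobsonRad hW ha hj, mul_assoc _ _ _⟩

theorem leftStar_mulElem_jacobsonRad {c : K} (hc : c ≠ 0) (hne : ∃ j ∈ jacobsonRad W, j ≠ 0) :
    leftStar (mulElem (jacobsonRad W) c) = mulElem W.toAddSubgroup c := by
  have hL := leftOrder_mulElem_jacobsonRad hW hJ hc
  ext z
  rw [mem_leftStar, hL]
  constructor
  · intro h
    exact h c (AddSubgroup.map_mono (jacobsonRad_le W))
  · rintro ⟨w, hw, rfl⟩ d hd
    have hd0 : d ≠ 0 := by
      rintro rfl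
      obtain ⟨j, hj, hj0⟩ := hne
      obtain ⟨x, -, hx⟩ := hd ⟨j, hj, rfl⟩
      have hx' : x * 0 = j * c := hx
      rw [mul_zero] at hx'
      exact mul_ne_zero hj0 hc hx'.symm
    have h1 : c * d⁻¹ ∈ W := by
      refine mem_of_jacobsonRad_mul hW hJ fun j hj => ?_
      have : j * c ∈ mulElem W.toAddSubgroup d := hd ⟨j, hj, rfl⟩
      rw [mem_mulElem hd0, mul_assoc] at this
      exact this
    have : w * c ∈ mulElem W.toAddSubgroup d := by
      rw [mem_mulElem hd0, mul_assoc]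
      exact W.mul_mem hw h1
    exact this

end Radical

variable {W : Subring K}

theorem IsConeFamily.isTop (hA : IsConeFamily σ A) (hW : IsTotalValuationRing W)
    (hle : ∀ s, leftOrder (A s) ≤ W) (hJ : jacobsonRad W * jacobsonRad W = jacobsonRad W) :
    hA.cone.IsTop (ofSubring σ W) where
  isOver := {
    deg_eq := fun h => h.1
    mem_of_mem := fun {g} h h0 => ⟨h0, hle 0 fun x hx => by
      have h0' : g.deg = 0 := h0
      have h' : g.coef ∈ A 0 := by rw [hA.mem_P, h0'] at h; exact h
      have := hA.mul_mem 0 0 _ h' _ hx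
      rwa [autAt_zero, add_zero] at this⟩
    mul_mem := fun {g h} hg hh => ⟨by rw [deg_mul, hg.1, hh.1, add_zero], by
      rw [coef_mul, hg.1, autAt_zero]
      exact W.mul_mem hg.2 hh.2⟩ }
  L_subset v x hx := ⟨hx.1, hle v (hA.mem_L.1 hx).2⟩
  idem j hj := by
    obtain ⟨h0, hj⟩ := (hA.mem_J hW).1 hj
    obtain ⟨j₁, h₁, j₂, h₂, e⟩ := exists_mul_of_mem_jacobsonRad hW hJ hj
    have hne : j₁ * j₂ ≠ 0 := e ▸ j.coef_ne_zero
    refine ⟨homog σ 0 j₁ (left_ne_zero_of_mul hne), (hA.mem_J hW).2 ⟨rfl, h₁⟩,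
      homog σ 0 j₂ (right_ne_zero_of_mul hne), (hA.mem_J hW).2 ⟨rfl, h₂⟩, ?_⟩
    refine ext' ?_ ?_
    · rw [coef_mul, deg_homog, autAt_zero, coef_homog, coef_homog, e]
    · rw [deg_mul, deg_homog, deg_homog, h0, add_zero]

/-- The component `A_s` lies between `J(W) c` and `W c`, where `c X^s` normalizes `W`. -/
structure IsSandwiched (σ : Multiplicative ℚ →* RingAut K) (W : Subring K)
    (A : ℚ → AddSubgroup K) (s : ℚ) (c : K) : Prop where
  ne_zero : c ≠ 0
  conj : ∀ a, a ∈ W ↔ c * autAt σ s a * c⁻¹ ∈ W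
  mul_mem : ∀ j ∈ jacobsonRad W, j * c ∈ A s
  mem_W : ∀ a ∈ A s, a * c⁻¹ ∈ W

theorem coef_conj (γ x : HomogeneousUnits σ) (h0 : x.deg = 0) :
    (γ * x * γ⁻¹).coef = γ.coef * autAt σ γ.deg x.coef * γ.coef⁻¹ := by
  rw [coef_mul, coef_mul, coef_inv, deg_mul, h0, add_zero, autAt_autAt_neg]

theorem deg_conj (γ x : HomogeneousUnits σ) : (γ * x * γ⁻¹).deg = x.deg := by
  rw [deg_mul, deg_mul, deg_inv]; ring

theorem conj_mem_ofSubring_iff (γ : HomogeneousUnits σ) :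
    (∀ g, g ∈ ofSubring σ W ↔ γ * g * γ⁻¹ ∈ ofSubring σ W) ↔
      ∀ a, a ∈ W ↔ γ.coef * autAt σ γ.deg a * γ.coef⁻¹ ∈ W := by
  constructor
  · intro h a
    by_cases ha : a = 0
    · simp [ha]
    have := h (homog σ 0 a ha)
    change (homog σ 0 a ha).deg = 0 ∧ _ ↔ _ = 0 ∧ _ at this
    rw [deg_conj, coef_conj _ _ rfl] at this
    simpa using this
  · intro h x
    change x.deg = 0 ∧ _ ↔ _ = 0 ∧ _
    rw [deg_conj]
    refine and_congr_right fun h0 => ?_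
    rw [coef_conj _ _ h0]
    exact h _

theorem coef_mul_inv_of_deg_eq {x γ : HomogeneousUnits σ} (h : x.deg = γ.deg) :
    (x * γ⁻¹).coef = x.coef * γ.coef⁻¹ := by
  rw [coef_mul, coef_inv, h, autAt_autAt_neg]

namespace IsConeFamily

variable (hA : IsConeFamily σ A)

theorem sandwich_iff (hW : IsTotalValuationRing W) {s : ℚ} {γ : HomogeneousUnits σ} :
    hA.cone.Sandwich (ofSubring σ W) s γ ↔ γ.deg = s ∧ IsSandwiched σ W A s γ.coef := by
  constructor
  · intro h
    have hs : γ.deg = s := h.deg_eq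
    refine ⟨hs, γ.coef_ne_zero, ?_, fun j hj => ?_, fun a ha => ?_⟩
    · have := (conj_mem_ofSubring_iff γ).1 h.conj
      rwa [hs] at this
    · by_cases hj0 : j = 0
      · rw [hj0, zero_mul]; exact (A s).zero_mem
      have := h.mem_P (homog σ 0 j hj0) ((hA.mem_J hW).2 ⟨rfl, hj⟩)
      rw [hA.mem_P, coef_mul, deg_mul, deg_homog, autAt_zero, zero_add, hs] at this
      exact this
    · by_cases ha0 : a = 0
      · rw [ha0, zero_mul]; exact W.zero_mem
      have := (h.mem_W (homog σ s a ha0) ha rfl).2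
      rwa [coef_mul_inv_of_deg_eq (x := homog σ s a ha0) hs.symm] at this
  · rintro ⟨hs, h⟩
    refine ⟨hs, (conj_mem_ofSubring_iff γ).2 (by rw [hs]; exact h.conj), fun j hj => ?_,
      fun z hz hzd => ?_⟩
    · obtain ⟨h0, hj⟩ := (hA.mem_J hW).1 hj
      rw [hA.mem_P, coef_mul, deg_mul, h0, autAt_zero, zero_add, hs]
      exact h.mul_mem _ hj
    · have hzd' : z.deg = s := hzd
      rw [hA.mem_P, hzd'] at hz
      refine ⟨by rw [deg_mul, deg_inv, hzd', hs, add_neg_cancel], ?_⟩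
      rw [coef_mul_inv_of_deg_eq (hzd'.trans hs.symm)]
      exact h.mem_W _ hz

theorem exists_sandwich_iff (hW : IsTotalValuationRing W) {s : ℚ} :
    (∃ γ, hA.cone.Sandwich (ofSubring σ W) s γ) ↔ ∃ c, IsSandwiched σ W A s c := by
  constructor
  · rintro ⟨γ, h⟩
    exact ⟨_, ((hA.sandwich_iff hW).1 h).2⟩
  · rintro ⟨c, h⟩
    exact ⟨homog σ s c h.ne_zero, (hA.sandwich_iff hW).2 ⟨rfl, h⟩⟩

end IsConeFamily

section Sandwiched

variable {s : ℚ} {c : K}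

theorem IsSandwiched.mul_eq (h : IsSandwiched σ W A s c) (hW : IsTotalValuationRing W)
    (hJ : jacobsonRad W * jacobsonRad W = jacobsonRad W) :
    jacobsonRad W * A s = mulElem (jacobsonRad W) c := by
  apply le_antisymm
  · rw [addSubgroup_mul_le]
    intro j hj a ha
    rw [mem_mulElem h.ne_zero, mul_assoc]
    exact jacobsonRad_mul_mem hW hj (h.mem_W a ha)
  · rintro _ ⟨j, hj, rfl⟩
    obtain ⟨j₁, h₁, j₂, h₂, rfl⟩ := exists_mul_of_mem_jacobsonRad hW hJ hj
    have := mul_mem_addSubgroup_mul h₁ (h.mul_mem j₂ h₂)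
    rw [← mul_assoc] at this
    exact this

theorem IsSandwiched.leftStar_eq (h : IsSandwiched σ W A s c) (hW : IsTotalValuationRing W)
    (hJ : jacobsonRad W * jacobsonRad W = jacobsonRad W) (hne : ∃ j ∈ jacobsonRad W, j ≠ 0) :
    leftStar (jacobsonRad W * A s) = mulElem W.toAddSubgroup c := by
  rw [h.mul_eq hW hJ, leftStar_mulElem_jacobsonRad hW hJ h.ne_zero hne]

theorem mulElem_eq_elemMul_iff (hc : c ≠ 0) :
    mulElem W.toAddSubgroup c = elemMul c (imageAt σ s W.toAddSubgroup) ↔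
      ∀ a, a ∈ W ↔ c * autAt σ s a * c⁻¹ ∈ W := by
  have key : ∀ a, c * autAt σ s a ∈ elemMul c (imageAt σ s W.toAddSubgroup) ↔ a ∈ W := by
    intro a
    rw [mem_elemMul hc, inv_mul_cancel_left₀ hc, mem_imageAt, autAt_neg_autAt]; rfl
  constructor
  · intro h a
    rw [← key a, ← h, mem_mulElem hc]; rfl
  · intro h
    ext z
    have e : z = c * autAt σ s (autAt σ (-s) (c⁻¹ * z)) := by
      rw [autAt_autAt_neg, mul_inv_cancel_left₀ hc]
    rw [e, key, mem_mulElem hc]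
    exact (h _).symm

end Sandwiched

end Homogeneous

open HomogeneousUnits

section Forward

variable {K : Type*} [DivisionRing K] {σ : Multiplicative ℚ →* RingAut K} {A : ℚ → AddSubgroup K}
  {V W : Subring K}

theorem IsGradedExtension.isConeFamily (h : IsGradedExtension σ V A) : IsConeFamily σ A :=
  ⟨((isGradedExtension_iff σ).1 h).2.1, ((isGradedExtension_iff σ).1 h).2.2⟩

theorem IsConeFamily.isGradedExtension (h : IsConeFamily σ A) (h0 : A 0 = V.toAddSubgroup) :
    IsGradedExtension σ V A :=
  (isGradedExtension_iff σ).2 ⟨h0, h.mul_mem, h.total⟩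

theorem IsGradedExtension.restrict (h : IsGradedExtension σ V A) (H : AddSubgroup ℚ) :
    IsGradedExtension (restrictHom σ H) V (fun s : H => A s) := by
  obtain ⟨h0, hmul, htot⟩ := (isGradedExtension_iff σ).1 h
  exact (isGradedExtension_iff _).2 ⟨h0, fun g h a ha b hb => hmul g h a ha b hb,
    fun g a ha => htot g a ha⟩

theorem IsConeFamily.fail_of_ne (hA : IsConeFamily σ A) {r s : ℚ}
    (h : A r * imageAt σ r (A s) ≠ A (r + s)) : hA.cone.Fail r s := by
  by_contra hn
  refine h (le_antisymm ?_ fun z hz => ?_)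
  · rw [addSubgroup_mul_le]
    intro a ha b hb
    rw [mem_imageAt] at hb
    have := hA.mul_mem r s a ha _ hb
    rwa [autAt_autAt_neg] at this
  · by_cases hz0 : z = 0
    · rw [hz0]; exact AddSubgroup.zero_mem _
    by_contra hz'
    refine hn ⟨homog σ (r + s) z hz0, hz, rfl, fun a ha had hb => hz' ?_⟩
    have had' : a.deg = r := had
    rw [hA.mem_P, had'] at ha
    rw [hA.mem_P, coef_mul, coef_inv, deg_mul, deg_inv, deg_homog, coef_homog, had',
      ← map_mul, neg_add_cancel_left] at hb
    have := mul_mem_addSubgroup_mul ha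
      ((mem_imageAt σ).2 (by simpa using hb) : a.coef⁻¹ * z ∈ imageAt σ r (A s))
    rwa [mul_inv_cancel_left₀ a.coef_ne_zero] at this

theorem IsTypeH.exists_fail (h : IsTypeH σ V A) (hA : IsConeFamily σ A) :
    ∃ r s, hA.cone.Fail r s ∧ 0 < r * s := by
  obtain ⟨-, r, -, ⟨-, g, k, hg, hk, hne⟩, -⟩ := h
  have hg' : (0 : ℚ) < g := hg
  have hk' : (0 : ℚ) < k := hk
  rcases hne with hne | hne
  · exact ⟨g, k, hA.fail_of_ne hne, mul_pos hg' hk'⟩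
  · refine ⟨-g, -k, hA.fail_of_ne fun h => hne ?_, by nlinarith⟩
    rw [← sub_eq_add_neg] at h
    exact h

section Free

variable (hA : IsConeFamily σ A) (hW : IsTotalValuationRing W) {s : ℚ}
  (hF : hA.cone.Free (ofSubring σ W) s)
include hA hF

theorem mul_mem_of_free {w a : K} (hw : w ∈ W) (ha : a ∈ A s) : w * a ∈ A s := by
  rw [← hA.mem_of_L_eq hF.L_eq] at hw
  exact hw a ha

theorem mul_eq_of_free : A s = W.toAddSubgroup * A s := by
  apply le_antisymm
  · intro a ha
    have := mul_mem_addSubgroup_mul (I := W.toAddSubgroup) W.one_mem ha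
    rwa [one_mul] at this
  · rw [addSubgroup_mul_le]
    exact fun w hw a ha => mul_mem_of_free hA hF hw ha

include hW

theorem exists_eq_mul_of_free {a : K} (ha : a ∈ A s) (ha0 : a ≠ 0) :
    ∃ j ∈ jacobsonRad W, ∃ b ∈ A s, a = j * b := by
  obtain ⟨j, hj, b, hb, hbd, e⟩ := hF.exists_J_mul (homog σ s a ha0) ha rfl
  obtain ⟨h0, hj⟩ := (hA.mem_J hW).1 hj
  have hbd' : b.deg = s := hbd
  rw [hA.mem_P, hbd'] at hb
  refine ⟨_, hj, _, hb, ?_⟩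
  have := congrArg coef e
  rwa [coef_mul, h0, autAt_zero, coef_homog] at this

theorem jacobsonRad_mul_eq_of_free : jacobsonRad W * A s = A s := by
  apply le_antisymm
  · rw [addSubgroup_mul_le]
    exact fun w hw a ha => mul_mem_of_free hA hF (jacobsonRad_le W hw) ha
  · intro a ha
    by_cases ha0 : a = 0
    · rw [ha0]; exact AddSubgroup.zero_mem _
    obtain ⟨j, hj, b, hb, rfl⟩ := exists_eq_mul_of_free hA hW hF ha ha0
    exact mul_mem_addSubgroup_mul hj hb

theorem leftStar_eq_of_free : leftStar (A s) = A s := by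
  refine le_antisymm (fun z hz => ?_) (le_leftStar _)
  rw [mem_leftStar, hA.mem_of_L_eq hF.L_eq] at hz
  by_contra hzA
  have hz0 : z ≠ 0 := fun h => hzA (h ▸ (A s).zero_mem)
  obtain ⟨j, hj, hjz⟩ := hF.exists_notMem (homog σ s z hz0) hzA rfl
  obtain ⟨h0, hj⟩ := (hA.mem_J hW).1 hj
  rw [hA.mem_P, coef_mul, deg_mul, h0, autAt_zero, zero_add, deg_homog, coef_homog] at hjz
  have hne : j.coef * z ≠ 0 := mul_ne_zero j.coef_ne_zero hz0
  have h1 : A s ≤ mulElem W.toAddSubgroup (j.coef * z) := by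
    intro a ha
    rw [mem_mulElem hne]
    by_contra hn
    have ha0 : a ≠ 0 := by
      rintro rfl
      exact hn (by simp)
    have h2 := (hW _ (mul_ne_zero ha0 (inv_ne_zero hne))).resolve_left hn
    refine hjz ?_
    have := mul_mem_of_free hA hF h2 ha
    rwa [mul_inv_rev, inv_inv, inv_mul_cancel_right₀ ha0] at this
  have h2 := hz _ h1
  rw [mem_mulElem hne, mul_inv_rev, mul_inv_cancel_left₀ hz0] at h2
  exact (mem_jacobsonRad hW j.coef_ne_zero).1 hj h2

theorem ne_mulElem_of_free (hne : ∃ j ∈ jacobsonRad W, j ≠ 0) (a : K) :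
    A s ≠ mulElem W.toAddSubgroup a := by
  intro h
  by_cases ha0 : a = 0
  · obtain ⟨j, hj, hj0⟩ := hne
    refine (mem_jacobsonRad hW hj0).1 hj ?_
    rw [← hA.mem_of_L_eq hF.L_eq, mem_leftOrder]
    intro x hx
    rw [h] at hx
    obtain ⟨w, -, rfl⟩ := hx
    change j⁻¹ * (w * a) ∈ A s
    rw [ha0, mul_zero, mul_zero]
    exact (A s).zero_mem
  · have ha : a ∈ A s := by rw [h]; exact ⟨1, W.one_mem, one_mul a⟩
    obtain ⟨j, hj, b, hb, e⟩ := exists_eq_mul_of_free hA hW hF ha ha0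
    rw [h] at hb
    obtain ⟨w, hw, rfl⟩ := hb
    have e' : a = j * (w * a) := e
    rw [← mul_assoc] at e'
    have h1 : j * w = 1 := mul_right_cancel₀ ha0 (by rw [← e', one_mul])
    have := jacobsonRad_mul_mem hW hj hw
    rw [h1] at this
    exact one_notMem_jacobsonRad hW this

end Free

theorem exists_ne_zero_of_not_isSandwiched {s : ℚ} (hW : IsTotalValuationRing W)
    (h : ¬∃ c, IsSandwiched σ W A s c) : ∃ j ∈ jacobsonRad W, j ≠ 0 := by
  by_contra! hn
  have hall : ∀ a, a ∈ W := by
    intro a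
    by_contra ha
    have ha0 : a ≠ 0 := fun h => ha (h ▸ W.zero_mem)
    exact inv_ne_zero ha0 (hn _ ((mem_jacobsonRad hW (inv_ne_zero ha0)).2 (by rwa [inv_inv])))
  exact h ⟨1, one_ne_zero, fun a => iff_of_true (hall _) (hall _),
    fun j hj => by rw [hn j hj, zero_mul]; exact (A s).zero_mem, fun a _ => hall _⟩

theorem coef_mem_modifiedComponents_iff (hA : IsConeFamily σ A) (hW : IsTotalValuationRing W)
    (hA0 : A 0 = V.toAddSubgroup) {H : AddSubgroup ℚ} {c : ℚ → K} {γ : ℚ → HomogeneousUnits σ}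
    (hγ : ∀ s ∈ H, (γ s).deg = s ∧ (γ s).coef = c s) (x : HomogeneousUnits σ) :
    x.coef ∈ modifiedComponents V W (H : Set ℚ) c A x.deg ↔
      hA.cone.Modified (ofSubring σ W) H γ x := by
  have hc : ∀ s ∈ H, c s ≠ 0 := fun s hs => (hγ s hs).2 ▸ (γ s).coef_ne_zero
  have hinv : x.deg ∈ H → (x * (γ x.deg)⁻¹).coef = x.coef * (c x.deg)⁻¹ := fun hs => by
    rw [coef_mul_inv_of_deg_eq (hγ _ hs).1.symm, (hγ _ hs).2]
  have hdeg : x.deg ∈ H → (x * (γ x.deg)⁻¹).deg = 0 := fun hs => by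
    rw [deg_mul, deg_inv, (hγ _ hs).1, add_neg_cancel]
  have hiffW : x.deg ∈ H → (x * (γ x.deg)⁻¹ ∈ ofSubring σ W ↔ x.coef * (c x.deg)⁻¹ ∈ W) := by
    intro hs
    change _ ∧ _ ↔ _
    rw [hinv hs, hdeg hs]
    simp
  have hiffJ : x.deg ∈ H → (x * (γ x.deg)⁻¹ ∈ hA.cone.J (ofSubring σ W) ↔
      x.coef * (c x.deg)⁻¹ ∈ jacobsonRad W) := by
    intro hs
    rw [hA.mem_J hW, hinv hs, hdeg hs]
    simp
  change _ ↔ (x.deg = 0 ∧ x.coef ∈ A x.deg) ∨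
    (x.deg ∈ H ∧ x.deg < 0 ∧ x * (γ x.deg)⁻¹ ∈ ofSubring σ W) ∨
    (x.deg ∈ H ∧ 0 < x.deg ∧ x * (γ x.deg)⁻¹ ∈ hA.cone.J (ofSubring σ W)) ∨
    (x.deg ∉ H ∧ x.coef ∈ A x.deg)
  unfold modifiedComponents
  have h0H : (0 : ℚ) ∈ H := H.zero_mem
  by_cases h0 : x.deg = 0
  · simp [h0, hA0, h0H]
  rw [if_neg h0]
  by_cases hH : x.deg ∈ H
  · rw [if_pos (show x.deg ∈ (H : Set ℚ) from hH), hiffW hH, hiffJ hH]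
    rcases lt_or_gt_of_ne h0 with h1 | h1
    · rw [if_pos h1, mem_mulElem (hc _ hH)]
      simp [h0, hH, h1, h1.le]
    · rw [if_neg h1.not_gt, mem_mulElem (hc _ hH)]
      simp [h0, hH, h1, h1.le]
  · rw [if_neg (show x.deg ∉ (H : Set ℚ) from hH)]
    simp [h0, hH]

theorem isConeFamily_of_homogeneous {B : ℚ → AddSubgroup K}
    (hmul : ∀ x y : HomogeneousUnits σ, x.coef ∈ B x.deg → y.coef ∈ B y.deg →
      (x * y).coef ∈ B (x * y).deg)
    (htot : ∀ x : HomogeneousUnits σ, x.coef ∈ B x.deg ∨ (x⁻¹).coef ∈ B (x⁻¹).deg) :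
    IsConeFamily σ B where
  mul_mem r s a ha b hb := by
    by_cases ha0 : a = 0
    · rw [ha0, zero_mul]; exact AddSubgroup.zero_mem _
    by_cases hb0 : b = 0
    · rw [hb0, map_zero, mul_zero]; exact AddSubgroup.zero_mem _
    have := hmul (homog σ r a ha0) (homog σ s b hb0) ha hb
    rwa [coef_mul, deg_mul] at this
  total r a ha := by
    have := htot (homog σ r a ha)
    rwa [coef_inv, deg_inv] at this

theorem IsTypeH.exists_generators (h : IsTypeH σ V A) (hV : IsTotalValuationRing V)
    (hVW : V ≤ W) (hle : ∀ s, leftOrder (A s) ≤ W)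
    (hJ : jacobsonRad W * jacobsonRad W = jacobsonRad W) {t : ℚ} (ht : leftOrder (A t) = W) :
    ∃ c : ℚ → K,
      (∀ r ∈ principalStarSet W A, ∀ s ∈ principalStarSet W A,
        leftStar (jacobsonRad W * A s) = mulElem W.toAddSubgroup (c s) ∧
        mulElem W.toAddSubgroup (c s) = elemMul (c s) (imageAt σ s W.toAddSubgroup) ∧
        mulElem W.toAddSubgroup (c (-s)) =
          mulElem W.toAddSubgroup (autAt σ (-s) (c s)⁻¹) ∧
        mulElem W.toAddSubgroup (c r) * imageAt σ r (mulElem W.toAddSubgroup (c s)) =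
          mulElem W.toAddSubgroup (c (r + s))) ∧
      (∃ H' : AddSubgroup ℚ, (H' : Set ℚ) = principalStarSet W A ∧ H' ≠ ⊥ ∧ H' ≠ ⊤ ∧
        IsGradedExtension (restrictHom σ H') V (fun s : H' => A s)) ∧
      (∀ s : ℚ, s ∉ principalStarSet W A →
        leftStar (A s) = A s ∧ A s = W.toAddSubgroup * A s ∧
        (∀ a : K, A s ≠ mulElem W.toAddSubgroup a) ∧
        (rightOrder (A s)).toAddSubgroup = imageAt σ s W.toAddSubgroup) ∧
      IsGradedExtension σ V (modifiedComponents V W (principalStarSet W A) c A) := by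
  classical
  have hW := hV.mono hVW
  have hA := h.1.isConeFamily
  have hA0 : A 0 = V.toAddSubgroup := h.1.2
  have hTop := hA.isTop hW hle hJ
  obtain ⟨r₀, s₀, hfail, hrs⟩ := h.exists_fail hA
  have htL := hA.L_eq_of_eq ht
  obtain ⟨p, hp, δ, hδ⟩ := GradedCone.exists_sandwich hTop.L_subset htL hfail hrs
  have hnot := GradedCone.not_forall_sandwich hTop htL hfail hrs
  have hfree : ∀ s, (¬∃ c, IsSandwiched σ W A s c) → hA.cone.Free (ofSubring σ W) s := fun s hs =>
    GradedCone.free_of_not_sandwich hTop hp hδ (by rwa [hA.exists_sandwich_iff hW])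
  obtain ⟨q, hq⟩ := not_forall.1 hnot
  rw [hA.exists_sandwich_iff hW] at hq
  have hne := exists_ne_zero_of_not_isSandwiched hW hq
  have hmem : ∀ s, s ∈ principalStarSet W A ↔ ∃ c, IsSandwiched σ W A s c := by
    intro s
    constructor
    · rintro ⟨c, hc⟩
      by_contra hn
      have hF := hfree s hn
      rw [jacobsonRad_mul_eq_of_free hA hW hF, leftStar_eq_of_free hA hW hF] at hc
      exact ne_mulElem_of_free hA hW hF hne c hc
    · rintro ⟨c, hc⟩
      exact ⟨c, hc.leftStar_eq hW hJ hne⟩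
  let H : AddSubgroup ℚ := {
    carrier := principalStarSet W A
    zero_mem' := by
      rw [hmem, ← hA.exists_sandwich_iff hW]
      exact ⟨1, GradedCone.Sandwich.one hTop.isOver⟩
    add_mem' := by
      intro r s hr hs
      rw [hmem, ← hA.exists_sandwich_iff hW] at hr hs ⊢
      obtain ⟨a, ha⟩ := hr
      obtain ⟨b, hb⟩ := hs
      exact ⟨_, ha.mul hTop hb⟩
    neg_mem' := by
      intro s hs
      rw [hmem, ← hA.exists_sandwich_iff hW] at hs ⊢
      obtain ⟨a, ha⟩ := hs
      exact ⟨_, ha.inv hTop⟩ }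
  have hH : ∀ s, s ∈ H ↔ ∃ c, IsSandwiched σ W A s c := hmem
  let c : ℚ → K := fun s => if hs : ∃ c, IsSandwiched σ W A s c then hs.choose else 0
  have hc : ∀ s ∈ H, IsSandwiched σ W A s (c s) := by
    intro s hs
    have hs' := (hH s).1 hs
    have : c s = hs'.choose := dif_pos hs'
    rw [this]
    exact hs'.choose_spec
  let γ : ℚ → HomogeneousUnits σ := fun s =>
    if hs : s ∈ H then homog σ s (c s) (hc s hs).ne_zero else 1
  have hγ : ∀ s ∈ H, (γ s).deg = s ∧ (γ s).coef = c s := by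
    intro s hs
    have : γ s = homog σ s (c s) (hc s hs).ne_zero := dif_pos hs
    rw [this]
    exact ⟨rfl, rfl⟩
  have hγS : ∀ s ∈ H, hA.cone.Sandwich (ofSubring σ W) s (γ s) := by
    intro s hs
    rw [hA.sandwich_iff hW, (hγ s hs).2]
    exact ⟨(hγ s hs).1, hc s hs⟩
  have huniq : ∀ {s a b}, IsSandwiched σ W A s a → IsSandwiched σ W A s b →
      mulElem W.toAddSubgroup a = mulElem W.toAddSubgroup b := by
    intro s a b ha hb
    rw [← ha.leftStar_eq hW hJ hne, hb.leftStar_eq hW hJ hne]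
  have hFree : ∀ s, s ∉ H → hA.cone.Free (ofSubring σ W) s := fun s hs =>
    hfree s (by rwa [← hH])
  refine ⟨c, fun r hr s hs => ?_, ⟨H, rfl, ?_, ?_, h.1.restrict H⟩, fun s hs => ?_, ?_⟩
  · have hs' := hc s hs
    have hr' := hc r hr
    refine ⟨hs'.leftStar_eq hW hJ hne, (mulElem_eq_elemMul_iff hs'.ne_zero).2 hs'.conj, ?_, ?_⟩
    · refine huniq (hc _ (H.neg_mem hs)) ?_
      have := ((hA.sandwich_iff hW).1 ((hγS s hs).inv hTop)).2
      rwa [coef_inv, (hγ s hs).1, (hγ s hs).2] at this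
    · have hrs : IsSandwiched σ W A (r + s) (c r * autAt σ r (c s)) := by
        have := ((hA.sandwich_iff hW).1 ((hγS r hr).mul hTop (hγS s hs))).2
        rwa [coef_mul, (hγ r hr).1, (hγ r hr).2, (hγ s hs).2] at this
      rw [huniq (hc _ (H.add_mem hr hs)) hrs]
      apply le_antisymm
      · rw [addSubgroup_mul_le]
        rintro _ ⟨w, hw, rfl⟩ _ ⟨_, ⟨w', hw', rfl⟩, rfl⟩
        refine ⟨w * (c r * autAt σ r w' * (c r)⁻¹), W.mul_mem hw ((hr'.conj w').1 hw'), ?_⟩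
        change w * (c r * autAt σ r w' * (c r)⁻¹) * (c r * autAt σ r (c s))
          = w * c r * autAt σ r (w' * c s)
        rw [map_mul]
        simp only [mul_assoc]
        rw [inv_mul_cancel_left₀ hr'.ne_zero]
      · rintro _ ⟨w, hw, rfl⟩
        change w * (c r * autAt σ r (c s)) ∈ _
        rw [← mul_assoc]
        refine mul_mem_addSubgroup_mul ⟨w, hw, rfl⟩ ?_
        rw [mem_imageAt, autAt_neg_autAt]
        exact ⟨1, W.one_mem, one_mul _⟩
  · intro hbot
    refine hp ?_
    have : p ∈ H := (hH p).2 ((hA.exists_sandwich_iff hW).1 ⟨δ, hδ⟩)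
    rwa [hbot, AddSubgroup.mem_bot] at this
  · intro htop
    exact hq ((hH q).1 (htop ▸ AddSubgroup.mem_top q))
  · have hF := hFree s hs
    exact ⟨leftStar_eq_of_free hA hW hF, mul_eq_of_free hA hF, ne_mulElem_of_free hA hW hF hne,
      hA.rightOrder_of_R_eq hF.R_eq⟩
  · have hiff := coef_mem_modifiedComponents_iff hA hW hA0 hγ
    refine (isConeFamily_of_homogeneous (fun x y hx hy => ?_) (fun x => ?_) :
      IsConeFamily σ _).isGradedExtension ?_
    · exact (hiff _).2 (((hiff x).1 hx).mul hTop hγS hFree ((hiff y).1 hy))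
    · exact (GradedCone.modified_total hTop hγS x).imp (hiff _).2 (hiff _).2
    · simp [modifiedComponents]

end Forward

section Backward

variable {K : Type*} [DivisionRing K] {σ : Multiplicative ℚ →* RingAut K} {A : ℚ → AddSubgroup K}
  {V W : Subring K}

theorem jacobsonRad_le_of_le (hV : IsTotalValuationRing V) (hVW : V ≤ W) :
    jacobsonRad W ≤ V.toAddSubgroup := by
  intro j hj
  by_cases h0 : j = 0
  · rw [h0]; exact V.zero_mem
  refine (hV j h0).resolve_right fun h => ?_
  exact (mem_jacobsonRad (hV.mono hVW) h0).1 hj (hVW h)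

theorem isSandwiched_of_leftStar_eq (hV : IsTotalValuationRing V) (hVW : V ≤ W)
    (hJ : jacobsonRad W * jacobsonRad W = jacobsonRad W) {s : ℚ} {c : K}
    (hmod : ∀ v ∈ V, ∀ a ∈ A s, v * a ∈ A s) (hc : c ≠ 0)
    (hstar : leftStar (jacobsonRad W * A s) = mulElem W.toAddSubgroup c)
    (hconj : mulElem W.toAddSubgroup c = elemMul c (imageAt σ s W.toAddSubgroup)) :
    IsSandwiched σ W A s c := by
  have hW := hV.mono hVW
  have hcmem : c ∈ leftStar (jacobsonRad W * A s) := by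
    rw [hstar]; exact ⟨1, W.one_mem, one_mul c⟩
  have hmulI : ∀ w ∈ W, ∀ x ∈ jacobsonRad W * A s, w * x ∈ jacobsonRad W * A s := by
    intro w hw x hx
    have : jacobsonRad W * A s ≤ (jacobsonRad W * A s).comap (AddMonoidHom.mulLeft w) := by
      rw [addSubgroup_mul_le]
      intro j hj a ha
      change w * (j * a) ∈ jacobsonRad W * A s
      rw [← mul_assoc]
      exact mul_mem_addSubgroup_mul (mul_mem_jacobsonRad hW hw hj) ha
    exact this hx
  have hle : leftOrder (jacobsonRad W * A s) ≤ W := by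
    intro a ha
    have : a * c ∈ leftStar (jacobsonRad W * A s) := by
      rw [mem_leftStar] at hcmem ⊢
      intro d hd
      obtain ⟨u, hu, e⟩ := hcmem d hd
      refine ⟨a * u, Subring.mul_mem _ ha hu, ?_⟩
      change a * u * d = a * c
      rw [mul_assoc]
      exact congrArg (a * ·) e
    rw [hstar, mem_mulElem hc, mul_inv_cancel_right₀ hc] at this
    exact this
  refine ⟨hc, (mulElem_eq_elemMul_iff hc).1 hconj, fun j hj => ?_, fun a ha => ?_⟩
  · have hIA : jacobsonRad W * A s ≤ A s := by
      rw [addSubgroup_mul_le]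
      exact fun j hj a ha => hmod j (jacobsonRad_le_of_le hV hVW hj) a ha
    refine hIA ?_
    by_contra hn
    have hj0 : j ≠ 0 := by
      rintro rfl
      exact hn (by rw [zero_mul]; exact AddSubgroup.zero_mem _)
    have hne : j * c ≠ 0 := mul_ne_zero hj0 hc
    have h1 : jacobsonRad W * A s
        ≤ mulElem (leftOrder (jacobsonRad W * A s)).toAddSubgroup (j * c) := by
      intro x hx
      rw [mem_mulElem hne]
      refine fun y hy => hmulI _ ?_ y hy
      by_contra hx'
      have hx0 : x ≠ 0 := by
        rintro rfl
        exact hx' (by simp)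
      have h2 := (hW _ (mul_ne_zero hx0 (inv_ne_zero hne))).resolve_left hx'
      refine hn ?_
      have := hmulI _ h2 x hx
      rwa [mul_inv_rev, inv_inv, inv_mul_cancel_right₀ hx0] at this
    have h2 := (mem_leftStar.1 hcmem) _ h1
    rw [mem_mulElem hne, mul_inv_rev, mul_inv_cancel_left₀ hc] at h2
    exact (mem_jacobsonRad hW hj0).1 hj (hle h2)
  · refine mem_of_jacobsonRad_mul hW hJ fun j hj => ?_
    have := le_leftStar _ (mul_mem_addSubgroup_mul hj ha)
    rw [hstar, mem_mulElem hc, mul_assoc] at this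
    exact this

theorem exists_jacobsonRad_mul (hW : IsTotalValuationRing W) {I : AddSubgroup K}
    (hmod : ∀ w ∈ W, ∀ a ∈ I, w * a ∈ I) (hne : ∀ a, I ≠ mulElem W.toAddSubgroup a) {a : K}
    (ha : a ∈ I) (ha0 : a ≠ 0) : ∃ j ∈ jacobsonRad W, ∃ b ∈ I, a = j * b := by
  by_contra! hn
  refine hne a (le_antisymm (fun b hb => ?_) ?_)
  · rw [mem_mulElem ha0]
    by_contra h
    have hb0 : b ≠ 0 := by
      rintro rfl
      exact h (by simp)
    refine hn (a * b⁻¹) ?_ b hb (inv_mul_cancel_right₀ hb0 a).symm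
    rw [mem_jacobsonRad hW (mul_ne_zero ha0 (inv_ne_zero hb0)), mul_inv_rev, inv_inv]
    exact h
  · rintro _ ⟨w, hw, rfl⟩
    exact hmod w hw a ha

theorem exists_mul_autAt_jacobsonRad (hW : IsTotalValuationRing W) {I : AddSubgroup K} {s : ℚ}
    (hmod : ∀ w ∈ W, ∀ a ∈ I, w * a ∈ I) (hle : leftOrder I ≤ W)
    (hr : ∀ w ∈ W, ∀ a ∈ I, a * autAt σ s w ∈ I)
    (hne : ∀ a, I ≠ mulElem W.toAddSubgroup a) {a : K}
    (ha : a ∈ I) (ha0 : a ≠ 0) : ∃ j ∈ jacobsonRad W, ∃ b ∈ I, a = b * autAt σ s j := by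
  by_contra! hn
  have key : ∀ b ∈ I, ∃ w ∈ W, b = a * autAt σ s w := by
    intro b hb
    by_cases hb0 : b = 0
    · exact ⟨0, W.zero_mem, by rw [hb0, map_zero, mul_zero]⟩
    have hu0 : autAt σ (-s) (a⁻¹ * b) ≠ 0 := by
      simpa using ⟨ha0, hb0⟩
    refine ⟨autAt σ (-s) (a⁻¹ * b), ?_, ?_⟩
    · by_contra hu
      refine hn (autAt σ (-s) (a⁻¹ * b))⁻¹ ?_ b hb ?_
      · rwa [mem_jacobsonRad hW (inv_ne_zero hu0), inv_inv]
      · rw [map_inv₀, autAt_autAt_neg, mul_inv_rev, inv_inv, mul_inv_cancel_left₀ hb0]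
    · rw [autAt_autAt_neg, mul_inv_cancel_left₀ ha0]
  refine hne a (le_antisymm (fun b hb => ?_) ?_)
  · rw [mem_mulElem ha0]
    refine hle fun x hx => ?_
    obtain ⟨w, hw, rfl⟩ := key b hb
    obtain ⟨w', hw', rfl⟩ := key x hx
    rw [mul_assoc, inv_mul_cancel_left₀ ha0, mul_assoc, ← map_mul]
    exact hr _ (W.mul_mem hw hw') a ha
  · rintro _ ⟨w, hw, rfl⟩
    exact hmod w hw a ha

theorem mulElem_zero (I : AddSubgroup K) : mulElem I 0 = ⊥ := by
  ext z
  rw [mem_mulElem_iff, AddSubgroup.mem_bot]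
  constructor
  · rintro ⟨x, -, rfl⟩
    exact mul_zero x
  · rintro rfl
    exact ⟨0, I.zero_mem, mul_zero 0⟩

theorem leftStar_bot : leftStar (⊥ : AddSubgroup K) = ⊥ := by
  refine le_antisymm (fun z hz => ?_) bot_le
  have := mem_leftStar.1 hz 0 bot_le
  rwa [mulElem_zero] at this

theorem mem_principalStarSet_of_jacobsonRad_eq_bot (h : jacobsonRad W = ⊥) (s : ℚ) :
    s ∈ principalStarSet W A := by
  refine ⟨0, ?_⟩
  have : (⊥ : AddSubgroup K) * A s = ⊥ := by
    rw [eq_bot_iff, addSubgroup_mul_le]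
    rintro x hx a -
    rw [AddSubgroup.mem_bot] at hx ⊢
    rw [hx, zero_mul]
  rw [h, this, leftStar_bot, mulElem_zero]

theorem generator_ne_zero (hA0 : A 0 = V.toAddSubgroup) {H : AddSubgroup ℚ}
    (hJne : jacobsonRad W ≠ ⊥) {c : ℚ → K}
    (hstar : leftStar (jacobsonRad W * A 0) = mulElem W.toAddSubgroup (c 0))
    (hmul : ∀ r ∈ H, ∀ s ∈ H, mulElem W.toAddSubgroup (c r) *
      imageAt σ r (mulElem W.toAddSubgroup (c s)) = mulElem W.toAddSubgroup (c (r + s)))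
    {s : ℚ} (hs : s ∈ H) : c s ≠ 0 := by
  have h0 : c 0 ≠ 0 := by
    intro h
    rw [h, mulElem_zero, hA0] at hstar
    refine hJne (eq_bot_iff.2 fun j hj => ?_)
    have := le_leftStar _ (mul_mem_addSubgroup_mul (B := V.toAddSubgroup) hj V.one_mem)
    rwa [hstar, mul_one] at this
  intro h
  have := hmul s hs (-s) (H.neg_mem hs)
  rw [h, mulElem_zero, add_neg_cancel] at this
  have h1 : c 0 ∈ (⊥ : AddSubgroup K) * imageAt σ s (mulElem W.toAddSubgroup (c (-s))) := by
    rw [this]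
    exact ⟨1, W.one_mem, one_mul _⟩
  have h2 : (⊥ : AddSubgroup K) * imageAt σ s (mulElem W.toAddSubgroup (c (-s))) ≤ ⊥ := by
    rw [addSubgroup_mul_le]
    rintro x hx a -
    rw [AddSubgroup.mem_bot] at hx ⊢
    rw [hx, zero_mul]
  exact h0 (h2 h1)

end Backward

section Reconstruction

variable {K : Type*} [DivisionRing K] {σ : Multiplicative ℚ →* RingAut K} {A : ℚ → AddSubgroup K}
  {V W : Subring K}

/-- The data from which a graded extension is recovered: the components in degrees from `H`
lie between `J(W) c_s` and `W c_s`, and the modified components form a graded extension. -/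
structure IsReconstructible (σ : Multiplicative ℚ →* RingAut K) (V W : Subring K)
    (A : ℚ → AddSubgroup K) (H : AddSubgroup ℚ) (c : ℚ → K) : Prop where
  zero_eq : A 0 = V.toAddSubgroup
  le : V ≤ W
  sandwiched : ∀ s ∈ H, IsSandwiched σ W A s (c s)
  exists_J_mul : ∀ s ∉ H, ∀ a ∈ A s, a ≠ 0 → ∃ j ∈ jacobsonRad W, ∃ b ∈ A s, a = j * b
  exists_mul_J : ∀ s ∉ H, ∀ a ∈ A s, a ≠ 0 → ∃ j ∈ jacobsonRad W, ∃ b ∈ A s, a = b * autAt σ s j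
  mul_mem : ∀ r ∈ H, ∀ s ∈ H, ∀ a ∈ A r, ∀ b ∈ A s, a * autAt σ r b ∈ A (r + s)
  total : ∀ r ∈ H, ∀ a, a ≠ 0 → a ∈ A r ∨ autAt σ (-r) a⁻¹ ∈ A (-r)
  modified : IsConeFamily σ (modifiedComponents V W (H : Set ℚ) c A)

namespace IsReconstructible

variable {H : AddSubgroup ℚ} {c : ℚ → K}

theorem recon (h : IsReconstructible σ V W A H c) (hW : IsTotalValuationRing W)
    {γ : ℚ → HomogeneousUnits σ} (hγ : ∀ s ∈ H, (γ s).deg = s ∧ (γ s).coef = c s) :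
    GradedCone.Recon h.modified.cone (ofSubring σ W) {x | x.coef ∈ A x.deg} H γ := by
  have hinv : ∀ x : HomogeneousUnits σ, x.deg ∈ H →
      (x * (γ x.deg)⁻¹).coef = x.coef * (c x.deg)⁻¹ := fun x hs => by
    rw [coef_mul_inv_of_deg_eq (hγ _ hs).1.symm, (hγ _ hs).2]
  have hdeg : ∀ x : HomogeneousUnits σ, x.deg ∈ H → (x * (γ x.deg)⁻¹).deg = 0 := fun x hs => by
    rw [deg_mul, deg_inv, (hγ _ hs).1, add_neg_cancel]
  have h0H : (0 : ℚ) ∈ H := H.zero_mem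
  have hM0 : modifiedComponents V W (H : Set ℚ) c A 0 = V.toAddSubgroup := by
    simp [modifiedComponents]
  have hMn : ∀ s ∉ H, modifiedComponents V W (H : Set ℚ) c A s = A s := by
    intro s hs
    have h0 : s ≠ 0 := fun h => hs (h ▸ h0H)
    have hs' : s ∉ (H : Set ℚ) := hs
    simp only [modifiedComponents, if_neg h0, if_neg hs']
  have hJmul : ∀ s ∈ H, ∀ j ∈ h.modified.cone.J (ofSubring σ W),
      (j * γ s).deg = s ∧ (j * γ s).coef = j.coef * c s := by
    intro s hs j hj
    obtain ⟨h0, -⟩ := (h.modified.mem_J hW).1 hj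
    rw [deg_mul, coef_mul, h0, autAt_zero, zero_add, (hγ s hs).1, (hγ s hs).2]
    exact ⟨rfl, rfl⟩
  have hJP : ∀ s ∈ H, ∀ j ∈ h.modified.cone.J (ofSubring σ W),
      (j * γ s).coef ∈ A (j * γ s).deg := by
    intro s hs j hj
    rw [(hJmul s hs j hj).1, (hJmul s hs j hj).2]
    exact (h.sandwiched s hs).mul_mem _ ((h.modified.mem_J hW).1 hj).2
  constructor
  · exact {
      deg_eq := fun h => h.1
      mem_of_mem := fun {g} hg h0 => ⟨h0, h.le (by
        have h0' : g.deg = 0 := h0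
        rw [h.modified.mem_P, h0', hM0] at hg
        exact hg)⟩
      mul_mem := fun {g k} hg hk => ⟨by rw [deg_mul, hg.1, hk.1, add_zero], by
        rw [coef_mul, hg.1, autAt_zero]
        exact W.mul_mem hg.2 hk.2⟩ }
  · intro s hs
    refine (conj_mem_ofSubring_iff (γ s)).2 ?_
    rw [(hγ s hs).1, (hγ s hs).2]
    exact (h.sandwiched s hs).conj
  · exact hJP
  · intro x hx hxH
    refine ⟨hdeg x hxH, ?_⟩
    change (x * (γ x.deg)⁻¹).coef ∈ W
    rw [hinv x hxH]
    exact (h.sandwiched _ hxH).mem_W _ hx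
  · intro s hs j hj
    have hP := hJP s hs j hj
    obtain ⟨hd, hc⟩ := hJmul s hs j hj
    have hjJ := ((h.modified.mem_J hW).1 hj).2
    rw [hd, hc] at hP
    rw [h.modified.mem_P, hd, hc]
    have hs' : s ∈ (H : Set ℚ) := hs
    by_cases h0 : s = 0
    · subst h0
      rw [hM0, ← h.zero_eq]
      exact hP
    · simp only [modifiedComponents, if_neg h0, if_pos hs']
      split_ifs
      · exact ⟨_, jacobsonRad_le W hjJ, rfl⟩
      · exact ⟨_, hjJ, rfl⟩
  · intro x hx hxH hx0
    have hxH' : x.deg ∈ (H : Set ℚ) := hxH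
    have hx0' : x.deg ≠ 0 := hx0
    refine ⟨hdeg x hxH, ?_⟩
    change (x * (γ x.deg)⁻¹).coef ∈ W
    rw [hinv x hxH]
    have hc := (h.sandwiched _ hxH).ne_zero
    rw [h.modified.mem_P] at hx
    simp only [modifiedComponents, if_neg hx0', if_pos hxH'] at hx
    split_ifs at hx
    · exact (mem_mulElem hc).1 hx
    · exact jacobsonRad_le W ((mem_mulElem hc).1 hx)
  · intro x h0
    have h0' : x.deg = 0 := h0
    rw [h.modified.mem_P, h0', hM0]
    change _ ↔ x.coef ∈ A x.deg
    rw [h0', h.zero_eq]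
  · intro x hx
    have hx' : x.deg ∉ H := hx
    rw [h.modified.mem_P, hMn _ hx']
    rfl
  · intro x hx hxH
    obtain ⟨j, hj, b, hb, e⟩ := h.exists_J_mul _ hxH _ hx x.coef_ne_zero
    have hne : j * b ≠ 0 := e ▸ x.coef_ne_zero
    refine ⟨homog σ 0 j (left_ne_zero_of_mul hne), (h.modified.mem_J hW).2 ⟨rfl, hj⟩,
      homog σ x.deg b (right_ne_zero_of_mul hne), hb, rfl, ext' ?_ ?_⟩
    · rw [coef_mul, deg_homog, autAt_zero, coef_homog, coef_homog, e]
    · rw [deg_mul, deg_homog, deg_homog, zero_add]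
  · intro x hx hxH
    obtain ⟨j, hj, b, hb, e⟩ := h.exists_mul_J _ hxH _ hx x.coef_ne_zero
    have hne : b * autAt σ x.deg j ≠ 0 := e ▸ x.coef_ne_zero
    have hj0 : j ≠ 0 := by
      rintro rfl
      exact hne (by simp)
    refine ⟨homog σ 0 j hj0, (h.modified.mem_J hW).2 ⟨rfl, hj⟩,
      homog σ x.deg b (left_ne_zero_of_mul hne), hb, rfl, ext' ?_ ?_⟩
    · rw [coef_mul, deg_homog, coef_homog, coef_homog, e]; rfl
    · rw [deg_mul, deg_homog, deg_homog, add_zero]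
  · intro x hx y hy hxH hyH
    change (x * y).coef ∈ A (x * y).deg
    rw [coef_mul, deg_mul]
    exact h.mul_mem _ hxH _ hyH _ hx _ hy
  · intro x hxH
    change x.coef ∈ A x.deg ∨ (x⁻¹).coef ∈ A (x⁻¹).deg
    rw [coef_inv, deg_inv]
    exact h.total _ hxH _ x.coef_ne_zero

theorem exists_recon (h : IsReconstructible σ V W A H c) (hW : IsTotalValuationRing W) :
    ∃ γ : ℚ → HomogeneousUnits σ, (∀ s ∈ H, (γ s).deg = s ∧ (γ s).coef = c s) ∧
      GradedCone.Recon h.modified.cone (ofSubring σ W) {x | x.coef ∈ A x.deg} H γ := by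
  classical
  let γ : ℚ → HomogeneousUnits σ := fun s =>
    if hs : s ∈ H then homog σ s (c s) (h.sandwiched s hs).ne_zero else 1
  have hγ : ∀ s ∈ H, (γ s).deg = s ∧ (γ s).coef = c s := by
    intro s hs
    have : γ s = homog σ s (c s) (h.sandwiched s hs).ne_zero := dif_pos hs
    rw [this]
    exact ⟨rfl, rfl⟩
  exact ⟨γ, hγ, h.recon hW hγ⟩

theorem isConeFamily (h : IsReconstructible σ V W A H c) (hW : IsTotalValuationRing W) :
    IsConeFamily σ A := by
  obtain ⟨γ, -, hR⟩ := h.exists_recon hW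
  exact isConeFamily_of_homogeneous (fun x y hx hy => hR.mul_mem_P hx hy) hR.total_P

theorem mul_le (h : IsReconstructible σ V W A H c) (hW : IsTotalValuationRing W) {r s : ℚ}
    (hr : r ∉ H) (hs : s ∉ H) (hrs : r + s ∈ H) (h0 : r + s ≠ 0) :
    A r * imageAt σ r (A s) ≤ mulElem (jacobsonRad W) (c (r + s)) := by
  obtain ⟨γ, hγ, hR⟩ := h.exists_recon hW
  rw [addSubgroup_mul_le]
  rintro a ha _ ⟨b, hb, rfl⟩
  change a * autAt σ r b ∈ _
  by_cases hab : a * autAt σ r b = 0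
  · rw [hab]; exact AddSubgroup.zero_mem _
  have ha0 : a ≠ 0 := left_ne_zero_of_mul hab
  have hb0 : b ≠ 0 := by
    rintro rfl
    exact hab (by simp)
  have hd : (homog σ r a ha0 * homog σ s b hb0).deg = r + s := by
    rw [deg_mul, deg_homog, deg_homog]
  have hx : homog σ r a ha0 ∈ {x : HomogeneousUnits σ | x.coef ∈ A x.deg} := ha
  have hy : homog σ s b hb0 ∈ {x : HomogeneousUnits σ | x.coef ∈ A x.deg} := hb
  have := hR.mul_mul_inv_mem_J hx hy hr hs (by rw [h.modified.deg_cone, hd]; exact hrs)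
    (by rw [h.modified.deg_cone, hd]; exact h0)
  rw [h.modified.mem_J hW, h.modified.deg_cone, hd,
    coef_mul_inv_of_deg_eq (hd.trans (hγ _ hrs).1.symm), (hγ _ hrs).2, coef_mul] at this
  rw [mem_mulElem (h.sandwiched _ hrs).ne_zero]
  exact this.2

theorem mul_ne (h : IsReconstructible σ V W A H c) (hW : IsTotalValuationRing W) {r s : ℚ}
    (hr : r ∉ H) (hs : s ∉ H) (hrs : r + s ∈ H) (h0 : r + s ≠ 0)
    (hinv : mulElem W.toAddSubgroup (c (-(r + s))) =
      mulElem W.toAddSubgroup (autAt σ (-(r + s)) (c (r + s))⁻¹)) :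
    A r * imageAt σ r (A s) ≠ A (r + s) ∨
      A (-r) * imageAt σ (-r) (A (-s)) ≠ A (-(r + s)) := by
  have hc := (h.sandwiched _ hrs).ne_zero
  rcases h.total _ hrs _ hc with hmem | hmem
  · left
    intro e
    rw [← e] at hmem
    have := h.mul_le hW hr hs hrs h0 hmem
    rw [mem_mulElem hc, mul_inv_cancel₀ hc] at this
    exact one_notMem_jacobsonRad hW this
  · right
    intro e
    have hneg : -r + -s = -(r + s) := by ring
    have hcn := (h.sandwiched _ (H.neg_mem hrs)).ne_zero
    rw [← e] at hmem
    have := h.mul_le hW (fun h => hr (neg_mem_iff.1 h)) (fun h => hs (neg_mem_iff.1 h))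
      (by rw [hneg]; exact H.neg_mem hrs) (by rw [hneg]; exact neg_ne_zero.2 h0) hmem
    rw [hneg] at this
    obtain ⟨j, hj, e'⟩ := this
    have e'' : j * c (-(r + s)) = autAt σ (-(r + s)) (c (r + s))⁻¹ := e'
    have h1 : c (-(r + s)) ∈ mulElem W.toAddSubgroup (autAt σ (-(r + s)) (c (r + s))⁻¹) := by
      rw [← hinv]; exact ⟨1, W.one_mem, one_mul _⟩
    obtain ⟨w, hw, e3⟩ := h1
    have e4 : w * autAt σ (-(r + s)) (c (r + s))⁻¹ = c (-(r + s)) := e3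
    rw [← e'', ← mul_assoc] at e4
    have h2 : w * j = 1 := mul_right_cancel₀ hcn (by rw [e4, one_mul])
    have := mul_mem_jacobsonRad hW hw hj
    rw [h2] at this
    exact one_notMem_jacobsonRad hW this

end IsReconstructible

theorem AddSubgroup.exists_pos_add_mem {H : AddSubgroup ℚ} (hbot : H ≠ ⊥) (htop : H ≠ ⊤) :
    ∃ r s : ℚ, 0 < r ∧ 0 < s ∧ r ∉ H ∧ s ∉ H ∧ r + s ∈ H := by
  obtain ⟨r, hr, hr0⟩ : ∃ r ∉ H, 0 < r := by
    obtain ⟨r, -, hr⟩ := SetLike.exists_of_lt (lt_top_iff_ne_top.2 htop)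
    rcases lt_trichotomy r 0 with h | h | h
    · exact ⟨-r, fun h => hr (neg_mem_iff.1 h), neg_pos.2 h⟩
    · exact absurd (h ▸ H.zero_mem) hr
    · exact ⟨r, hr, h⟩
  obtain ⟨q, hq, hq0⟩ : ∃ q ∈ H, 0 < q := by
    obtain ⟨q, hq, hq0⟩ := (AddSubgroup.bot_or_exists_ne_zero H).resolve_left hbot
    rcases lt_or_gt_of_ne hq0 with h | h
    · exact ⟨-q, H.neg_mem hq, neg_pos.2 h⟩
    · exact ⟨q, hq, h⟩
  obtain ⟨n, hn⟩ := Archimedean.arch (r + 1) hq0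
  have hnq : n • q ∈ H := H.nsmul_mem hq n
  refine ⟨r, n • q - r, hr0, by linarith, hr, fun h => hr ?_, by rwa [add_sub_cancel]⟩
  have := H.sub_mem hnq h
  rwa [sub_sub_cancel] at this

theorem Rat.exists_mem_zmultiples (r s : ℚ) :
    ∃ t : ℚ, 0 < t ∧ r ∈ AddSubgroup.zmultiples t ∧ s ∈ AddSubgroup.zmultiples t := by
  have hr : (r.den : ℚ) ≠ 0 := by exact_mod_cast r.den_nz
  have hs : (s.den : ℚ) ≠ 0 := by exact_mod_cast s.den_nz
  refine ⟨((r.den : ℚ) * s.den)⁻¹, by positivity, ?_, ?_⟩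
  · refine AddSubgroup.mem_zmultiples_iff.2 ⟨r.num * s.den, ?_⟩
    rw [zsmul_eq_mul]
    push_cast
    rw [← div_eq_mul_inv, div_eq_iff (mul_ne_zero hr hs)]
    linear_combination -(s.den : ℚ) * Rat.mul_den_eq_num r
  · refine AddSubgroup.mem_zmultiples_iff.2 ⟨s.num * r.den, ?_⟩
    rw [zsmul_eq_mul]
    push_cast
    rw [← div_eq_mul_inv, div_eq_iff (mul_ne_zero hr hs)]
    linear_combination -(r.den : ℚ) * Rat.mul_den_eq_num s

theorem IsReconstructible.isTypeH {H : AddSubgroup ℚ} {c : ℚ → K}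
    (h : IsReconstructible σ V W A H c) (hW : IsTotalValuationRing W)
    (hbot : H ≠ ⊥) (htop : H ≠ ⊤)
    (hinv : ∀ s ∈ H, mulElem W.toAddSubgroup (c (-s)) =
      mulElem W.toAddSubgroup (autAt σ (-s) (c s)⁻¹))
    (hU : IsUnionOfLeftOrders A W) (hJ : jacobsonRad W * jacobsonRad W = jacobsonRad W) :
    IsTypeH σ V A := by
  have hG := (h.isConeFamily hW).isGradedExtension h.zero_eq
  obtain ⟨r, s, hr0, hs0, hr, hs, hrs⟩ := AddSubgroup.exists_pos_add_mem hbot htop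
  obtain ⟨t, ht0, hrt, hst⟩ := Rat.exists_mem_zmultiples r s
  refine ⟨hG, t, ht0, ⟨hG.restrict _, ⟨r, hrt⟩, ⟨s, hst⟩, hr0, hs0, ?_⟩, W, hU, hJ⟩
  have := h.mul_ne hW hr hs hrs (by linarith) (hinv _ hrs)
  rw [neg_add'] at this
  exact this

end Reconstruction

theorem theorem4p22 {K : Type*} [DivisionRing K] (V : Subring K) (hV : IsTotalValuationRing V)
    (hVK : V ≠ ⊤) (σ : Multiplicative ℚ →* RingAut K) (A : ℚ → AddSubgroup K)
    (hA0 : A 0 = V.toAddSubgroup) (W : Subring K) (hW : IsUnionOfLeftOrders A W)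
    (hJ : jacobsonRad W * jacobsonRad W = jacobsonRad W)
    (ht : ∃ t : ℚ, leftOrder (A t) = W) (H : Set ℚ) (hH : H = principalStarSet W A) :
    IsTypeH σ V A ↔
      ∃ c : ℚ → K,
        (∀ r ∈ H, ∀ s ∈ H,
          leftStar (jacobsonRad W * A s) = mulElem W.toAddSubgroup (c s) ∧
          mulElem W.toAddSubgroup (c s) = elemMul (c s) (imageAt σ s W.toAddSubgroup) ∧
          mulElem W.toAddSubgroup (c (-s)) =
            mulElem W.toAddSubgroup (autAt σ (-s) (c s)⁻¹) ∧
          mulElem W.toAddSubgroup (c r) * imageAt σ r (mulElem W.toAddSubgroup (c s)) =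
            mulElem W.toAddSubgroup (c (r + s))) ∧
        (∃ H' : AddSubgroup ℚ, (H' : Set ℚ) = H ∧ H' ≠ ⊥ ∧ H' ≠ ⊤ ∧
          IsGradedExtension (restrictHom σ H') V (fun s : H' => A s)) ∧
        (∀ s : ℚ, s ∉ H →
          leftStar (A s) = A s ∧ A s = W.toAddSubgroup * A s ∧
          (∀ a : K, A s ≠ mulElem W.toAddSubgroup a) ∧
          (rightOrder (A s)).toAddSubgroup = imageAt σ s W.toAddSubgroup) ∧
        IsGradedExtension σ V (modifiedComponents V W H c A) := by
  have hle : ∀ s, leftOrder (A s) ≤ W := by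
    intro s a ha
    rw [← SetLike.mem_coe, hW]
    exact Set.mem_iUnion.2 ⟨s, ha⟩
  have hVW : V ≤ W := by
    intro v hv
    refine hle 0 fun x hx => ?_
    rw [hA0] at hx ⊢
    exact V.mul_mem hv hx
  have hWV := hV.mono hVW
  subst hH
  obtain ⟨t, ht⟩ := ht
  refine ⟨fun h => h.exists_generators hV hVW hle hJ ht, ?_⟩
  rintro ⟨c, h1, ⟨H, hH, hbot, htop, hG⟩, h2, h3⟩
  rw [← hH] at h1 h2 h3
  have hJne : jacobsonRad W ≠ ⊥ := by
    intro h
    refine htop (eq_top_iff.2 fun s _ => ?_)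
    rw [← SetLike.mem_coe, hH]
    exact mem_principalStarSet_of_jacobsonRad_eq_bot h s
  obtain ⟨-, hmul, htot⟩ := (isGradedExtension_iff _).1 hG
  have hmulH : ∀ r ∈ H, ∀ s ∈ H, ∀ a ∈ A r, ∀ b ∈ A s, a * autAt σ r b ∈ A (r + s) :=
    fun r hr s hs a ha b hb => hmul ⟨r, hr⟩ ⟨s, hs⟩ a ha b hb
  have h0H := H.zero_mem
  have hmodH : ∀ s ∈ H, ∀ v ∈ V, ∀ a ∈ A s, v * a ∈ A s := by
    intro s hs v hv a ha
    have := hmulH 0 h0H s hs v (by rw [hA0]; exact hv) a ha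
    rwa [autAt_zero, zero_add] at this
  have hc : ∀ s ∈ H, c s ≠ 0 := fun s hs => generator_ne_zero (σ := σ) hA0 hJne
    (h1 0 h0H 0 h0H).1 (fun r hr s hs => (h1 r hr s hs).2.2.2) hs
  have hmodW : ∀ s ∉ H, ∀ w ∈ W, ∀ a ∈ A s, w * a ∈ A s := by
    intro s hs w hw a ha
    rw [(h2 s hs).2.1]
    exact mul_mem_addSubgroup_mul hw ha
  refine IsReconstructible.isTypeH (H := H) (c := c) ⟨hA0, hVW, fun s hs => ?_, fun s hs a => ?_,
    fun s hs a => ?_, hmulH, fun r hr a ha => htot ⟨r, hr⟩ a ha, h3.isConeFamily⟩ hWV hbot htop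
    (fun s hs => (h1 0 h0H s hs).2.2.1) hW hJ
  · obtain ⟨e1, e2, -⟩ := h1 0 h0H s hs
    exact isSandwiched_of_leftStar_eq hV hVW hJ (hmodH s hs) (hc s hs) e1 e2
  · exact exists_jacobsonRad_mul hWV (hmodW s hs) (h2 s hs).2.2.1
  · refine exists_mul_autAt_jacobsonRad hWV (hmodW s hs) (hle s) (fun w hw x hx => ?_)
      (h2 s hs).2.2.1
    have : autAt σ s w ∈ (rightOrder (A s)).toAddSubgroup := by
      rw [(h2 s hs).2.2.2, mem_imageAt, autAt_neg_autAt]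
      exact hw
    exact this x hx
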